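/- Let $n\ge 1$, $0<\alpha<n$, $1<p<\frac n\alpha$, let $q$ be given by $\frac1q+\frac\alpha n=\frac1p$, let $p'=\frac{p}{p-1}$, and let $m\ge 0$ be an integer. Cubes in $\mathbb R^n$ have sides parallel to the axes. For a measurable $w$ with $0<w<\infty$ a.e. put $$[w]_{A_{p,q}}=\sup_Q\Big(\frac1{|Q|}\int_Q w^q\Big)\Big(\frac1{|Q|}\int_Q w^{-p'}\Big)^{q/p'},$$ and write $w\in A_{p,q}$ if this is finite. For real $b\in L^1_{loc}(\mathbb R^n)$ put $\|b\|_{BMO}=\sup_Q\frac1{|Q|}\int_Q|b-b_Q|$, where $b_Q=\frac1{|Q|}\int_Q b$, and write $b\in BMO$ if this is finite. Let $\|f\|_{L^r(w^r)}=(\int|f|^rw^r)^{1/r}$, let $I_\alpha f(x)=\int_{\mathbb R^n}\frac{f(y)}{|x-y|^{n-\alpha}}\,dy$, and define $(I_\alpha)_b^0=I_\alpha$ and $(I_\alpha)_b^{k+1}f=b\,(I_\alpha)_b^{k}f-(I_\alpha)_b^{k}(bf)$. Functions $f$ are real or complex valued. 1. There is a constant $c$ depending only on $n,p,q$ (hence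 $\alpha$) and $m$ such that for all $w\in A_{p,q}$, $b\in BMO$ and $f\in L^p(w^p)$, the integrals $I_\alpha(b^jf)(x)$, $0\le j\le m$, converge absolutely for a.e. $x$, the function $(I_\alpha)_b^mf$ belongs to $L^q(w^q)$, and $$\|(I_\alpha)_b^mf\|_{L^q(w^q)}\le c\,\|b\|_{BMO}^m\,[w]_{A_{p,q}}^{(m+1-\frac\alpha n)\max\{1,\frac{p'}q\}}\,\|f\|_{L^p(w^p)}.$$ 2. The exponent of $[w]_{A_{p,q}}$ is sharp: if it is replaced by any smaller real number, the inequality fails for every constant $c$. It fails already for $b(x)=\log|x|$ (which is in $BMO$), with a power weight $w(x)=|x|^a\in A_{p,q}$ and a power function $f(x)=|x|^s\chi_S(x)\in L^p(w^p)$, where $S$ is the unit ball or its complement. 3. Conversely, let $m>0$, $w\in A_{p,q}$ and $b\in L^m_{loc}(\mathbb R^n)$ real valued. If there is a constant $c$ such that for every measurable set $E$ of finite measure $$\|(I_\alpha)_b^m\chi_E\|_{L^q(w^q)}\le c\Big(\int_Ew^p\Big)^{1/p},$$ then $b\in BMO$. -/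

import Mathlib

open MeasureTheory
open scoped ENNReal NNReal

namespace FracComm

noncomputable section

/-- The space `ℝⁿ` with its Euclidean norm and Lebesgue measure. -/
abbrev E (n : ℕ) : Type := EuclideanSpace ℝ (Fin n)

/-- The closed cube with sides parallel to the axes, lower corner `a` and side length `ℓ`. -/
def cube {n : ℕ} (a : E n) (ℓ : ℝ) : Set (E n) :=
  {x | ∀ i, a i ≤ x i ∧ x i ≤ a i + ℓ}

/-- `‖b‖_BMO = sup_Q |Q|⁻¹ ∫_Q |b - b_Q|`, the supremum over all cubes, with values in `[0, ∞]`. -/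
def bmoNorm {n : ℕ} (b : E n → ℝ) : ℝ≥0∞ :=
  ⨆ (a : E n) (ℓ : ℝ) (_ : 0 < ℓ),
    ⨍⁻ x in cube a ℓ, ‖b x - ⨍ y in cube a ℓ, b y ∂volume‖ₑ ∂volume

/-- `b ∈ BMO`. -/
def MemBMO {n : ℕ} (b : E n → ℝ) : Prop :=
  LocallyIntegrable b volume ∧ bmoNorm b < ∞

/-- `b ∈ L^m_loc`. -/
def MemLmLoc {n : ℕ} (m : ℕ) (b : E n → ℝ) : Prop :=
  ∀ K : Set (E n), IsCompact K → MemLp b (m : ℝ≥0∞) (volume.restrict K)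

/-- `[w]_{A_{p,q}} = sup_Q (|Q|⁻¹ ∫_Q w^q) (|Q|⁻¹ ∫_Q w^{-p'})^{q/p'}`, with values in `[0, ∞]`,
where `p' = p / (p - 1)`. -/
def apqConst {n : ℕ} (p q : ℝ) (w : E n → ℝ) : ℝ≥0∞ :=
  ⨆ (a : E n) (ℓ : ℝ) (_ : 0 < ℓ),
    (⨍⁻ x in cube a ℓ, ENNReal.ofReal (w x) ^ q ∂volume) *
      (⨍⁻ x in cube a ℓ, ENNReal.ofReal (w x) ^ (-p.conjExponent) ∂volume) ^ (q / p.conjExponent)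

/-- `w ∈ A_{p,q}`: a measurable, almost everywhere positive (and finite) function with
`[w]_{A_{p,q}} < ∞`. -/
def MemApq {n : ℕ} (p q : ℝ) (w : E n → ℝ) : Prop :=
  AEMeasurable w volume ∧ (∀ᵐ x ∂volume, 0 < w x) ∧ apqConst p q w < ∞

/-- The measure `w^r dx`. -/
def weightMeasure {n : ℕ} (w : E n → ℝ) (r : ℝ) : Measure (E n) :=
  volume.withDensity (fun x => ENNReal.ofReal (w x) ^ r)

/-- The norm of `L^r(w^r)`, that is `(∫ |f|^r w^r)^{1/r}`, with values in `[0, ∞]`. -/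
def wNorm {n : ℕ} {𝕜 : Type*} [RCLike 𝕜] (w : E n → ℝ) (r : ℝ) (f : E n → 𝕜) : ℝ≥0∞ :=
  eLpNorm f (ENNReal.ofReal r) (weightMeasure w r)

/-- `f ∈ L^r(w^r)`. -/
def MemWLp {n : ℕ} {𝕜 : Type*} [RCLike 𝕜] (w : E n → ℝ) (r : ℝ) (f : E n → 𝕜) : Prop :=
  MemLp f (ENNReal.ofReal r) (weightMeasure w r)

/-- The kernel `1 / |x - y|^{n - α}` of the fractional integral. -/
def rieszKernel {n : ℕ} (α : ℝ) (x y : E n) : ℝ :=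
  1 / ‖x - y‖ ^ ((n : ℝ) - α)

/-- The fractional integral `I_α f(x) = ∫ f(y) / |x - y|^{n - α} dy`. -/
def fracIntegral {n : ℕ} {𝕜 : Type*} [RCLike 𝕜] (α : ℝ) (f : E n → 𝕜) (x : E n) : 𝕜 :=
  ∫ y, rieszKernel α x y • f y ∂volume

/-- The commutator `[b, G] f = b G f - G (b f)`. -/
def opCommutator {n : ℕ} {𝕜 : Type*} [RCLike 𝕜] (b : E n → ℝ)
    (G : (E n → 𝕜) → E n → 𝕜) (f : E n → 𝕜) (x : E n) : 𝕜 :=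
  b x • G f x - G (fun y => b y • f y) x

/-- The iterated commutator: `G_b^0 = G` and `G_b^{m+1} = [b, G_b^m]`. -/
def iterCommutator {n : ℕ} {𝕜 : Type*} [RCLike 𝕜] (b : E n → ℝ)
    (G : (E n → 𝕜) → E n → 𝕜) : ℕ → (E n → 𝕜) → E n → 𝕜
  | 0 => G
  | m + 1 => opCommutator b (iterCommutator b G m)

/-- `(I_α)_b^m`. -/
def fracCommutator {n : ℕ} {𝕜 : Type*} [RCLike 𝕜] (α : ℝ) (b : E n → ℝ) (m : ℕ) :
    (E n → 𝕜) → E n → 𝕜 :=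
  iterCommutator b (fracIntegral α) m

/-- All the integrals that occur in `(I_α)_b^m f(x)`, namely `I_α (b^j f)(x)` for `0 ≤ j ≤ m`,
converge absolutely for almost every `x`. -/
def CommutatorConverges {n : ℕ} {𝕜 : Type*} [RCLike 𝕜] (α : ℝ) (b : E n → ℝ) (m : ℕ)
    (f : E n → 𝕜) : Prop :=
  ∀ᵐ x ∂(volume : Measure (E n)), ∀ j ≤ m,
    Integrable (fun y => rieszKernel α x y • (b y ^ j • f y)) volume

end

end FracComm

/-!
The weighted bound rests on an estimate for the fractional integral itself (the case `m = 0`). By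
the one-third trick its kernel is dominated by finitely many dyadic kernels
(`rieszKernel_le_sum_dyadic`), so a dyadic bilinear form for the measures `σ = w ^ (-p') dx` and
`u = w ^ q dx` has to be bounded (`sum_dyadic_form_le`). It is thinned out to a sparse family of
cubes, which satisfies a Carleson packing condition for both measures, and split into classes on
which the `A_{p,q}` quantity has a given dyadic size. Over one class, stopping times for the
averages of the two functions leave sums over stopping cubes, each of which is estimated by Hölder's
inequality with exponents `1 / p` and `1 - 1 / q` (`sum_class_le`). As `1 / p > 1 / q`, these exponents
add up to more than one, and the Carleson constant of only one of the two measures is needed, with a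
power `1 / q` or `1 / p'` (`sum_rpow_mul_rpow_le_of_sup`). The Carleson constants of `u` and `σ` are comparable to
`[w]` and `[w] ^ (p' / q)`, and the class bounds form a geometric series, which gives the exponent
`(1 - α / n) max {1, p' / q}` (`lintegral_rieszKernel_weight_le`).

For `m > 0` the commutator is the integral operator with kernel
`(b x - b y) ^ m / |x - y| ^ (n - α)`. The elementary inequality
`|t| ^ m ≤ m! ε ^ (-m) (exp (ε t) + exp (-ε t))` dominates it by two fractional integrals conjugated
by `exp (± ε b)`, that is, by the fractional integral for the weights `w exp (± ε b)`. A weighted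
John–Nirenberg inequality whose exponent is linear in the reciprocal of the constant of the measure
(`lintegral_exp_sub_average_le`) shows that these weights satisfy the `A_{p,q}` condition with a
constant comparable to `[w]` as long as `ε ‖b‖ [w] ^ max {1, p' / q}` is small
(`exists_memApq_mul_exp`). With the largest such `ε`, the factor `ε ^ (-m)` is exactly the additional
power of `‖b‖` and `[w]` (`exists_fracCommutator_bound`).

Sharpness is seen on power weights one of whose two densities, `w ^ (-p')` or `w ^ q`, has
exponent `d - n` with `d` small. The constant `[w]` is then at most a multiple of `d ^ (-q / p')` or
of `d ^ (-1)`. A power function on the unit ball, respectively on its complement, has a commutator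
with `log |x|` that gains `d ^ (-(m + 1))` pointwise, from the region where the logarithms differ by
at least `1 / d`; the ratio of the norms is at least a multiple of `d ^ (-(m + 1 - α / n))`
(`exists_extremalFamily_ball`, `exists_extremalFamily_compl_ball`, `ExtremalFamily.exists_lt`).

For the converse, let `t` be a median of `b` on a cube. If `x` and `y` lie on different sides of the
level `t`, then `b x - b y` has a constant sign and is at least `|b x - t|` in absolute value, so
there is no cancellation in the commutator of the indicator of one side, evaluated on the other
(`enorm_fracCommutator_indicator_ge`). The restricted bound, Hölder's inequality and the `A_{p,q}`
condition then bound the mean of `|b - t| ^ m` over the cube by a constant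
(`exists_lintegral_sub_pow_le`).
-/

namespace FracComm

open Filter Topology

section

/-! ### Finite nested families of sets and stopping levels -/

/-- Hölder's inequality for three sequences whose exponents add up to at least one. -/
theorem sum_rpow_mul_rpow_mul_rpow_le {ι : Type*} (s : Finset ι) (v u w : ι → ℝ)
    (hv : ∀ i ∈ s, 0 < v i) (hu : ∀ i ∈ s, 0 < u i) (hw : ∀ i ∈ s, 0 < w i)
    {a b c : ℝ} (ha : 0 ≤ a) (hb : 0 ≤ b) (hc : 0 ≤ c) (habc : 1 ≤ a + b + c) :
    ∑ i ∈ s, v i ^ a * u i ^ b * w i ^ c ≤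
      (∑ i ∈ s, v i) ^ a * (∑ i ∈ s, u i) ^ b * (∑ i ∈ s, w i) ^ c := by
  rcases s.eq_empty_or_nonempty with rfl | hs
  · simp only [Finset.sum_empty]; positivity
  set V := ∑ i ∈ s, v i with hV
  set U := ∑ i ∈ s, u i with hU
  set W := ∑ i ∈ s, w i with hW
  have hVp : 0 < V := Finset.sum_pos hv hs
  have hUp : 0 < U := Finset.sum_pos hu hs
  have hWp : 0 < W := Finset.sum_pos hw hs
  set t := a + b + c with ht
  have htp : 0 < t := by linarith
  have key : ∀ i ∈ s, v i ^ a * u i ^ b * w i ^ c ≤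
      (V ^ a * U ^ b * W ^ c) * (a / t * (v i / V) + b / t * (u i / U) + c / t * (w i / W)) := by
    intro i hi
    have h1 := hv i hi
    have h2 := hu i hi
    have h3 := hw i hi
    have l1 : v i / V ≤ 1 := (div_le_one hVp).2 (Finset.single_le_sum (fun j hj => (hv j hj).le) hi)
    have l2 : u i / U ≤ 1 := (div_le_one hUp).2 (Finset.single_le_sum (fun j hj => (hu j hj).le) hi)
    have l3 : w i / W ≤ 1 := (div_le_one hWp).2 (Finset.single_le_sum (fun j hj => (hw j hj).le) hi)
    have am := Real.geom_mean_le_arith_mean3_weighted (w₁ := a / t) (w₂ := b / t) (w₃ := c / t)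
      (p₁ := v i / V) (p₂ := u i / U) (p₃ := w i / W)
      (by positivity) (by positivity) (by positivity) (by positivity) (by positivity)
      (by positivity) (by field_simp; exact ht.symm)
    have e1 : ∀ {x : ℝ} (y : ℝ), 0 < x → x ^ y = (x ^ (y / t)) ^ t := by
      intro x y hx
      rw [← Real.rpow_mul hx.le]; congr 1; field_simp
    have hprod : (v i / V) ^ a * (u i / U) ^ b * (w i / W) ^ c ≤
        (v i / V) ^ (a / t) * (u i / U) ^ (b / t) * (w i / W) ^ (c / t) := by
      rw [e1 a (div_pos h1 hVp), e1 b (div_pos h2 hUp), e1 c (div_pos h3 hWp),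
        ← Real.mul_rpow (by positivity) (by positivity),
        ← Real.mul_rpow (by positivity) (by positivity)]
      have hle : (v i / V) ^ (a / t) * (u i / U) ^ (b / t) * (w i / W) ^ (c / t) ≤ 1 := by
        have m1 := Real.rpow_le_one (z := a / t) (by positivity) l1 (by positivity)
        have m2 := Real.rpow_le_one (z := b / t) (by positivity) l2 (by positivity)
        have m3 := Real.rpow_le_one (z := c / t) (by positivity) l3 (by positivity)
        exact mul_le_one₀ (mul_le_one₀ m1 (by positivity) m2) (by positivity) m3
      exact (Real.rpow_le_rpow_of_exponent_ge (by positivity) hle habc).trans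
        (by rw [Real.rpow_one])
    have hfac : v i ^ a * u i ^ b * w i ^ c =
        (V ^ a * U ^ b * W ^ c) * ((v i / V) ^ a * (u i / U) ^ b * (w i / W) ^ c) := by
      rw [Real.div_rpow h1.le hVp.le, Real.div_rpow h2.le hUp.le, Real.div_rpow h3.le hWp.le]
      field_simp
    rw [hfac]
    exact mul_le_mul_of_nonneg_left (hprod.trans am) (by positivity)
  refine (Finset.sum_le_sum key).trans (le_of_eq ?_)
  rw [← Finset.mul_sum, Finset.sum_add_distrib, Finset.sum_add_distrib, ← Finset.mul_sum,
    ← Finset.mul_sum, ← Finset.mul_sum, ← Finset.sum_div, ← Finset.sum_div, ← Finset.sum_div,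
    ← hV, ← hU, ← hW, div_self hVp.ne', div_self hUp.ne', div_self hWp.ne']
  have : a / t * 1 + b / t * 1 + c / t * 1 = 1 := by field_simp; exact ht.symm
  rw [this, mul_one]

theorem sum_rpow_mul_rpow_le {ι : Type*} (s : Finset ι) (v u : ι → ℝ)
    (hv : ∀ i ∈ s, 0 < v i) (hu : ∀ i ∈ s, 0 < u i)
    {a b : ℝ} (ha : 0 ≤ a) (hb : 0 ≤ b) (hab : 1 ≤ a + b) :
    ∑ i ∈ s, v i ^ a * u i ^ b ≤ (∑ i ∈ s, v i) ^ a * (∑ i ∈ s, u i) ^ b := by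
  simpa using sum_rpow_mul_rpow_mul_rpow_le s v u v hv hu hv ha hb le_rfl (by simpa using hab)

theorem sum_pow_le_of_injOn {ι : Type*} (s : Finset ι) (g : ι → ℕ) (hg : Set.InjOn g s)
    {r : ℝ} (h0 : 0 ≤ r) (h1 : r < 1) : ∑ i ∈ s, r ^ g i ≤ (1 - r)⁻¹ := by
  classical
  rw [← Finset.sum_image (f := fun m => r ^ m) hg, ← tsum_geometric_of_lt_one h0 h1]
  exact Summable.sum_le_tsum _ (fun _ _ => by positivity) (summable_geometric_of_lt_one h0 h1)

/-- A geometric sum over dyadic numbers below a threshold is comparable with its last term. -/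
theorem sum_zpow_rpow_le (I : Finset ℤ) {e y : ℝ} (he : 0 < e) (hy : 0 < y)
    (hI : ∀ i ∈ I, (2 : ℝ) ^ i ≤ y) :
    ∑ i ∈ I, ((2 : ℝ) ^ i) ^ e ≤ (1 - (2 : ℝ) ^ (-e))⁻¹ * y ^ e := by
  have hr1 : (2 : ℝ) ^ (-e) < 1 := Real.rpow_lt_one_of_one_lt_of_neg (by norm_num) (by linarith)
  have hr0 : 0 ≤ (2 : ℝ) ^ (-e) := by positivity
  set i₀ := Int.log 2 y with hi₀
  have hle : ∀ i ∈ I, i ≤ i₀ := fun i hi =>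
    (Int.zpow_le_iff_le_log (b := 2) (by norm_num) hy).1 (by exact_mod_cast hI i hi)
  have hi₀y : (2 : ℝ) ^ i₀ ≤ y := by
    exact_mod_cast Int.zpow_log_le_self (b := 2) (by norm_num) hy
  have hinj : Set.InjOn (fun i : ℤ => (i₀ - i).toNat) I := by
    intro i hi j hj h
    have := hle i hi; have := hle j hj
    simp only at h; omega
  have hterm : ∀ i ∈ I, ((2 : ℝ) ^ i) ^ e = ((2 : ℝ) ^ i₀) ^ e * ((2 : ℝ) ^ (-e)) ^ (i₀ - i).toNat := by
    intro i hi
    have h := hle i hi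
    rw [← Real.rpow_intCast, ← Real.rpow_intCast, ← Real.rpow_natCast, ← Real.rpow_mul (by norm_num),
      ← Real.rpow_mul (by norm_num), ← Real.rpow_mul (by norm_num), ← Real.rpow_add (by norm_num)]
    congr 1
    have : (((i₀ - i).toNat : ℕ) : ℝ) = (i₀ : ℝ) - i := by
      have : (((i₀ - i).toNat : ℕ) : ℤ) = i₀ - i := Int.toNat_of_nonneg (by omega)
      exact_mod_cast this
    rw [this]; ring
  rw [Finset.sum_congr rfl hterm, ← Finset.mul_sum, mul_comm]
  have hinv : 0 ≤ (1 - (2 : ℝ) ^ (-e))⁻¹ := inv_nonneg.2 (by linarith)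
  exact mul_le_mul (sum_pow_le_of_injOn I _ hinj hr0 hr1)
    (Real.rpow_le_rpow (by positivity) hi₀y he.le) (by positivity) hinv

variable {X : Type*}

/-- Any two members of the family are disjoint or one of them contains the other. -/
def IsNested (S : Finset (Set X)) : Prop :=
  ∀ Q ∈ S, ∀ R ∈ S, Q ⊆ R ∨ R ⊆ Q ∨ Disjoint Q R

theorem IsNested.subset {S T : Finset (Set X)} (hS : IsNested S) (h : T ⊆ S) : IsNested T :=
  fun Q hQ R hR => hS Q (h hQ) R (h hR)

/-- `R` is maximal among the members of `S` that carry the same label as `R`, in the strong sense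
that no larger member of `S` has this label. -/
def IsTop {β : Type*} (S : Finset (Set X)) (lab : Set X → β) (R : Set X) : Prop :=
  ∀ R' ∈ S, R ⊂ R' → lab R' ≠ lab R

theorem exists_isTop {β : Type*} {S : Finset (Set X)} (lab : Set X → β) {Q : Set X} (hQ : Q ∈ S) :
    ∃ R ∈ S, Q ⊆ R ∧ lab Q = lab R ∧ IsTop S lab R := by
  classical
  obtain ⟨R, hR, hmax⟩ := (S.filter (fun R => Q ⊆ R ∧ lab Q = lab R)).exists_maximal
    ⟨Q, by simp [hQ]⟩
  simp only [Finset.mem_filter] at hR hmax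
  refine ⟨R, hR.1, hR.2.1, hR.2.2, fun R' hR' hRR' heq => ?_⟩
  exact hRR'.2 (hmax ⟨hR', hR.2.1.trans hRR'.1, hR.2.2.trans heq.symm⟩ hRR'.1)

open Classical in
/-- A sum over the family is dominated by grouping each member under a top with the same label that
contains it. -/
theorem sum_le_sum_isTop {β : Type*} (S : Finset (Set X)) (lab : Set X → β) (a : Set X → ℝ)
    (ha : ∀ Q ∈ S, 0 ≤ a Q) :
    ∑ Q ∈ S, a Q ≤ ∑ R ∈ S.filter (IsTop S lab),
      ∑ Q ∈ S.filter (fun Q => Q ⊆ R ∧ lab Q = lab R), a Q := by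
  have h : ∀ Q : Set X, ∃ R, Q ∈ S → (R ∈ S ∧ Q ⊆ R ∧ lab Q = lab R ∧ IsTop S lab R) := by
    intro Q
    by_cases hQ : Q ∈ S
    · obtain ⟨R, h1, h2⟩ := exists_isTop lab hQ
      exact ⟨R, fun _ => ⟨h1, h2⟩⟩
    · exact ⟨Q, fun h => absurd h hQ⟩
  choose ρ hρ using h
  rw [← Finset.sum_fiberwise_of_maps_to (s := S) (t := S.filter (IsTop S lab)) (g := ρ)
    (fun Q hQ => by simp [(hρ Q hQ).1, (hρ Q hQ).2.2.2])]
  refine Finset.sum_le_sum fun R _ => ?_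
  refine Finset.sum_le_sum_of_subset_of_nonneg (fun Q hQ => ?_) (fun Q hQ _ => ha Q ?_)
  · simp only [Finset.mem_filter] at hQ ⊢
    obtain ⟨h1, rfl⟩ := hQ
    exact ⟨h1, (hρ Q h1).2.1, (hρ Q h1).2.2.1⟩
  · exact (Finset.mem_filter.1 hQ).1

/-- The stopping levels of a positive function `φ` on a finite family of sets: `L Q` is the dyadic
size of the largest value of `φ` on the members containing `Q`. -/
theorem exists_level (S : Finset (Set X)) (φ : Set X → ℝ) (hφ : ∀ Q ∈ S, 0 < φ Q) :
    ∃ L : Set X → ℤ, (∀ Q ∈ S, ∀ R ∈ S, Q ⊆ R → L R ≤ L Q) ∧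
      (∀ Q ∈ S, φ Q < 2 ^ (L Q + 1)) ∧
      (∀ Q ∈ S, IsTop S L Q → (2 : ℝ) ^ (L Q) ≤ φ Q) := by
  classical
  let F : Set X → Finset (Set X) := fun Q => S.filter (fun R => Q ⊆ R)
  let L : Set X → ℤ := fun Q =>
    if h : (F Q).Nonempty then (F Q).sup' h (fun R => Int.log 2 (φ R)) else 0
  have hne : ∀ Q ∈ S, (F Q).Nonempty := fun Q hQ => ⟨Q, by simp [F, hQ]⟩
  have hL : ∀ Q (hQ : Q ∈ S), L Q = (F Q).sup' (hne Q hQ) (fun R => Int.log 2 (φ R)) :=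
    fun Q hQ => dif_pos (hne Q hQ)
  have hanti : ∀ Q ∈ S, ∀ R ∈ S, Q ⊆ R → L R ≤ L Q := by
    intro Q hQ R hR h
    rw [hL Q hQ, hL R hR]
    refine Finset.sup'_mono _ (fun T hT => ?_) _
    simp only [F, Finset.mem_filter] at hT ⊢
    exact ⟨hT.1, h.trans hT.2⟩
  refine ⟨L, hanti, ?_, ?_⟩
  · intro Q hQ
    have h1 : Int.log 2 (φ Q) ≤ L Q := by
      rw [hL Q hQ]
      exact Finset.le_sup' (fun R => Int.log 2 (φ R)) (by simp [F, hQ])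
    have h2 : φ Q < (2 : ℝ) ^ (Int.log 2 (φ Q) + 1) := by
      exact_mod_cast Int.lt_zpow_succ_log_self (b := 2) (by norm_num) (φ Q)
    exact h2.trans_le (zpow_le_zpow_right₀ (by norm_num) (by omega))
  · intro Q hQ htop
    obtain ⟨R, hR, hmax⟩ := Finset.exists_mem_eq_sup' (hne Q hQ) (fun R => Int.log 2 (φ R))
    rw [← hL Q hQ] at hmax
    simp only [F, Finset.mem_filter] at hR
    have hLR : L R = L Q := by
      refine le_antisymm (hanti Q hQ R hR.1 hR.2) ?_
      rw [hmax, hL R hR.1]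
      exact Finset.le_sup' (fun R => Int.log 2 (φ R)) (by simp [F, hR.1])
    have hQR : R = Q := by
      by_contra hne'
      exact htop R hR.1 (LE.le.ssubset_of_ne hR.2 (Ne.symm hne')) hLR
    subst hQR
    rw [hmax]
    exact_mod_cast Int.zpow_log_le_self (b := 2) (by norm_num) (hφ R hQ)

/-- Within a class of sets on which `U ^ a * Sg ^ b` is comparable with `τ * V ^ (a + b)`, and along
which `V` decays geometrically from generation to generation, a sum over all descendants is
dominated by its top term. -/
theorem sum_descendants_le (X : Type*) {a b : ℝ} (ha : 0 < a) (ha1 : a < 1) (hb : 0 < b)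
    (hb1 : b < 1) (hab : a + b < 1) :
    ∃ C : ℝ, 0 < C ∧ ∀ (S : Finset (Set X)) (V U Sg : Set X → ℝ),
      (∀ Q ∈ S, 0 < V Q) → (∀ Q ∈ S, 0 < U Q) → (∀ Q ∈ S, 0 < Sg Q) →
      ∀ (l : Set X → ℤ) (τ : ℝ), 0 < τ →
      (∀ Q ∈ S, τ * V Q ^ (a + b) ≤ U Q ^ a * Sg Q ^ b) →
      (∀ Q ∈ S, U Q ^ a * Sg Q ^ b ≤ 2 * τ * V Q ^ (a + b)) →
      ∀ R ∈ S, ∀ T ⊆ S, (∀ Q ∈ T, l R ≤ l Q) →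
      (∀ m : ℕ, ∑ Q ∈ T with l Q = l R + m, V Q ≤ 2 * (1 / 2) ^ m * V R) →
      (∀ m : ℕ, ∑ Q ∈ T with l Q = l R + m, U Q ≤ U R) →
      (∀ m : ℕ, ∑ Q ∈ T with l Q = l R + m, Sg Q ≤ Sg R) →
      ∑ Q ∈ T, U Q ^ (1 - a) * Sg Q ^ (1 - b) ≤ C * (U R ^ (1 - a) * Sg R ^ (1 - b)) := by
  -- `U ^ a * Sg ^ b` is exchanged for `τ * V ^ (a + b)` to the largest power `t` that leaves
  -- nonnegative powers of `U` and `Sg`; the power of `V` produces the geometric decay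
  set t := min ((1 - a) / a) ((1 - b) / b) with ht
  have htp : 0 < t := lt_min (div_pos (by linarith) ha) (div_pos (by linarith) hb)
  have hta : t * a ≤ 1 - a := by
    have := min_le_left ((1 - a) / a) ((1 - b) / b)
    rwa [← ht, le_div_iff₀ ha] at this
  have htb : t * b ≤ 1 - b := by
    have := min_le_right ((1 - a) / a) ((1 - b) / b)
    rwa [← ht, le_div_iff₀ hb] at this
  set r : ℝ := (1 / 2 : ℝ) ^ ((a + b) * t) with hr
  have hr0 : 0 ≤ r := by positivity
  have hr1 : r < 1 := Real.rpow_lt_one (by norm_num) (by norm_num) (by positivity)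
  have hr1' : 0 < 1 - r := by linarith
  refine ⟨(2 : ℝ) ^ t * (2 : ℝ) ^ ((a + b) * t) * (1 - r)⁻¹, by positivity, ?_⟩
  intro S V U Sg hVp hUp hSp l τ hτ hlo hhi R hR T hTS hl hV hU hS
  have hUR := hUp R hR
  have hSR := hSp R hR
  have hVR := hVp R hR
  have hgen : ∀ m : ℕ, ∑ Q ∈ T with l Q = l R + m, U Q ^ (1 - a) * Sg Q ^ (1 - b) ≤
      (2 : ℝ) ^ t * (2 : ℝ) ^ ((a + b) * t) * r ^ m * (U R ^ (1 - a) * Sg R ^ (1 - b)) := by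
    intro m
    set G := T.filter (fun Q => l Q = l R + m)
    have hGS : ∀ Q ∈ G, Q ∈ S := fun Q hQ => hTS (Finset.mem_filter.1 hQ).1
    have h1 : ∀ Q ∈ G, U Q ^ (1 - a) * Sg Q ^ (1 - b) ≤ (2 * τ) ^ t *
        (V Q ^ ((a + b) * t) * U Q ^ (1 - a - t * a) * Sg Q ^ (1 - b - t * b)) := by
      intro Q hQ
      have hu := hUp Q (hGS Q hQ)
      have hs := hSp Q (hGS Q hQ)
      have hv := hVp Q (hGS Q hQ)
      have e : U Q ^ (1 - a) * Sg Q ^ (1 - b) =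
          (U Q ^ a * Sg Q ^ b) ^ t * (U Q ^ (1 - a - t * a) * Sg Q ^ (1 - b - t * b)) := by
        rw [Real.mul_rpow (by positivity) (by positivity), ← Real.rpow_mul hu.le,
          ← Real.rpow_mul hs.le, mul_mul_mul_comm, ← Real.rpow_add hu, ← Real.rpow_add hs]
        congr 2 <;> ring
      have e2 : (2 * τ) ^ t * V Q ^ ((a + b) * t) = (2 * τ * V Q ^ (a + b)) ^ t := by
        rw [Real.mul_rpow (x := 2 * τ) (by positivity) (by positivity), ← Real.rpow_mul hv.le]
      rw [e]
      calc _ ≤ (2 * τ * V Q ^ (a + b)) ^ t * (U Q ^ (1 - a - t * a) * Sg Q ^ (1 - b - t * b)) := by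
            refine mul_le_mul_of_nonneg_right ?_ (by positivity)
            exact Real.rpow_le_rpow (by positivity) (hhi Q (hGS Q hQ)) htp.le
        _ = _ := by rw [← e2]; ring
    -- the three exponents add up to `2 - (a + b) ≥ 1`
    have h2 := sum_rpow_mul_rpow_mul_rpow_le G V U Sg (fun Q hQ => hVp Q (hGS Q hQ))
      (fun Q hQ => hUp Q (hGS Q hQ)) (fun Q hQ => hSp Q (hGS Q hQ))
      (a := (a + b) * t) (b := 1 - a - t * a) (c := 1 - b - t * b)
      (by positivity) (by linarith) (by linarith) (by nlinarith)
    have hVG : 0 ≤ ∑ Q ∈ G, V Q := Finset.sum_nonneg fun Q hQ => (hVp Q (hGS Q hQ)).le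
    have hUG : 0 ≤ ∑ Q ∈ G, U Q := Finset.sum_nonneg fun Q hQ => (hUp Q (hGS Q hQ)).le
    have hSG : 0 ≤ ∑ Q ∈ G, Sg Q := Finset.sum_nonneg fun Q hQ => (hSp Q (hGS Q hQ)).le
    calc ∑ Q ∈ G, U Q ^ (1 - a) * Sg Q ^ (1 - b)
        ≤ ∑ Q ∈ G, (2 * τ) ^ t *
        (V Q ^ ((a + b) * t) * U Q ^ (1 - a - t * a) * Sg Q ^ (1 - b - t * b)) :=
          Finset.sum_le_sum h1
      _ ≤ (2 * τ) ^ t * ((2 * (1 / 2) ^ m * V R) ^ ((a + b) * t) * U R ^ (1 - a - t * a) *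
            Sg R ^ (1 - b - t * b)) := by
          rw [← Finset.mul_sum]
          refine mul_le_mul_of_nonneg_left (h2.trans ?_) (by positivity)
          have i1 := hV m
          have i2 := hU m
          have i3 := hS m
          have j1 : 0 ≤ 1 - a - t * a := by linarith
          have j2 : 0 ≤ 1 - b - t * b := by linarith
          gcongr
      _ = (2 : ℝ) ^ t * (2 : ℝ) ^ ((a + b) * t) * r ^ m * ((τ * V R ^ (a + b)) ^ t *
            (U R ^ (1 - a - t * a) * Sg R ^ (1 - b - t * b))) := by
          rw [Real.mul_rpow (by positivity) hτ.le, Real.mul_rpow (by positivity) hVR.le,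
            Real.mul_rpow (by positivity) (by positivity), Real.mul_rpow hτ.le (by positivity),
            ← Real.rpow_mul hVR.le, hr, ← Real.rpow_natCast, ← Real.rpow_natCast,
            ← Real.rpow_mul (by norm_num), ← Real.rpow_mul (by norm_num), mul_comm (m : ℝ)]
          ring
      _ ≤ (2 : ℝ) ^ t * (2 : ℝ) ^ ((a + b) * t) * r ^ m * ((U R ^ a * Sg R ^ b) ^ t *
            (U R ^ (1 - a - t * a) * Sg R ^ (1 - b - t * b))) := by
          have := hlo R hR
          gcongr
      _ = _ := by
          congr 1
          rw [Real.mul_rpow (by positivity) (by positivity), ← Real.rpow_mul hUR.le,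
            ← Real.rpow_mul hSR.le, mul_mul_mul_comm, ← Real.rpow_add hUR, ← Real.rpow_add hSR]
          congr 2 <;> ring
  classical
  set I := T.image l
  have hinj : Set.InjOn (fun i : ℤ => (i - l R).toNat) I := by
    intro i hi j hj h
    simp only [I, Finset.coe_image, Set.mem_image, Finset.mem_coe] at hi hj
    obtain ⟨Q, hQ, rfl⟩ := hi
    obtain ⟨Q', hQ', rfl⟩ := hj
    have := hl Q hQ; have := hl Q' hQ'
    simp only at h; omega
  calc ∑ Q ∈ T, U Q ^ (1 - a) * Sg Q ^ (1 - b)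
      = ∑ i ∈ I, ∑ Q ∈ T with l Q = i, U Q ^ (1 - a) * Sg Q ^ (1 - b) :=
        (Finset.sum_fiberwise_of_maps_to (fun Q hQ => Finset.mem_image_of_mem l hQ) _).symm
    _ ≤ ∑ i ∈ I, (2 : ℝ) ^ t * (2 : ℝ) ^ ((a + b) * t) * (U R ^ (1 - a) * Sg R ^ (1 - b)) *
          r ^ (i - l R).toNat := by
        refine Finset.sum_le_sum fun i hi => ?_
        have hge : l R ≤ i := by
          obtain ⟨Q, hQ, rfl⟩ := Finset.mem_image.1 hi
          exact hl Q hQ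
        have := hgen (i - l R).toNat
        rw [Int.toNat_of_nonneg (by omega), add_sub_cancel] at this
        refine this.trans (le_of_eq (by ring))
    _ ≤ (2 : ℝ) ^ t * (2 : ℝ) ^ ((a + b) * t) * (U R ^ (1 - a) * Sg R ^ (1 - b)) * (1 - r)⁻¹ := by
        rw [← Finset.mul_sum]
        gcongr
        exact sum_pow_le_of_injOn I _ hinj hr0 hr1
    _ = _ := by ring

/-- Off-diagonal Hölder inequality: because `(1 - b) + (1 - a) > 1`, the bound on the sum of the
`x i` only enters with the power `a`. -/
theorem sum_rpow_mul_rpow_le_of_sup {ι : Type*} (T : Finset ι) (x y : ι → ℝ)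
    (hx : ∀ i ∈ T, 0 < x i) (hy : ∀ i ∈ T, 0 < y i) {a b N A B : ℝ} (ha : 0 < a) (ha1 : a < 1)
    (hab : a + b < 1) (hN : 0 ≤ N) (hA : 0 < A)
    (hxN : ∑ i ∈ T, x i ≤ N * A) (hxA : ∀ i ∈ T, x i ≤ A) (hyB : ∑ i ∈ T, y i ≤ B) :
    ∑ i ∈ T, x i ^ (1 - b) * y i ^ (1 - a) ≤ N ^ a * (A ^ (1 - b) * B ^ (1 - a)) := by
  have hy0 : 0 ≤ ∑ i ∈ T, y i := Finset.sum_nonneg fun i hi => (hy i hi).le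
  have hx0 : 0 ≤ ∑ i ∈ T, x i := Finset.sum_nonneg fun i hi => (hx i hi).le
  have ha1' : 0 ≤ 1 - a := by linarith
  calc ∑ i ∈ T, x i ^ (1 - b) * y i ^ (1 - a)
      ≤ ∑ i ∈ T, A ^ (1 - b - a) * (x i ^ a * y i ^ (1 - a)) := by
        refine Finset.sum_le_sum fun i hi => ?_
        have h1 := hx i hi
        have h2 := hy i hi
        have e : x i ^ (1 - b) = x i ^ (1 - b - a) * x i ^ a := by
          rw [← Real.rpow_add h1]; congr 1; ring
        rw [e, mul_assoc]
        have h3 : 0 ≤ 1 - b - a := by linarith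
        gcongr
        exact hxA i hi
    _ ≤ A ^ (1 - b - a) * ((N * A) ^ a * B ^ (1 - a)) := by
        rw [← Finset.mul_sum]
        refine mul_le_mul_of_nonneg_left ((sum_rpow_mul_rpow_le T x y hx hy ha.le ha1'
          (by linarith)).trans ?_) (by positivity)
        gcongr
    _ = _ := by
        have e : A ^ (1 - b) = A ^ (1 - b - a) * A ^ a := by
          rw [← Real.rpow_add hA]; congr 1; ring
        rw [Real.mul_rpow hN hA.le, e]; ring

end

section

variable {X : Type*}

/-! ### Carleson families and the stopping-time bound for one class of cubes -/

theorem IsNested.disjoint_of_level {S : Finset (Set X)} (hS : IsNested S) {l : Set X → ℤ}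
    (hl : ∀ Q ∈ S, ∀ R ∈ S, Q ⊂ R → l R < l Q) {Q R : Set X} (hQ : Q ∈ S) (hR : R ∈ S)
    (hne : Q ≠ R) (h : l Q = l R) : Disjoint Q R := by
  rcases hS Q hQ R hR with h1 | h1 | h1
  · have := hl Q hQ R hR (LE.le.ssubset_of_ne h1 hne); omega
  · have := hl R hR Q hQ (LE.le.ssubset_of_ne h1 hne.symm); omega
  · exact h1

theorem IsNested.disjoint_of_isTop {β : Type*} {S : Finset (Set X)} (hS : IsNested S)
    {lab : Set X → β} {Q R : Set X} (hQ : Q ∈ S) (hR : R ∈ S) (hQt : IsTop S lab Q)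
    (hRt : IsTop S lab R) (hne : Q ≠ R) (h : lab Q = lab R) : Disjoint Q R := by
  rcases hS Q hQ R hR with h1 | h1 | h1
  · exact absurd h.symm (hQt R hR (LE.le.ssubset_of_ne h1 hne))
  · exact absurd h (hRt Q hQ (LE.le.ssubset_of_ne h1 hne.symm))
  · exact h1

variable [MeasurableSpace X]

theorem sum_measureReal_le_of_disjoint (ν : Measure X) (T : Finset (Set X)) (A : Set X)
    (hA : ν A ≠ ∞) (hT : ∀ Q ∈ T, MeasurableSet Q ∧ Q ⊆ A)
    (hd : ∀ Q ∈ T, ∀ R ∈ T, Q ≠ R → Disjoint Q R) : ∑ Q ∈ T, ν.real Q ≤ ν.real A := by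
  have h := measureReal_biUnion_finset (μ := ν) (s := T) (f := id)
    (fun Q hQ R hR hne => hd Q hQ R hR hne) (fun Q hQ => (hT Q hQ).1)
    (fun Q hQ => ((measure_mono (hT Q hQ).2).trans_lt hA.lt_top).ne)
  simp only [id] at h
  rw [← h]
  exact measureReal_mono (Set.iUnion₂_subset fun Q hQ => (hT Q hQ).2) hA

/-- A family whose generations shrink geometrically for `μ` satisfies a Carleson packing condition
for every measure `ν` that gives each cube at most `N` times the mass of any subset carrying half of
its `μ`-mass. Removing from each cube the cubes at least three generations below it leaves such a
subset, and the subsets so obtained overlap at most three times. -/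
theorem sum_measureReal_le_of_sparse (μ ν : Measure X) {S : Finset (Set X)} (hS : IsNested S)
    (hm : ∀ Q ∈ S, MeasurableSet Q) (hμ : ∀ Q ∈ S, μ Q ≠ ∞) (hν : ∀ Q ∈ S, ν Q ≠ ∞)
    {l : Set X → ℤ} (hl : ∀ Q ∈ S, ∀ R ∈ S, Q ⊂ R → l R < l Q)
    (hgen : ∀ R ∈ S, ∀ m : ℕ, ∀ T ⊆ S, (∀ Q ∈ T, Q ⊆ R ∧ l Q = l R + m) →
      ∑ Q ∈ T, μ.real Q ≤ 2 * (1 / 2) ^ m * μ.real R)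
    {N : ℝ} (hN : 0 ≤ N) (hνN : ∀ Q ∈ S, ∀ E ⊆ Q, MeasurableSet E → μ.real Q ≤ 2 * μ.real E →
      ν.real Q ≤ N * ν.real E) (T : Finset (Set X)) (hT : T ⊆ S) :
    ∑ Q ∈ T, ν.real Q ≤ 3 * N * ν.real (⋃ Q ∈ T, Q) := by
  classical
  let D : Set X → Finset (Set X) := fun Q => S.filter (fun R => R ⊆ Q ∧ l Q + 3 ≤ l R)
  let E : Set X → Set X := fun Q => Q \ ⋃ R ∈ D Q, R
  have hEm : ∀ Q ∈ S, MeasurableSet (E Q) := fun Q hQ =>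
    (hm Q hQ).diff (Finset.measurableSet_biUnion _ fun R hR => hm R (Finset.mem_filter.1 hR).1)
  have hEQ : ∀ Q, E Q ⊆ Q := fun Q => Set.sdiff_subset
  have hsmall : ∀ Q ∈ S, μ.real (⋃ R ∈ D Q, R) ≤ 1 / 2 * μ.real Q := by
    intro Q hQ
    have hDS : ∀ R ∈ D Q, R ∈ S ∧ R ⊆ Q ∧ l Q + 3 ≤ l R := fun R hR => Finset.mem_filter.1 hR
    refine (measureReal_biUnion_finset_le (D Q) id).trans ?_
    simp only [id]
    set I := (D Q).image l
    have hI : ∀ i ∈ I, l Q + 3 ≤ i := by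
      intro i hi
      obtain ⟨R, hR, rfl⟩ := Finset.mem_image.1 hi
      exact (hDS R hR).2.2
    have hinj : Set.InjOn (fun i : ℤ => (i - (l Q + 3)).toNat) I := by
      intro i hi j hj h
      have := hI i hi; have := hI j hj
      simp only at h; omega
    calc ∑ R ∈ D Q, μ.real R
        = ∑ i ∈ I, ∑ R ∈ D Q with l R = i, μ.real R :=
          (Finset.sum_fiberwise_of_maps_to (fun R hR => Finset.mem_image_of_mem l hR) _).symm
      _ ≤ ∑ i ∈ I, 1 / 4 * μ.real Q * (1 / 2) ^ (i - (l Q + 3)).toNat := by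
          refine Finset.sum_le_sum fun i hi => ?_
          have h3 := hI i hi
          have := hgen Q hQ ((i - (l Q + 3)).toNat + 3) ((D Q).filter (fun R => l R = i))
            (fun R hR => (hDS R (Finset.mem_filter.1 hR).1).1)
            (fun R hR => ⟨(hDS R (Finset.mem_filter.1 hR).1).2.1, by
              rw [(Finset.mem_filter.1 hR).2]; push_cast
              rw [Int.toNat_of_nonneg (by omega)]; ring⟩)
          refine this.trans (le_of_eq ?_)
          rw [pow_add]; ring
      _ ≤ 1 / 4 * μ.real Q * (1 - 1 / 2)⁻¹ := by
          rw [← Finset.mul_sum]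
          refine mul_le_mul_of_nonneg_left ?_ (by positivity)
          exact sum_pow_le_of_injOn I _ hinj (by norm_num) (by norm_num)
      _ = _ := by ring
  have hQE : ∀ Q ∈ S, ν.real Q ≤ N * ν.real (E Q) := by
    intro Q hQ
    refine hνN Q hQ _ (hEQ Q) (hEm Q hQ) ?_
    have hUQ : (⋃ R ∈ D Q, R) ⊆ Q := Set.iUnion₂_subset fun R hR => (Finset.mem_filter.1 hR).2.1
    have := measureReal_sdiff (μ := μ) hUQ
      (Finset.measurableSet_biUnion _ fun R hR => hm R (Finset.mem_filter.1 hR).1)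
      (hμ Q hQ)
    have h2 := hsmall Q hQ
    simp only [E]
    rw [this]; linarith
  have hfin : ν (⋃ Q ∈ T, Q) ≠ ∞ :=
    ((measure_biUnion_finset_le T id).trans_lt
      (ENNReal.sum_lt_top.2 fun Q hQ => (hν Q (hT hQ)).lt_top)).ne
  have hres : ∀ r : ℤ, ∑ Q ∈ T with l Q % 3 = r, ν.real (E Q) ≤ ν.real (⋃ Q ∈ T, Q) := by
    intro r
    have hsub : ∀ Q ∈ T.filter (fun Q => l Q % 3 = r), Q ∈ S ∧ Q ∈ T ∧ l Q % 3 = r := fun Q hQ =>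
      ⟨hT (Finset.mem_filter.1 hQ).1, Finset.mem_filter.1 hQ⟩
    have key : ∀ Q ∈ T.filter (fun Q => l Q % 3 = r), ∀ R ∈ T.filter (fun Q => l Q % 3 = r),
        Q ⊂ R → Disjoint (E Q) (E R) := by
      intro Q hQ R hR hQR
      have h1 := hsub Q hQ
      have h2 := hsub R hR
      have h3 := hl Q h1.1 R h2.1 hQR
      have hmem : Q ∈ D R := Finset.mem_filter.2 ⟨h1.1, hQR.1, by omega⟩
      refine Set.disjoint_left.2 fun x hx hx' => hx'.2 ?_
      exact Set.mem_biUnion (s := {R' | R' ∈ D R}) hmem (hEQ Q hx)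
    have h := measureReal_biUnion_finset (μ := ν) (s := T.filter (fun Q => l Q % 3 = r)) (f := E)
      (fun Q hQ R hR hne => by
        have h1 := hsub Q hQ
        have h2 := hsub R hR
        rcases hS Q h1.1 R h2.1 with h3 | h3 | h3
        · exact key Q hQ R hR (LE.le.ssubset_of_ne h3 hne)
        · exact (key R hR Q hQ (LE.le.ssubset_of_ne h3 hne.symm)).symm
        · exact h3.mono (hEQ Q) (hEQ R))
      (fun Q hQ => hEm Q (hsub Q hQ).1)
      (fun Q hQ => ((measure_mono (hEQ Q)).trans_lt (hν Q (hsub Q hQ).1).lt_top).ne)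
    rw [← h]
    refine measureReal_mono (Set.iUnion₂_subset fun Q hQ => ?_) hfin
    exact (hEQ Q).trans (Set.subset_biUnion_of_mem (u := fun Q : Set X => Q)
      (s := {Q | Q ∈ T}) (hsub Q hQ).2.1)
  calc ∑ Q ∈ T, ν.real Q ≤ ∑ Q ∈ T, N * ν.real (E Q) :=
        Finset.sum_le_sum fun Q hQ => hQE Q (hT hQ)
    _ = N * ∑ r ∈ ({0, 1, 2} : Finset ℤ), ∑ Q ∈ T with l Q % 3 = r, ν.real (E Q) := by
        rw [← Finset.mul_sum, Finset.sum_fiberwise_of_maps_to]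
        intro Q hQ
        simp only [Finset.mem_insert, Finset.mem_singleton]
        omega
    _ ≤ N * ∑ r ∈ ({0, 1, 2} : Finset ℤ), ν.real (⋃ Q ∈ T, Q) :=
        mul_le_mul_of_nonneg_left (Finset.sum_le_sum fun r _ => hres r) hN
    _ = _ := by simp; ring

open Classical in
/-- The dyadic maximal inequality in summed form: the tops of the stopping levels of the
`ν`-averages of `f`, weighted by the `p`-th power of their level, are controlled by `∫ f ^ p`. -/
theorem sum_isTop_level_le {p : ℝ} (hp : 1 < p) :
    ∃ C : ℝ, 0 < C ∧ ∀ (ν : Measure X) (S : Finset (Set X)), IsNested S →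
      (∀ Q ∈ S, MeasurableSet Q) → (∀ Q ∈ S, ν Q ≠ ∞) →
      ∀ f : X → ℝ≥0∞, Measurable f → (∀ Q ∈ S, ∫⁻ x in Q, f x ∂ν ≠ ∞) →
      ∫⁻ x, f x ^ p ∂ν ≠ ∞ →
      ∀ L : Set X → ℤ, (∀ Q ∈ S, IsTop S L Q →
        (2 : ℝ) ^ (L Q) * ν.real Q ≤ (∫⁻ x in Q, f x ∂ν).toReal) →
      ∑ Q ∈ S.filter (IsTop S L), ((2 : ℝ) ^ (L Q)) ^ p * ν.real Q ≤
        C * (∫⁻ x, f x ^ p ∂ν).toReal := by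
  set e := p - 1 with he
  have hep : 0 < e := by linarith
  set K : ℝ := (1 - (2 : ℝ) ^ (-e))⁻¹ with hK
  have hKp : 0 < K := inv_pos.2 (by
    have := Real.rpow_lt_one_of_one_lt_of_neg (x := (2 : ℝ)) (z := -e) (by norm_num) (by linarith)
    linarith)
  refine ⟨2 * (2 ^ e * K), by positivity, ?_⟩
  intro ν S hS hm hν f hf hfin hfp L hL
  set c : ℤ → ℝ≥0∞ := fun i => ENNReal.ofReal ((2 : ℝ) ^ i) with hc
  set Tp := S.filter (IsTop S L) with hTp
  have hTS : ∀ Q ∈ Tp, Q ∈ S ∧ IsTop S L Q := fun Q hQ => Finset.mem_filter.1 hQ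
  set I := Tp.image L
  have hci : ∀ i, c i = c (i - 1) + c (i - 1) := by
    intro i
    simp only [hc]
    rw [← ENNReal.ofReal_add (by positivity) (by positivity), zpow_sub_one₀ (by norm_num)]
    congr 1; ring
  have hcfin : ∀ i, c i ≠ ∞ := fun i => ENNReal.ofReal_ne_top
  -- the truncation `f ≤ 2 ^ (i - 1) + f 1_{f > 2 ^ (i - 1)}` removes half of the average
  have hone : ∀ Q ∈ Tp, c (L Q - 1) * ν Q ≤ ∫⁻ x in Q, {x | c (L Q - 1) < f x}.indicator f x ∂ν := by
    intro Q hQ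
    obtain ⟨hQS, hQt⟩ := hTS Q hQ
    have h1 : c (L Q) * ν Q ≤ ∫⁻ x in Q, f x ∂ν := by
      rw [← ENNReal.ofReal_toReal (hfin Q hQS), ← ENNReal.ofReal_toReal (hν Q hQS), hc,
        ← ENNReal.ofReal_mul (by positivity)]
      exact ENNReal.ofReal_le_ofReal (hL Q hQS hQt)
    have h2 : ∫⁻ x in Q, f x ∂ν ≤ c (L Q - 1) * ν Q +
        ∫⁻ x in Q, {x | c (L Q - 1) < f x}.indicator f x ∂ν := by
      rw [← setLIntegral_const, ← lintegral_add_left measurable_const]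
      refine lintegral_mono fun x => ?_
      by_cases hx : c (L Q - 1) < f x
      · simp [Set.indicator, hx]
      · simp [Set.indicator, hx]; exact not_lt.1 hx
    rw [hci, add_mul] at h1
    exact (ENNReal.add_le_add_iff_left (ENNReal.mul_ne_top (hcfin _) (hν Q hQS))).1 (h1.trans h2)
  have hlevel : ∀ i, ∑ Q ∈ Tp with L Q = i, c (i - 1) * ν Q ≤
      ∫⁻ x, {x | c (i - 1) < f x}.indicator f x ∂ν := by
    intro i
    have hd : Set.PairwiseDisjoint (↑(Tp.filter (fun Q => L Q = i)) : Set (Set X)) id := by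
      intro Q hQ R hR hne
      have h1 := Finset.mem_filter.1 (Finset.mem_coe.1 hQ)
      have h2 := Finset.mem_filter.1 (Finset.mem_coe.1 hR)
      exact hS.disjoint_of_isTop (hTS Q h1.1).1 (hTS R h2.1).1 (hTS Q h1.1).2 (hTS R h2.1).2 hne
        (h1.2.trans h2.2.symm)
    calc ∑ Q ∈ Tp with L Q = i, c (i - 1) * ν Q
        ≤ ∑ Q ∈ Tp with L Q = i, ∫⁻ x in Q, {x | c (i - 1) < f x}.indicator f x ∂ν := by
          refine Finset.sum_le_sum fun Q hQ => ?_
          obtain ⟨h1, rfl⟩ := Finset.mem_filter.1 hQ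
          exact hone Q h1
      _ = ∫⁻ x in ⋃ Q ∈ Tp.filter (fun Q => L Q = i), Q, {x | c (i - 1) < f x}.indicator f x ∂ν :=
          (lintegral_biUnion_finset hd (fun Q hQ => hm Q
            (hTS Q (Finset.mem_filter.1 hQ).1).1) _).symm
      _ ≤ _ := setLIntegral_le_lintegral _ _
  have hpt : ∀ x, ∑ i ∈ I, 2 * c i ^ e * {x | c (i - 1) < f x}.indicator f x ≤
      ENNReal.ofReal (2 * (2 ^ e * K)) * f x ^ p := by
    intro x
    rcases eq_or_ne (f x) 0 with h0 | h0
    · have : ∀ i, {x | c (i - 1) < f x}.indicator f x = 0 := by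
        intro i; simp [Set.indicator, h0]
      simp [this]
    rcases eq_or_ne (f x) ∞ with ht | ht
    · rw [ht, ENNReal.top_rpow_of_pos (by linarith), ENNReal.mul_top]
      · exact le_top
      · exact (ENNReal.ofReal_pos.2 (by positivity)).ne'
    have hy : 0 < (f x).toReal := ENNReal.toReal_pos h0 ht
    have hsum := sum_zpow_rpow_le (I.filter (fun i => c (i - 1) < f x)) (e := e)
      (y := 2 * (f x).toReal) hep (by positivity) (by
        intro i hi
        have h1 := (Finset.mem_filter.1 hi).2
        have h2 : (2 : ℝ) ^ (i - 1) < (f x).toReal := by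
          rw [← ENNReal.ofReal_toReal ht] at h1
          exact (ENNReal.ofReal_lt_ofReal_iff hy).1 h1
        rw [zpow_sub_one₀ (by norm_num)] at h2
        linarith)
    have hce : ∀ i, c i ^ e = ENNReal.ofReal (((2 : ℝ) ^ i) ^ e) := fun i =>
      ENNReal.ofReal_rpow_of_pos (by positivity)
    calc ∑ i ∈ I, 2 * c i ^ e * {x | c (i - 1) < f x}.indicator f x
        = ∑ i ∈ I.filter (fun i => c (i - 1) < f x), 2 * c i ^ e * f x := by
          rw [Finset.sum_filter]
          refine Finset.sum_congr rfl fun i _ => ?_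
          by_cases h : c (i - 1) < f x <;> simp [Set.indicator, h]
      _ = 2 * f x * ∑ i ∈ I.filter (fun i => c (i - 1) < f x), c i ^ e := by
          rw [Finset.mul_sum]
          exact Finset.sum_congr rfl fun i _ => by ring
      _ = 2 * f x * ENNReal.ofReal (∑ i ∈ I.filter (fun i => c (i - 1) < f x), ((2 : ℝ) ^ i) ^ e) := by
          rw [ENNReal.ofReal_sum_of_nonneg (fun i _ => by positivity)]
          simp only [hce]
      _ ≤ 2 * f x * ENNReal.ofReal (K * (2 * (f x).toReal) ^ e) := by gcongr
      _ = ENNReal.ofReal (2 * (2 ^ e * K)) * f x ^ p := by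
          conv_lhs => rw [← ENNReal.ofReal_toReal ht]
          conv_rhs => rw [← ENNReal.ofReal_toReal ht]
          rw [ENNReal.ofReal_rpow_of_pos hy, ← ENNReal.ofReal_mul (by positivity),
            show (2 : ℝ≥0∞) = ENNReal.ofReal 2 by simp, ← ENNReal.ofReal_mul (by norm_num),
            ENNReal.toReal_ofReal hy.le, ← ENNReal.ofReal_mul (by positivity)]
          congr 1
          rw [Real.mul_rpow (by norm_num) hy.le, show p = e + 1 by rw [he]; ring,
            Real.rpow_add_one hy.ne']
          ring
  have hmain : ∑ Q ∈ Tp, c (L Q) ^ p * ν Q ≤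
      ENNReal.ofReal (2 * (2 ^ e * K)) * ∫⁻ x, f x ^ p ∂ν := by
    calc ∑ Q ∈ Tp, c (L Q) ^ p * ν Q
        = ∑ i ∈ I, ∑ Q ∈ Tp with L Q = i, c (L Q) ^ p * ν Q :=
          (Finset.sum_fiberwise_of_maps_to (fun Q hQ => Finset.mem_image_of_mem L hQ) _).symm
      _ = ∑ i ∈ I, 2 * c i ^ e * ∑ Q ∈ Tp with L Q = i, c (i - 1) * ν Q := by
          refine Finset.sum_congr rfl fun i _ => ?_
          rw [Finset.mul_sum]
          refine Finset.sum_congr rfl fun Q hQ => ?_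
          rw [(Finset.mem_filter.1 hQ).2, ← mul_assoc, mul_right_comm 2, two_mul, ← hci i, mul_comm (c i)]
          congr 1
          have h0 : c i ≠ 0 := (ENNReal.ofReal_pos.2 (by positivity)).ne'
          rw [show p = e + 1 by rw [he]; ring, ENNReal.rpow_add _ _ h0 (hcfin i), ENNReal.rpow_one]
      _ ≤ ∑ i ∈ I, 2 * c i ^ e * ∫⁻ x, {x | c (i - 1) < f x}.indicator f x ∂ν := by
          gcongr with i _
          exact hlevel i
      _ = ∫⁻ x, ∑ i ∈ I, 2 * c i ^ e * {x | c (i - 1) < f x}.indicator f x ∂ν := by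
          have hmi : ∀ i, Measurable ({x | c (i - 1) < f x}.indicator f) := fun i =>
            hf.indicator (measurableSet_lt measurable_const hf)
          rw [lintegral_finsetSum _ (fun i _ => (hmi i).const_mul _)]
          exact Finset.sum_congr rfl fun i _ => (lintegral_const_mul _ (hmi i)).symm
      _ ≤ ∫⁻ x, ENNReal.ofReal (2 * (2 ^ e * K)) * f x ^ p ∂ν := lintegral_mono hpt
      _ = _ := lintegral_const_mul _ (hf.pow_const p)
  have h1 := ENNReal.toReal_mono (ENNReal.mul_ne_top ENNReal.ofReal_ne_top hfp) hmain
  rw [ENNReal.toReal_mul, ENNReal.toReal_ofReal (by positivity), ENNReal.toReal_sum] at h1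
  · refine le_trans (le_of_eq (Finset.sum_congr rfl fun Q hQ => ?_)) h1
    rw [ENNReal.toReal_mul, ← ENNReal.toReal_rpow, hc, ENNReal.toReal_ofReal (by positivity)]
    rfl
  · intro Q hQ
    exact ENNReal.mul_ne_top (ENNReal.rpow_ne_top_of_nonneg (by linarith) (hcfin _))
      (hν Q (hTS Q hQ).1)

end

section

variable {X : Type*} [MeasurableSpace X]

/-! ### The bilinear form over one class of cubes -/

open Classical in
/-- Consequences of the maximal inequality for a Carleson family: the three bounds on
`x R = (2 ^ L R) ^ p * ν R` needed in the stopping-time argument. -/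
theorem exists_level_bounds {b : ℝ} (hb : 0 < b) (hb1 : b < 1) :
    ∃ C : ℝ, 0 < C ∧ ∀ (ν : Measure X) (S : Finset (Set X)), IsNested S →
      (∀ Q ∈ S, MeasurableSet Q) → (∀ Q ∈ S, ν Q ≠ ∞) → (∀ Q ∈ S, 0 < ν.real Q) →
      ∀ f : X → ℝ≥0∞, Measurable f → (∀ Q ∈ S, ∫⁻ x in Q, f x ∂ν ≠ ∞) →
      (∀ Q ∈ S, 0 < (∫⁻ x in Q, f x ∂ν).toReal) →
      ∫⁻ x, f x ^ (1 / (1 - b)) ∂ν ≠ ∞ →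
      ∀ N : ℝ, 0 ≤ N → (∀ T ⊆ S, ∑ Q ∈ T, ν.real Q ≤ 3 * N * ν.real (⋃ Q ∈ T, Q)) →
      ∃ (L : Set X → ℤ) (x : Set X → ℝ), (∀ Q ∈ S, ∀ R ∈ S, Q ⊆ R → L R ≤ L Q) ∧
        (∀ Q ∈ S, 0 < x Q) ∧
        (∀ Q ∈ S, x Q ^ (1 - b) = (2 : ℝ) ^ L Q * ν.real Q ^ (1 - b)) ∧
        (∀ Q ∈ S, (∫⁻ x in Q, f x ∂ν).toReal ≤ 2 * ((2 : ℝ) ^ L Q) * ν.real Q) ∧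
        ∑ Q ∈ S, x Q ≤ 3 * N * (C * (∫⁻ x, f x ^ (1 / (1 - b)) ∂ν).toReal) ∧
        (∀ Q ∈ S, x Q ≤ C * (∫⁻ x, f x ^ (1 / (1 - b)) ∂ν).toReal) ∧
        ∑ Q ∈ S.filter (IsTop S L), x Q ≤ C * (∫⁻ x, f x ^ (1 / (1 - b)) ∂ν).toReal := by
  have hp : 1 < 1 / (1 - b) := by rw [lt_div_iff₀ (by linarith)]; linarith
  obtain ⟨C, hC, hmax⟩ := sum_isTop_level_le (X := X) hp
  set p := 1 / (1 - b) with hpdef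
  refine ⟨C, hC, ?_⟩
  intro ν S hS hm hν hνp f hf hfin hfpos hfp N hN hcar
  obtain ⟨L, hanti, hlt, htop⟩ := exists_level S (fun Q => (∫⁻ x in Q, f x ∂ν).toReal / ν.real Q)
    (fun Q hQ => div_pos (hfpos Q hQ) (hνp Q hQ))
  have hM := hmax ν S hS hm hν f hf hfin hfp L (fun Q hQ ht => by
    have := htop Q hQ ht
    rwa [le_div_iff₀ (hνp Q hQ)] at this)
  set A := C * (∫⁻ x, f x ^ p ∂ν).toReal with hA
  set x : Set X → ℝ := fun Q => ((2 : ℝ) ^ L Q) ^ p * ν.real Q with hx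
  have hxtop : ∀ Q ∈ S, ∃ R ∈ S.filter (IsTop S L), Q ⊆ R ∧ L Q = L R := by
    intro Q hQ
    obtain ⟨R, hR, h1, h2, h3⟩ := exists_isTop L hQ
    exact ⟨R, Finset.mem_filter.2 ⟨hR, h3⟩, h1, h2⟩
  have hxp : ∀ Q ∈ S, 0 < x Q := fun Q hQ => mul_pos (by positivity) (hνp Q hQ)
  refine ⟨L, x, hanti, hxp, ?_, ?_, ?_, ?_, hM⟩
  · intro Q hQ
    have := hνp Q hQ
    rw [hx, Real.mul_rpow (by positivity) this.le, ← Real.rpow_mul (by positivity), hpdef,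
      one_div, inv_mul_cancel₀ (by linarith), Real.rpow_one]
  · intro Q hQ
    have h1 := hlt Q hQ
    rw [div_lt_iff₀ (hνp Q hQ), zpow_add_one₀ (by norm_num)] at h1
    linarith
  · have hgrp : ∀ i, ∑ Q ∈ S with L Q = i, x Q ≤
        3 * N * ∑ R ∈ S.filter (IsTop S L) with L R = i, x R := by
      intro i
      have h1 := hcar (S.filter (fun Q => L Q = i)) (Finset.filter_subset _ _)
      have h2 : ν.real (⋃ Q ∈ S.filter (fun Q => L Q = i), Q) ≤
          ∑ R ∈ S.filter (IsTop S L) with L R = i, ν.real R := by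
        refine le_trans (measureReal_mono (Set.iUnion₂_subset fun Q hQ => ?_) ?_)
          (measureReal_biUnion_finset_le ((S.filter (IsTop S L)).filter (fun R => L R = i)) id)
        · obtain ⟨hQS, rfl⟩ := Finset.mem_filter.1 hQ
          obtain ⟨R, hR, h3, h4⟩ := hxtop Q hQS
          exact h3.trans (Set.subset_biUnion_of_mem (u := fun Q : Set X => Q)
            (s := {R | R ∈ (S.filter (IsTop S L)).filter (fun R => L R = L Q)})
            (Finset.mem_filter.2 ⟨hR, h4.symm⟩))
        · refine ((measure_biUnion_finset_le _ id).trans_lt (ENNReal.sum_lt_top.2 fun Q hQ => ?_)).ne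
          exact (hν Q (Finset.mem_filter.1 (Finset.mem_filter.1 hQ).1).1).lt_top
      have h3 : ∀ T : Finset (Set X), (∀ Q ∈ T, L Q = i) →
          ∑ Q ∈ T, x Q = ((2 : ℝ) ^ i) ^ p * ∑ Q ∈ T, ν.real Q := by
        intro T hT
        rw [Finset.mul_sum]
        exact Finset.sum_congr rfl fun Q hQ => by rw [hx]; simp only; rw [hT Q hQ]
      rw [h3 _ (fun Q hQ => (Finset.mem_filter.1 hQ).2), h3 _ (fun Q hQ => (Finset.mem_filter.1 hQ).2),
        mul_left_comm]
      refine mul_le_mul_of_nonneg_left (h1.trans ?_) (by positivity)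
      exact mul_le_mul_of_nonneg_left h2 (by positivity)
    calc ∑ Q ∈ S, x Q = ∑ i ∈ S.image L, ∑ Q ∈ S with L Q = i, x Q :=
          (Finset.sum_fiberwise_of_maps_to (fun Q hQ => Finset.mem_image_of_mem L hQ) _).symm
      _ ≤ ∑ i ∈ S.image L, 3 * N * ∑ R ∈ S.filter (IsTop S L) with L R = i, x R :=
          Finset.sum_le_sum fun i _ => hgrp i
      _ = 3 * N * ∑ R ∈ S.filter (IsTop S L), x R := by
          rw [← Finset.mul_sum, Finset.sum_fiberwise_of_maps_to]
          exact fun R hR => Finset.mem_image_of_mem L (Finset.mem_filter.1 hR).1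
      _ ≤ 3 * N * A := mul_le_mul_of_nonneg_left hM (by positivity)
  · intro Q hQ
    obtain ⟨R, hR, h1, h2⟩ := hxtop Q hQ
    have hRS := (Finset.mem_filter.1 hR).1
    calc x Q ≤ x R := by
          rw [hx]; simp only; rw [h2]
          exact mul_le_mul_of_nonneg_left (measureReal_mono h1 (hν R hRS)) (by positivity)
      _ ≤ ∑ R ∈ S.filter (IsTop S L), x R :=
          Finset.single_le_sum (fun R hR => (hxp R (Finset.mem_filter.1 hR).1).le) hR
      _ ≤ A := hM

/-- The bilinear form over one class of cubes, on which the `A_{p,q}` quantity is comparable with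
`τ`. Each cube is charged to the largest cube with the same stopping levels for both functions; that
cube is a top either for the levels of `f` or for those of `g`, and the off-diagonal Hölder
inequality then needs the Carleson constant of only one of the two measures, raised to a small
power. Here `a = 1 / q` and `b = 1 / p'`. -/
theorem sum_class_le {a b : ℝ} (ha : 0 < a) (ha1 : a < 1) (hb : 0 < b)
    (hb1 : b < 1) (hab : a + b < 1) :
    ∃ C : ℝ, 0 < C ∧ ∀ (σ u : Measure X) (V : Set X → ℝ) (S : Finset (Set X)), IsNested S →
      (∀ Q ∈ S, Q.Nonempty) → (∀ Q ∈ S, MeasurableSet Q) → (∀ Q ∈ S, 0 < V Q) →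
      (∀ Q ∈ S, σ Q ≠ ∞) → (∀ Q ∈ S, 0 < σ.real Q) →
      (∀ Q ∈ S, u Q ≠ ∞) → (∀ Q ∈ S, 0 < u.real Q) →
      ∀ l : Set X → ℤ, (∀ Q ∈ S, ∀ R ∈ S, Q ⊂ R → l R < l Q) →
      (∀ R ∈ S, ∀ m : ℕ, ∀ T ⊆ S, (∀ Q ∈ T, Q ⊆ R ∧ l Q = l R + m) →
        ∑ Q ∈ T, V Q ≤ 2 * (1 / 2) ^ m * V R) →
      ∀ Nσ : ℝ, 0 ≤ Nσ → (∀ T ⊆ S, ∑ Q ∈ T, σ.real Q ≤ 3 * Nσ * σ.real (⋃ Q ∈ T, Q)) →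
      ∀ Nu : ℝ, 0 ≤ Nu → (∀ T ⊆ S, ∑ Q ∈ T, u.real Q ≤ 3 * Nu * u.real (⋃ Q ∈ T, Q)) →
      ∀ τ : ℝ, 0 < τ → (∀ Q ∈ S, τ * V Q ^ (a + b) ≤ u.real Q ^ a * σ.real Q ^ b) →
      (∀ Q ∈ S, u.real Q ^ a * σ.real Q ^ b ≤ 2 * τ * V Q ^ (a + b)) →
      ∀ f : X → ℝ≥0∞, Measurable f → (∀ Q ∈ S, ∫⁻ x in Q, f x ∂σ ≠ ∞) →
      (∀ Q ∈ S, 0 < (∫⁻ x in Q, f x ∂σ).toReal) → ∫⁻ x, f x ^ (1 / (1 - b)) ∂σ ≠ ∞ →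
      ∀ g : X → ℝ≥0∞, Measurable g → (∀ Q ∈ S, ∫⁻ x in Q, g x ∂u ≠ ∞) →
      (∀ Q ∈ S, 0 < (∫⁻ x in Q, g x ∂u).toReal) → ∫⁻ x, g x ^ (1 / (1 - a)) ∂u ≠ ∞ →
      ∑ Q ∈ S, V Q ^ (-(a + b)) * (∫⁻ x in Q, f x ∂σ).toReal * (∫⁻ x in Q, g x ∂u).toReal ≤
        C * τ * (Nσ ^ a + Nu ^ b) * ((∫⁻ x, f x ^ (1 / (1 - b)) ∂σ).toReal ^ (1 - b) *
          (∫⁻ x, g x ^ (1 / (1 - a)) ∂u).toReal ^ (1 - a)) := by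
  classical
  obtain ⟨C₀, hC₀, hdesc⟩ := sum_descendants_le X ha ha1 hb hb1 hab
  obtain ⟨C₁, hC₁, hlevf⟩ := exists_level_bounds (X := X) hb hb1
  obtain ⟨C₂, hC₂, hlevg⟩ := exists_level_bounds (X := X) ha ha1
  refine ⟨8 * C₀ * (C₁ ^ (1 - b) * C₂ ^ (1 - a)) * (3 ^ a + 3 ^ b), by positivity, ?_⟩
  intro σ u V S hS hne hm hV hσ hσp hu hup l hl hgen Nσ hNσ hcσ Nu hNu hcu τ hτ hlo hhi f hf hfin
    hfpos hfp g hg hgin hgpos hgp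
  obtain ⟨I, x, hI, hx, hxI, hfI, hx1, hx2, hx3⟩ :=
    hlevf σ S hS hm hσ hσp f hf hfin hfpos hfp Nσ hNσ hcσ
  obtain ⟨J, y, hJ, hy, hyJ, hgJ, hy1, hy2, hy3⟩ :=
    hlevg u S hS hm hu hup g hg hgin hgpos hgp Nu hNu hcu
  set F := (∫⁻ x, f x ^ (1 / (1 - b)) ∂σ).toReal with hF
  set G := (∫⁻ x, g x ^ (1 / (1 - a)) ∂u).toReal with hG
  rcases S.eq_empty_or_nonempty with rfl | hSne
  · simp only [Finset.sum_empty]; positivity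
  have hAf : 0 < C₁ * F := by
    obtain ⟨Q, hQ⟩ := hSne; exact (hx Q hQ).trans_le (hx2 Q hQ)
  have hAg : 0 < C₂ * G := by
    obtain ⟨Q, hQ⟩ := hSne; exact (hy Q hQ).trans_le (hy2 Q hQ)
  have hFp : 0 < F := by rcases pos_and_pos_or_neg_and_neg_of_mul_pos hAf with h | h <;> linarith
  have hGp : 0 < G := by rcases pos_and_pos_or_neg_and_neg_of_mul_pos hAg with h | h <;> linarith
  set lab : Set X → ℤ × ℤ := fun Q => (I Q, J Q) with hlab
  set z : Set X → ℝ := fun Q => x Q ^ (1 - b) * y Q ^ (1 - a) with hz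
  have hz0 : ∀ Q ∈ S, 0 ≤ z Q := fun Q hQ => by
    have := hx Q hQ; have := hy Q hQ; positivity
  -- a term is dominated using the lower class bound
  have hterm : ∀ Q ∈ S, V Q ^ (-(a + b)) * (∫⁻ x in Q, f x ∂σ).toReal *
      (∫⁻ x in Q, g x ∂u).toReal ≤ 8 * τ * z Q := by
    intro Q hQ
    have hv := hV Q hQ
    have hs := hσp Q hQ
    have hu' := hup Q hQ
    have h1 := hfI Q hQ
    have h2 := hgJ Q hQ
    have h3 : V Q ^ (-(a + b)) * (σ.real Q ^ b * u.real Q ^ a) ≤ 2 * τ := by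
      rw [Real.rpow_neg hv.le, inv_mul_le_iff₀ (by positivity)]
      have := hhi Q hQ
      linarith
    have e1 : σ.real Q = σ.real Q ^ (1 - b) * σ.real Q ^ b := by
      rw [← Real.rpow_add hs]; simp
    have e2 : u.real Q = u.real Q ^ (1 - a) * u.real Q ^ a := by
      rw [← Real.rpow_add hu']; simp
    calc V Q ^ (-(a + b)) * (∫⁻ x in Q, f x ∂σ).toReal * (∫⁻ x in Q, g x ∂u).toReal
        ≤ V Q ^ (-(a + b)) * (2 * 2 ^ I Q * σ.real Q) * (2 * 2 ^ J Q * u.real Q) := by gcongr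
      _ = 4 * (V Q ^ (-(a + b)) * (σ.real Q ^ b * u.real Q ^ a)) *
          ((2 ^ I Q * σ.real Q ^ (1 - b)) * (2 ^ J Q * u.real Q ^ (1 - a))) := by
          nth_rewrite 1 [e1]; nth_rewrite 1 [e2]; ring
      _ = 4 * (V Q ^ (-(a + b)) * (σ.real Q ^ b * u.real Q ^ a)) * z Q := by
          rw [hz]; simp only; rw [hxI Q hQ, hyJ Q hQ]
      _ ≤ 4 * (2 * τ) * z Q := by
          have := hz0 Q hQ
          gcongr
      _ = _ := by ring
  -- the descendants of a top with the same labels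
  have hinner : ∀ R ∈ S, ∑ Q ∈ S with Q ⊆ R ∧ lab Q = lab R, z Q ≤ C₀ * z R := by
    intro R hR
    set T := S.filter (fun Q => Q ⊆ R ∧ lab Q = lab R) with hT
    have hTS : ∀ Q ∈ T, Q ∈ S ∧ Q ⊆ R ∧ lab Q = lab R := fun Q hQ => Finset.mem_filter.1 hQ
    have hdisj : ∀ m : ℕ, ∀ Q ∈ T.filter (fun Q => l Q = l R + m),
        ∀ Q' ∈ T.filter (fun Q => l Q = l R + m), Q ≠ Q' → Disjoint Q Q' := by
      intro m Q hQ Q' hQ' hne'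
      have h1 := Finset.mem_filter.1 hQ
      have h2 := Finset.mem_filter.1 hQ'
      exact hS.disjoint_of_level hl (hTS Q h1.1).1 (hTS Q' h2.1).1 hne' (h1.2.trans h2.2.symm)
    have hd := hdesc S V (fun Q => u.real Q) (fun Q => σ.real Q) hV hup hσp l τ hτ hlo hhi R hR T
      (Finset.filter_subset _ _)
      (fun Q hQ => by
        have h1 := hTS Q hQ
        rcases eq_or_ne Q R with rfl | h
        · exact le_rfl
        · exact (hl Q h1.1 R hR (LE.le.ssubset_of_ne h1.2.1 h)).le)
      (fun m => hgen R hR m _ ((Finset.filter_subset _ _).trans (Finset.filter_subset _ _))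
        (fun Q hQ => ⟨(hTS Q (Finset.mem_filter.1 hQ).1).2.1, (Finset.mem_filter.1 hQ).2⟩))
      (fun m => sum_measureReal_le_of_disjoint u _ R (hu R hR)
        (fun Q hQ => ⟨hm Q (hTS Q (Finset.mem_filter.1 hQ).1).1,
          (hTS Q (Finset.mem_filter.1 hQ).1).2.1⟩) (hdisj m))
      (fun m => sum_measureReal_le_of_disjoint σ _ R (hσ R hR)
        (fun Q hQ => ⟨hm Q (hTS Q (Finset.mem_filter.1 hQ).1).1,
          (hTS Q (Finset.mem_filter.1 hQ).1).2.1⟩) (hdisj m))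
    have hzz : ∀ Q ∈ S, z Q = (2 ^ I Q * 2 ^ J Q) * (u.real Q ^ (1 - a) * σ.real Q ^ (1 - b)) := by
      intro Q hQ
      rw [hz]; simp only; rw [hxI Q hQ, hyJ Q hQ]; ring
    have : ∑ Q ∈ T, z Q = (2 ^ I R * 2 ^ J R) * ∑ Q ∈ T, u.real Q ^ (1 - a) * σ.real Q ^ (1 - b) := by
      rw [Finset.mul_sum]
      refine Finset.sum_congr rfl fun Q hQ => ?_
      have h1 := hTS Q hQ
      have h2 : I Q = I R ∧ J Q = J R := by simpa [hlab] using h1.2.2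
      rw [hzz Q h1.1, h2.1, h2.2]
    rw [this, hzz R hR]
    calc _ ≤ ((2 : ℝ) ^ I R * 2 ^ J R) * (C₀ * (u.real R ^ (1 - a) * σ.real R ^ (1 - b))) := by
          gcongr
      _ = _ := by ring
  -- a top for the pair of labels is a top for one of them
  have htops : S.filter (IsTop S lab) ⊆ S.filter (IsTop S I) ∪ S.filter (IsTop S J) := by
    intro R hR
    obtain ⟨hRS, hRt⟩ := Finset.mem_filter.1 hR
    simp only [Finset.mem_union, Finset.mem_filter, hRS, true_and]
    by_contra hcon
    simp only [not_or, IsTop, not_forall, not_not] at hcon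
    obtain ⟨⟨R₁, h1, h1', h1''⟩, R₂, h2, h2', h2''⟩ := hcon
    obtain ⟨r, hr⟩ := hne R hRS
    rcases hS R₁ h1 R₂ h2 with h | h | h
    · have h3 := hJ R₁ h1 R₂ h2 h
      have h4 := hJ R hRS R₁ h1 h1'.1
      exact hRt R₁ h1 h1' (Prod.ext h1'' (le_antisymm h4 (h2''.symm.le.trans h3)))
    · have h3 := hI R₂ h2 R₁ h1 h
      have h4 := hI R hRS R₂ h2 h2'.1
      exact hRt R₂ h2 h2' (Prod.ext (le_antisymm h4 (h1''.symm.le.trans h3)) h2'')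
    · exact Set.disjoint_left.1 h (h1'.1 hr) (h2'.1 hr)
  have hJtop : ∑ R ∈ S.filter (IsTop S J), z R ≤
      (3 * Nσ) ^ a * ((C₁ * F) ^ (1 - b) * (C₂ * G) ^ (1 - a)) := by
    have hsub : ∀ R ∈ S.filter (IsTop S J), R ∈ S := fun R hR => (Finset.mem_filter.1 hR).1
    refine sum_rpow_mul_rpow_le_of_sup _ x y (fun R hR => hx R (hsub R hR))
      (fun R hR => hy R (hsub R hR)) ha ha1 hab (by positivity) hAf ?_
      (fun R hR => hx2 R (hsub R hR)) hy3
    exact (Finset.sum_le_sum_of_subset_of_nonneg (Finset.filter_subset _ _)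
      (fun R hR _ => (hx R hR).le)).trans hx1
  have hItop : ∑ R ∈ S.filter (IsTop S I), z R ≤
      (3 * Nu) ^ b * ((C₂ * G) ^ (1 - a) * (C₁ * F) ^ (1 - b)) := by
    have hsub : ∀ R ∈ S.filter (IsTop S I), R ∈ S := fun R hR => (Finset.mem_filter.1 hR).1
    have h := sum_rpow_mul_rpow_le_of_sup (S.filter (IsTop S I)) y x (fun R hR => hy R (hsub R hR))
      (fun R hR => hx R (hsub R hR)) hb hb1 (by linarith : b + a < 1)
      (by positivity : 0 ≤ 3 * Nu) hAg
      ((Finset.sum_le_sum_of_subset_of_nonneg (Finset.filter_subset _ _)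
        (fun R hR _ => (hy R hR).le)).trans hy1)
      (fun R hR => hy2 R (hsub R hR)) hx3
    refine le_trans (le_of_eq (Finset.sum_congr rfl fun R _ => ?_)) h
    rw [hz]; ring
  calc ∑ Q ∈ S, V Q ^ (-(a + b)) * (∫⁻ x in Q, f x ∂σ).toReal * (∫⁻ x in Q, g x ∂u).toReal
      ≤ 8 * τ * ∑ Q ∈ S, z Q := by
        rw [Finset.mul_sum]; exact Finset.sum_le_sum hterm
    _ ≤ 8 * τ * ∑ R ∈ S.filter (IsTop S lab), C₀ * z R := by
        refine mul_le_mul_of_nonneg_left ((sum_le_sum_isTop S lab z hz0).trans ?_) (by positivity)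
        exact Finset.sum_le_sum fun R hR =>
          (le_of_eq (Finset.sum_congr (by ext; simp) fun _ _ => rfl)).trans
            (hinner R (Finset.mem_filter.1 hR).1)
    _ ≤ 8 * τ * (C₀ * (∑ R ∈ S.filter (IsTop S J), z R + ∑ R ∈ S.filter (IsTop S I), z R)) := by
        rw [← Finset.mul_sum]
        refine mul_le_mul_of_nonneg_left (mul_le_mul_of_nonneg_left ?_ hC₀.le) (by positivity)
        refine (Finset.sum_le_sum_of_subset_of_nonneg htops fun R hR _ => hz0 R ?_).trans ?_
        · rcases Finset.mem_union.1 hR with h | h <;> exact (Finset.mem_filter.1 h).1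
        · rw [add_comm, ← Finset.sum_union_inter]
          refine le_add_of_nonneg_right (Finset.sum_nonneg fun R hR => hz0 R ?_)
          exact (Finset.mem_filter.1 (Finset.mem_inter.1 hR).1).1
    _ ≤ 8 * τ * (C₀ * ((3 * Nσ) ^ a * ((C₁ * F) ^ (1 - b) * (C₂ * G) ^ (1 - a)) +
          (3 * Nu) ^ b * ((C₂ * G) ^ (1 - a) * (C₁ * F) ^ (1 - b)))) := by gcongr
    _ = 8 * τ * C₀ * ((C₁ ^ (1 - b) * C₂ ^ (1 - a)) * (F ^ (1 - b) * G ^ (1 - a))) *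
          (3 ^ a * Nσ ^ a + 3 ^ b * Nu ^ b) := by
        rw [Real.mul_rpow hC₁.le hFp.le, Real.mul_rpow hC₂.le hGp.le,
          Real.mul_rpow (by norm_num) hNσ, Real.mul_rpow (by norm_num) hNu]
        ring
    _ ≤ 8 * τ * C₀ * ((C₁ ^ (1 - b) * C₂ ^ (1 - a)) * (F ^ (1 - b) * G ^ (1 - a))) *
          ((3 ^ a + 3 ^ b) * (Nσ ^ a + Nu ^ b)) := by
        refine mul_le_mul_of_nonneg_left ?_ (by positivity)
        have h1 : 0 ≤ (3 : ℝ) ^ a * Nu ^ b := by positivity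
        have h2 : 0 ≤ (3 : ℝ) ^ b * Nσ ^ a := by positivity
        nlinarith
    _ = _ := by ring

end

section

variable {X : Type*} [MeasurableSpace X]

/-! ### The dyadic fractional bilinear form -/

theorem setLIntegral_ne_top_of_rpow {ν : Measure X} {Q : Set X} (hQ : ν Q ≠ ∞) {f : X → ℝ≥0∞}
    {p : ℝ} (hp : 1 ≤ p) (hfp : ∫⁻ x, f x ^ p ∂ν ≠ ∞) : ∫⁻ x in Q, f x ∂ν ≠ ∞ := by
  have h : ∫⁻ x in Q, f x ∂ν ≤ ∫⁻ x in Q, 1 + f x ^ p ∂ν := by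
    refine lintegral_mono fun x => ?_
    rcases le_total (f x) 1 with h | h
    · exact h.trans le_self_add
    · exact (ENNReal.le_rpow_self_of_one_le h hp).trans le_add_self
  refine (h.trans_lt ?_).ne
  rw [lintegral_add_left measurable_const, setLIntegral_const, one_mul]
  exact ENNReal.add_lt_top.2 ⟨hQ.lt_top, (setLIntegral_le_lintegral _ _).trans_lt hfp.lt_top⟩

/-- The fractional dyadic sum of a measure over the subcubes of `R` is dominated by its top term. -/
theorem sum_scale_le {d : ℝ} (hd : 0 < d) {e : ℝ} (he : 0 < e) (ν : Measure X)
    (T : Finset (Set X)) (R : Set X) (hR : ν R ≠ ∞) (hT : ∀ Q ∈ T, MeasurableSet Q ∧ Q ⊆ R)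
    (V : Set X → ℝ) (k : Set X → ℤ) (hV : ∀ Q ∈ T, V Q = ((2 : ℝ) ^ k Q) ^ d)
    (hVR : V R = ((2 : ℝ) ^ k R) ^ d) (hk : ∀ Q ∈ T, k Q ≤ k R)
    (hdis : ∀ Q ∈ T, ∀ Q' ∈ T, Q ≠ Q' → k Q = k Q' → Disjoint Q Q') :
    ∑ Q ∈ T, V Q ^ e * ν.real Q ≤ (1 - (2 : ℝ) ^ (-(d * e)))⁻¹ * (V R ^ e * ν.real R) := by
  classical
  have hpow : ∀ Q ∈ T, V Q ^ e = ((2 : ℝ) ^ k Q) ^ (d * e) := fun Q hQ => by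
    rw [hV Q hQ, ← Real.rpow_mul (by positivity)]
  calc ∑ Q ∈ T, V Q ^ e * ν.real Q
      = ∑ i ∈ T.image k, ∑ Q ∈ T with k Q = i, V Q ^ e * ν.real Q :=
        (Finset.sum_fiberwise_of_maps_to (fun Q hQ => Finset.mem_image_of_mem k hQ) _).symm
    _ ≤ ∑ i ∈ T.image k, ((2 : ℝ) ^ i) ^ (d * e) * ν.real R := by
        refine Finset.sum_le_sum fun i _ => ?_
        have h1 : ∑ Q ∈ T with k Q = i, V Q ^ e * ν.real Q =
            ((2 : ℝ) ^ i) ^ (d * e) * ∑ Q ∈ T with k Q = i, ν.real Q := by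
          rw [Finset.mul_sum]
          refine Finset.sum_congr rfl fun Q hQ => ?_
          obtain ⟨h1, rfl⟩ := Finset.mem_filter.1 hQ
          rw [hpow Q h1]
        rw [h1]
        refine mul_le_mul_of_nonneg_left ?_ (by positivity)
        refine sum_measureReal_le_of_disjoint ν _ R hR
          (fun Q hQ => hT Q (Finset.mem_filter.1 hQ).1) (fun Q hQ Q' hQ' hne => ?_)
        have h1 := Finset.mem_filter.1 hQ
        have h2 := Finset.mem_filter.1 hQ'
        exact hdis Q h1.1 Q' h2.1 hne (h1.2.trans h2.2.symm)
    _ ≤ ((1 - (2 : ℝ) ^ (-(d * e)))⁻¹ * ((2 : ℝ) ^ k R) ^ (d * e)) * ν.real R := by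
        rw [← Finset.sum_mul]
        refine mul_le_mul_of_nonneg_right ?_ (by positivity)
        refine sum_zpow_rpow_le _ (by positivity) (by positivity) fun i hi => ?_
        obtain ⟨Q, hQ, rfl⟩ := Finset.mem_image.1 hi
        exact zpow_le_zpow_right₀ (by norm_num) (hk Q hQ)
    _ = _ := by rw [hVR, ← Real.rpow_mul (by positivity)]; ring

/-- The dyadic fractional bilinear form, for two measures satisfying a joint `A_{p,q}` bound with
constant `A`, where `a = 1 / q` and `b = 1 / p'`. The cubes are first thinned out to a sparse family
by stopping at the Lebesgue averages of `f dσ`, and then split into classes according to the size of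
the `A_{p,q}` quantity, over which the bounds form a geometric series. -/
theorem sum_dyadic_form_le {a b d : ℝ} (ha : 0 < a) (ha1 : a < 1) (hb : 0 < b)
    (hb1 : b < 1) (hab : a + b < 1) (hd : 0 < d) :
    ∃ C : ℝ, 0 < C ∧ ∀ (μ σ u : Measure X) (D : Finset (Set X)), IsNested D →
      (∀ Q ∈ D, Q.Nonempty) → (∀ Q ∈ D, MeasurableSet Q) →
      ∀ k : Set X → ℤ, (∀ Q ∈ D, μ.real Q = ((2 : ℝ) ^ k Q) ^ d) → (∀ Q ∈ D, μ Q ≠ ∞) →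
      (∀ Q ∈ D, ∀ R ∈ D, Q ⊆ R → k Q ≤ k R) →
      (∀ Q ∈ D, ∀ R ∈ D, Q ≠ R → k Q = k R → Disjoint Q R) →
      (∀ Q ∈ D, σ Q ≠ ∞) → (∀ Q ∈ D, 0 < σ.real Q) →
      (∀ Q ∈ D, u Q ≠ ∞) → (∀ Q ∈ D, 0 < u.real Q) →
      ∀ Nσ : ℝ, 0 ≤ Nσ → (∀ Q ∈ D, ∀ E ⊆ Q, MeasurableSet E → μ.real Q ≤ 2 * μ.real E →
        σ.real Q ≤ Nσ * σ.real E) →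
      ∀ Nu : ℝ, 0 ≤ Nu → (∀ Q ∈ D, ∀ E ⊆ Q, MeasurableSet E → μ.real Q ≤ 2 * μ.real E →
        u.real Q ≤ Nu * u.real E) →
      ∀ A : ℝ, 0 < A → (∀ Q ∈ D, u.real Q ^ a * σ.real Q ^ b ≤ A * μ.real Q ^ (a + b)) →
      ∀ f : X → ℝ≥0∞, Measurable f → ∫⁻ x, f x ^ (1 / (1 - b)) ∂σ ≠ ∞ →
      ∀ g : X → ℝ≥0∞, Measurable g → ∫⁻ x, g x ^ (1 / (1 - a)) ∂u ≠ ∞ →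
      ∑ Q ∈ D, μ.real Q ^ (-(a + b)) * (∫⁻ x in Q, f x ∂σ).toReal *
          (∫⁻ x in Q, g x ∂u).toReal ≤
        C * A * (Nσ ^ a + Nu ^ b) * ((∫⁻ x, f x ^ (1 / (1 - b)) ∂σ).toReal ^ (1 - b) *
          (∫⁻ x, g x ^ (1 / (1 - a)) ∂u).toReal ^ (1 - a)) := by
  classical
  obtain ⟨C₀, hC₀, hclass⟩ := sum_class_le (X := X) ha ha1 hb hb1 hab
  have he : 0 < 1 - (a + b) := by linarith
  set K : ℝ := (1 - (2 : ℝ) ^ (-(d * (1 - (a + b)))))⁻¹ with hK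
  have hKp : 0 < K := inv_pos.2 (by
    have := Real.rpow_lt_one_of_one_lt_of_neg (x := (2 : ℝ)) (z := -(d * (1 - (a + b))))
      (by norm_num) (by have := mul_pos hd he; linarith)
    linarith)
  refine ⟨2 * K * (2 * C₀), by positivity, ?_⟩
  intro μ σ u D₀ hD₀ hne₀ hm₀ k hk₀ hμ₀ hkmono₀ hkdis₀ hσ₀ hσp₀ hu₀ hup₀ Nσ hNσ hNσE Nu hNu hNuE A hA hApq
    f hf hfp g hg hgp
  have hp1 : (1 : ℝ) ≤ 1 / (1 - b) := by rw [le_div_iff₀ (by linarith)]; linarith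
  have hq1 : (1 : ℝ) ≤ 1 / (1 - a) := by rw [le_div_iff₀ (by linarith)]; linarith
  set F : Set X → ℝ := fun Q => (∫⁻ x in Q, f x ∂σ).toReal with hF
  set G : Set X → ℝ := fun Q => (∫⁻ x in Q, g x ∂u).toReal with hG
  set Z := (∫⁻ x, f x ^ (1 / (1 - b)) ∂σ).toReal ^ (1 - b) *
          (∫⁻ x, g x ^ (1 / (1 - a)) ∂u).toReal ^ (1 - a) with hZ
  have hZ0 : 0 ≤ Z := by positivity
  -- the other cubes contribute nothing to the form
  set D := D₀.filter (fun Q => 0 < F Q ∧ 0 < G Q) with hDdef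
  have hDsub : D ⊆ D₀ := Finset.filter_subset _ _
  have hFG : ∀ Q ∈ D, 0 < F Q ∧ 0 < G Q := fun Q hQ => (Finset.mem_filter.1 hQ).2
  have hF0 : ∀ Q, 0 ≤ F Q := fun Q => ENNReal.toReal_nonneg
  have hG0 : ∀ Q, 0 ≤ G Q := fun Q => ENNReal.toReal_nonneg
  have hD := hD₀.subset hDsub
  have hVpos : ∀ Q ∈ D, 0 < μ.real Q := fun Q hQ => by
    rw [hk₀ Q (hDsub hQ)]; positivity
  have hFν : ∀ Q ∈ D, F Q = (σ.withDensity f).real Q := fun Q hQ => by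
    rw [Measure.real, withDensity_apply _ (hm₀ Q (hDsub hQ))]
  have hGν : ∀ Q ∈ D, G Q = (u.withDensity g).real Q := fun Q hQ => by
    rw [Measure.real, withDensity_apply _ (hm₀ Q (hDsub hQ))]
  have hFfin : ∀ Q ∈ D, ∫⁻ x in Q, f x ∂σ ≠ ∞ := fun Q hQ =>
    setLIntegral_ne_top_of_rpow (hσ₀ Q (hDsub hQ)) hp1 hfp
  have hGfin : ∀ Q ∈ D, ∫⁻ x in Q, g x ∂u ≠ ∞ := fun Q hQ =>
    setLIntegral_ne_top_of_rpow (hu₀ Q (hDsub hQ)) hq1 hgp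
  obtain ⟨L, hL, hLlt, hLtop⟩ := exists_level D (fun Q => F Q / μ.real Q)
    (fun Q hQ => div_pos (hFG Q hQ).1 (hVpos Q hQ))
  set S := D.filter (IsTop D L) with hS
  have hSD : S ⊆ D := Finset.filter_subset _ _
  have hStop : ∀ Q ∈ S, IsTop D L Q := fun Q hQ => (Finset.mem_filter.1 hQ).2
  have hSN := hD.subset hSD
  have hLstrict : ∀ Q ∈ S, ∀ R ∈ S, Q ⊂ R → L R < L Q := fun Q hQ R hR h =>
    lt_of_le_of_ne (hL Q (hSD hQ) R (hSD hR) h.1) (hStop Q hQ R (hSD hR) h)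
  have hFup : ∀ Q ∈ D, F Q ≤ 2 * (2 : ℝ) ^ L Q * μ.real Q := by
    intro Q hQ
    have := hLlt Q hQ
    rw [div_lt_iff₀ (hVpos Q hQ), zpow_add_one₀ (by norm_num)] at this
    linarith
  have hFlo : ∀ Q ∈ S, (2 : ℝ) ^ L Q * μ.real Q ≤ F Q := by
    intro Q hQ
    have := hLtop Q (hSD hQ) (hStop Q hQ)
    rwa [le_div_iff₀ (hVpos Q (hSD hQ))] at this
  have hgen : ∀ R ∈ S, ∀ m : ℕ, ∀ T ⊆ S, (∀ Q ∈ T, Q ⊆ R ∧ L Q = L R + m) →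
      ∑ Q ∈ T, μ.real Q ≤ 2 * (1 / 2) ^ m * μ.real R := by
    intro R hR m T hTS hT
    have h1 : ∑ Q ∈ T, F Q ≤ F R := by
      rw [hFν R (hSD hR), Finset.sum_congr rfl fun Q hQ => hFν Q (hSD (hTS hQ))]
      refine sum_measureReal_le_of_disjoint _ T R ?_ (fun Q hQ =>
        ⟨hm₀ Q (hDsub (hSD (hTS hQ))), (hT Q hQ).1⟩) (fun Q hQ Q' hQ' hne =>
          hSN.disjoint_of_level hLstrict (hTS hQ) (hTS hQ') hne
            ((hT Q hQ).2.trans (hT Q' hQ').2.symm))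
      rw [withDensity_apply _ (hm₀ R (hDsub (hSD hR)))]
      exact hFfin R (hSD hR)
    have h2 : (2 : ℝ) ^ (L R + m) * ∑ Q ∈ T, μ.real Q ≤ 2 * (2 : ℝ) ^ L R * μ.real R := by
      refine le_trans ?_ (h1.trans (hFup R (hSD hR)))
      rw [Finset.mul_sum]
      refine Finset.sum_le_sum fun Q hQ => ?_
      rw [← (hT Q hQ).2]
      exact hFlo Q (hTS hQ)
    rw [zpow_add₀ (by norm_num), zpow_natCast] at h2
    have h3 : (0 : ℝ) < 2 ^ L R := by positivity
    have h4 : (0 : ℝ) < 2 ^ m := by positivity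
    have h5 : (2 : ℝ) ^ m * ∑ Q ∈ T, μ.real Q ≤ 2 * μ.real R :=
      le_of_mul_le_mul_left (by linarith) h3
    rw [one_div, inv_pow]
    rw [← le_div_iff₀' h4] at h5
    refine h5.trans (le_of_eq (by field_simp))
  -- below a top `R` of the levels, up to the next stop, the average of `f` is at most twice that of
  -- `R`, and what remains is a geometric sum over scales
  have hsparse : ∑ Q ∈ D, μ.real Q ^ (-(a + b)) * F Q * G Q ≤
      2 * K * ∑ R ∈ S, μ.real R ^ (-(a + b)) * F R * G R := by
    refine (sum_le_sum_isTop D L _ (fun Q hQ => ?_)).trans ?_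
    · have := (hFG Q hQ).1; have := (hFG Q hQ).2; positivity
    rw [Finset.mul_sum]
    refine Finset.sum_le_sum fun R hR => ?_
    have hRD := hSD hR
    have hVe : ∀ Q ∈ D, μ.real Q ^ (-(a + b)) * μ.real Q = μ.real Q ^ (1 - (a + b)) := by
      intro Q hQ
      rw [← Real.rpow_add_one (hVpos Q hQ).ne']
      congr 1; ring
    set T := D.filter (fun Q => Q ⊆ R ∧ L Q = L R) with hT
    have hTD : ∀ Q ∈ T, Q ∈ D ∧ Q ⊆ R ∧ L Q = L R := fun Q hQ => Finset.mem_filter.1 hQ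
    have h1 := sum_scale_le hd he (u.withDensity g) T R
      (by rw [withDensity_apply _ (hm₀ R (hDsub hRD))]; exact hGfin R hRD)
      (fun Q hQ => ⟨hm₀ Q (hDsub (hTD Q hQ).1), (hTD Q hQ).2.1⟩) (fun Q => μ.real Q) k
      (fun Q hQ => hk₀ Q (hDsub (hTD Q hQ).1)) (hk₀ R (hDsub hRD))
      (fun Q hQ => hkmono₀ Q (hDsub (hTD Q hQ).1) R (hDsub hRD) (hTD Q hQ).2.1)
      (fun Q hQ Q' hQ' => hkdis₀ Q (hDsub (hTD Q hQ).1) Q' (hDsub (hTD Q' hQ').1))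
    rw [← hK, ← hGν R hRD] at h1
    calc _ = ∑ Q ∈ T, μ.real Q ^ (-(a + b)) * F Q * G Q :=
          Finset.sum_congr (by ext; simp [hT]) fun _ _ => rfl
      _ ≤ ∑ Q ∈ T, 2 * (2 : ℝ) ^ L R *
            (μ.real Q ^ (1 - (a + b)) * (u.withDensity g).real Q) := by
          refine Finset.sum_le_sum fun Q hQ => ?_
          have h2 := hTD Q hQ
          have h3 := hFup Q h2.1
          have h4 := hG0 Q
          calc _ ≤ μ.real Q ^ (-(a + b)) * (2 * (2 : ℝ) ^ L Q * μ.real Q) * G Q := by gcongr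
            _ = _ := by rw [← hVe Q h2.1, ← hGν Q h2.1, h2.2.2]; ring
      _ ≤ 2 * (2 : ℝ) ^ L R * (K * (μ.real R ^ (1 - (a + b)) * G R)) := by
          rw [← Finset.mul_sum]; gcongr
      _ = 2 * K * (μ.real R ^ (-(a + b)) * ((2 : ℝ) ^ L R * μ.real R) * G R) := by
          rw [← hVe R hRD]; ring
      _ ≤ 2 * K * (μ.real R ^ (-(a + b)) * F R * G R) := by
          have h3 := hFlo R hR
          have h4 := hG0 R
          gcongr
  -- the classes consist of the cubes on which `t` has a given dyadic size; only sizes at most `A` occur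
  set t : Set X → ℝ := fun Q => u.real Q ^ a * σ.real Q ^ b / μ.real Q ^ (a + b) with ht
  have htpos : ∀ Q ∈ S, 0 < t Q := fun Q hQ => by
    have := hVpos Q (hSD hQ)
    have := hσp₀ Q (hDsub (hSD hQ))
    have := hup₀ Q (hDsub (hSD hQ))
    positivity
  set c : Set X → ℤ := fun Q => Int.log 2 (t Q) with hc
  have hcl : ∀ i : ℤ, ∑ Q ∈ S with c Q = i, μ.real Q ^ (-(a + b)) * F Q * G Q ≤
      C₀ * (2 : ℝ) ^ i * (Nσ ^ a + Nu ^ b) * Z := by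
    intro i
    set T := S.filter (fun Q => c Q = i) with hT
    have hTS : T ⊆ S := Finset.filter_subset _ _
    have hTD : ∀ Q ∈ T, Q ∈ D := fun Q hQ => hSD (hTS hQ)
    have hT0 : ∀ Q ∈ T, Q ∈ D₀ := fun Q hQ => hDsub (hTD Q hQ)
    have hTN := hSN.subset hTS
    have hTl : ∀ Q ∈ T, ∀ R ∈ T, Q ⊂ R → L R < L Q := fun Q hQ R hR =>
      hLstrict Q (hTS hQ) R (hTS hR)
    have hTgen : ∀ R ∈ T, ∀ m : ℕ, ∀ T' ⊆ T, (∀ Q ∈ T', Q ⊆ R ∧ L Q = L R + m) →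
        ∑ Q ∈ T', μ.real Q ≤ 2 * (1 / 2) ^ m * μ.real R := fun R hR m T' hT' =>
      hgen R (hTS hR) m T' (hT'.trans hTS)
    refine hclass σ u (fun Q => μ.real Q) T hTN (fun Q hQ => hne₀ Q (hT0 Q hQ))
      (fun Q hQ => hm₀ Q (hT0 Q hQ)) (fun Q hQ => hVpos Q (hTD Q hQ))
      (fun Q hQ => hσ₀ Q (hT0 Q hQ)) (fun Q hQ => hσp₀ Q (hT0 Q hQ))
      (fun Q hQ => hu₀ Q (hT0 Q hQ)) (fun Q hQ => hup₀ Q (hT0 Q hQ)) L hTl hTgen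
      Nσ hNσ ?_ Nu hNu ?_ (2 ^ i) (by positivity) ?_ ?_
      f hf (fun Q hQ => hFfin Q (hTD Q hQ)) (fun Q hQ => (hFG Q (hTD Q hQ)).1) hfp
      g hg (fun Q hQ => hGfin Q (hTD Q hQ)) (fun Q hQ => (hFG Q (hTD Q hQ)).2) hgp
    · exact sum_measureReal_le_of_sparse μ σ hTN (fun Q hQ => hm₀ Q (hT0 Q hQ))
        (fun Q hQ => hμ₀ Q (hT0 Q hQ)) (fun Q hQ => hσ₀ Q (hT0 Q hQ)) hTl hTgen hNσ
        (fun Q hQ => hNσE Q (hT0 Q hQ))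
    · exact sum_measureReal_le_of_sparse μ u hTN (fun Q hQ => hm₀ Q (hT0 Q hQ))
        (fun Q hQ => hμ₀ Q (hT0 Q hQ)) (fun Q hQ => hu₀ Q (hT0 Q hQ)) hTl hTgen hNu
        (fun Q hQ => hNuE Q (hT0 Q hQ))
    · intro Q hQ
      have h1 := Int.zpow_log_le_self (b := 2) (by norm_num) (htpos Q (hTS hQ))
      have h2 : Int.log 2 (t Q) = i := (Finset.mem_filter.1 hQ).2
      rw [h2] at h1
      have := hVpos Q (hTD Q hQ)
      rw [ht, le_div_iff₀ (by positivity)] at h1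
      exact_mod_cast h1
    · intro Q hQ
      have h1 := (Int.lt_zpow_succ_log_self (b := 2) (by norm_num) (t Q)).le
      have h2 : Int.log 2 (t Q) = i := (Finset.mem_filter.1 hQ).2
      rw [h2, zpow_add_one₀ (by norm_num)] at h1
      have := hVpos Q (hTD Q hQ)
      rw [ht, div_le_iff₀ (by positivity)] at h1
      push_cast at h1
      linarith
  have hIsum : ∑ i ∈ S.image c, (2 : ℝ) ^ i ≤ 2 * A := by
    have := sum_zpow_rpow_le (S.image c) (e := 1) (y := A) one_pos hA (fun i hi => by
      obtain ⟨Q, hQ, rfl⟩ := Finset.mem_image.1 hi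
      have h1 := Int.zpow_log_le_self (b := 2) (by norm_num) (htpos Q hQ)
      refine le_trans (by exact_mod_cast h1) ?_
      have := hVpos Q (hSD hQ)
      rw [ht]; simp only
      rw [div_le_iff₀ (by positivity)]
      exact hApq Q (hDsub (hSD hQ)))
    simp only [Real.rpow_one] at this
    refine this.trans (le_of_eq ?_)
    rw [Real.rpow_neg_one]; norm_num
  calc ∑ Q ∈ D₀, μ.real Q ^ (-(a + b)) * F Q * G Q
      = ∑ Q ∈ D, μ.real Q ^ (-(a + b)) * F Q * G Q := by
        refine (Finset.sum_subset hDsub fun Q hQ hQD => ?_).symm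
        have : ¬ (0 < F Q ∧ 0 < G Q) := fun h => hQD (Finset.mem_filter.2 ⟨hQ, h⟩)
        rcases (hF0 Q).eq_or_lt with h | h
        · rw [← h]; ring
        · rcases (hG0 Q).eq_or_lt with h' | h'
          · rw [← h']; ring
          · exact absurd ⟨h, h'⟩ this
    _ ≤ 2 * K * ∑ R ∈ S, μ.real R ^ (-(a + b)) * F R * G R := hsparse
    _ = 2 * K * ∑ i ∈ S.image c, ∑ Q ∈ S with c Q = i, μ.real Q ^ (-(a + b)) * F Q * G Q := by
        rw [Finset.sum_fiberwise_of_maps_to (fun Q hQ => Finset.mem_image_of_mem c hQ)]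
    _ ≤ 2 * K * ∑ i ∈ S.image c, C₀ * (2 : ℝ) ^ i * (Nσ ^ a + Nu ^ b) * Z := by
        gcongr with i _
        exact hcl i
    _ = 2 * K * (C₀ * (∑ i ∈ S.image c, (2 : ℝ) ^ i) * (Nσ ^ a + Nu ^ b) * Z) := by
        simp only [Finset.mul_sum, Finset.sum_mul]
    _ ≤ 2 * K * (C₀ * (2 * A) * (Nσ ^ a + Nu ^ b) * Z) := by gcongr
    _ = _ := by ring

end

section

/-! ### Grid cells -/

variable {n : ℕ}

/-- The half-open cell with index `j` of the grid with base point `t` and mesh `h`. -/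
noncomputable def cell (t : E n) (h : ℝ) (j : Fin n → ℤ) : Set (E n) :=
  {x | ∀ i, ⌊(x i - t i) / h⌋ = j i}

/-- The index of the cell containing `x`. -/
noncomputable def cellIndex (t : E n) (h : ℝ) (x : E n) : Fin n → ℤ := fun i => ⌊(x i - t i) / h⌋

/-- The lower corner of a cell. -/
noncomputable def cellCorner (t : E n) (h : ℝ) (j : Fin n → ℤ) : E n :=
  WithLp.toLp 2 (fun i => t i + h * j i)

theorem mem_cell_iff {t : E n} {h : ℝ} {j : Fin n → ℤ} {x : E n} :
    x ∈ cell t h j ↔ cellIndex t h x = j := by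
  simp [cell, cellIndex, funext_iff]

theorem mem_cell_cellIndex (t : E n) (h : ℝ) (x : E n) : x ∈ cell t h (cellIndex t h x) :=
  mem_cell_iff.2 rfl

theorem disjoint_cell (t : E n) (h : ℝ) {j j' : Fin n → ℤ} (hj : j ≠ j') :
    Disjoint (cell t h j) (cell t h j') :=
  Set.disjoint_left.2 fun _ hx hx' => hj ((mem_cell_iff.1 hx).symm.trans (mem_cell_iff.1 hx'))

theorem mem_cell_iff_bounds {t : E n} {h : ℝ} (hh : 0 < h) {j : Fin n → ℤ} {x : E n} :
    x ∈ cell t h j ↔ ∀ i, t i + h * j i ≤ x i ∧ x i < t i + h * j i + h := by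
  refine forall_congr' fun i => ?_
  rw [Int.floor_eq_iff, le_div_iff₀ hh, div_lt_iff₀ hh]
  constructor <;> rintro ⟨h1, h2⟩ <;> constructor <;> linarith

theorem cell_eq_preimage {t : E n} {h : ℝ} (hh : 0 < h) (j : Fin n → ℤ) :
    cell t h j = WithLp.ofLp ⁻¹' (Set.univ.pi fun i => Set.Ico (t i + h * j i) (t i + h * j i + h)) := by
  ext x
  rw [mem_cell_iff_bounds hh]
  simp [Set.mem_pi]

theorem cube_eq_preimage (a : E n) (l : ℝ) :
    cube a l = WithLp.ofLp ⁻¹' (Set.univ.pi fun i => Set.Icc (a i) (a i + l)) := by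
  ext x
  simp [cube, Pi.le_def, forall_and]

theorem measurableSet_cell (t : E n) {h : ℝ} (hh : 0 < h) (j : Fin n → ℤ) :
    MeasurableSet (cell t h j) := by
  rw [cell_eq_preimage hh]
  exact (PiLp.volume_preserving_ofLp (Fin n)).measurable
    (MeasurableSet.univ_pi fun i => measurableSet_Ico)

theorem isCompact_cube (a : E n) (l : ℝ) : IsCompact (cube a l) := by
  rw [cube_eq_preimage]
  exact (PiLp.homeomorph 2 (fun _ : Fin n => ℝ)).isCompact_preimage.2
    (isCompact_univ_pi fun i => isCompact_Icc)

theorem measurableSet_cube (a : E n) (l : ℝ) : MeasurableSet (cube a l) :=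
  (isCompact_cube a l).measurableSet

theorem volume_cell (t : E n) {h : ℝ} (hh : 0 < h) (j : Fin n → ℤ) :
    volume (cell t h j) = ENNReal.ofReal h ^ n := by
  rw [cell_eq_preimage hh, (PiLp.volume_preserving_ofLp (Fin n)).measure_preimage
    (MeasurableSet.univ_pi fun i => measurableSet_Ico).nullMeasurableSet, Real.volume_pi_Ico]
  simp

theorem volume_cube (a : E n) (l : ℝ) : volume (cube a l) = ENNReal.ofReal l ^ n := by
  rw [cube_eq_preimage, (PiLp.volume_preserving_ofLp (Fin n)).measure_preimage
    (MeasurableSet.univ_pi fun i => measurableSet_Icc).nullMeasurableSet, volume_pi,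
    Measure.pi_pi]
  simp [Real.volume_Icc]

theorem volume_real_cell (t : E n) {h : ℝ} (hh : 0 < h) (j : Fin n → ℤ) :
    volume.real (cell t h j) = h ^ n := by
  rw [Measure.real, volume_cell t hh, ENNReal.toReal_pow, ENNReal.toReal_ofReal hh.le]

theorem cell_subset_cube (t : E n) {h : ℝ} (hh : 0 < h) (j : Fin n → ℤ) :
    cell t h j ⊆ cube (cellCorner t h j) h := by
  intro x hx i
  have := (mem_cell_iff_bounds hh).1 hx i
  exact ⟨this.1, this.2.le⟩

theorem cell_ae_eq_cube (t : E n) {h : ℝ} (hh : 0 < h) (j : Fin n → ℤ) :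
    cell t h j =ᵐ[volume] cube (cellCorner t h j) h := by
  refine ae_eq_of_subset_of_measure_ge (cell_subset_cube t hh j) ?_
    (measurableSet_cell t hh j).nullMeasurableSet ?_
  · rw [volume_cell t hh, volume_cube]
  · rw [volume_cube]; exact ENNReal.pow_ne_top ENNReal.ofReal_ne_top

/-- Every cube is, up to a null set, the cell of index `0` of the grid based at its corner. -/
theorem cellCorner_zero (a : E n) (h : ℝ) : cellCorner a h 0 = a := by
  ext i; simp [cellCorner]

theorem cell_nonempty (t : E n) {h : ℝ} (hh : 0 < h) (j : Fin n → ℤ) : (cell t h j).Nonempty :=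
  ⟨cellCorner t h j, (mem_cell_iff_bounds hh).2 fun i => ⟨le_rfl, by
    simp [cellCorner, hh]⟩⟩

theorem cellIndex_mul_natCast (t : E n) (h : ℝ) (N : ℕ) (x : E n) :
    cellIndex t (h * N) x = fun i => cellIndex t h x i / (N : ℤ) := by
  funext i
  simp only [cellIndex]
  rw [← Int.floor_div_natCast, div_div]

theorem cell_subset_cell_of_mem {t : E n} {h : ℝ} {N : ℕ} {j j' : Fin n → ℤ} {x : E n}
    (h1 : x ∈ cell t h j) (h2 : x ∈ cell t (h * N) j') : cell t h j ⊆ cell t (h * N) j' := by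
  intro y hy
  rw [mem_cell_iff] at h1 h2 hy ⊢
  rw [← h2, cellIndex_mul_natCast, cellIndex_mul_natCast, h1, hy]

/-- The dyadic cell of side `2 ^ k.1` and index `k.2` in the grid based at `t`. -/
noncomputable def dyadicCell (t : E n) (k : ℤ × (Fin n → ℤ)) : Set (E n) := cell t ((2 : ℝ) ^ k.1) k.2

theorem dyadicCell_subset_of_mem {t : E n} {k l : ℤ × (Fin n → ℤ)} (hkl : k.1 ≤ l.1) {x : E n}
    (h1 : x ∈ dyadicCell t k) (h2 : x ∈ dyadicCell t l) : dyadicCell t k ⊆ dyadicCell t l := by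
  have e : (2 : ℝ) ^ l.1 = (2 : ℝ) ^ k.1 * ((2 ^ (l.1 - k.1).toNat : ℕ) : ℝ) := by
    push_cast
    rw [← zpow_natCast, Int.toNat_of_nonneg (by omega), ← zpow_add₀ (by norm_num)]
    congr 1; ring
  unfold dyadicCell at *
  rw [e] at h2 ⊢
  exact cell_subset_cell_of_mem h1 h2

theorem dyadicCell_nested (t : E n) (k l : ℤ × (Fin n → ℤ)) :
    dyadicCell t k ⊆ dyadicCell t l ∨ dyadicCell t l ⊆ dyadicCell t k ∨
      Disjoint (dyadicCell t k) (dyadicCell t l) := by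
  by_cases h : Disjoint (dyadicCell t k) (dyadicCell t l)
  · exact Or.inr (Or.inr h)
  · obtain ⟨x, h1, h2⟩ := Set.not_disjoint_iff.1 h
    rcases le_total k.1 l.1 with h3 | h3
    · exact Or.inl (dyadicCell_subset_of_mem h3 h1 h2)
    · exact Or.inr (Or.inl (dyadicCell_subset_of_mem h3 h2 h1))

theorem volume_real_dyadicCell (t : E n) (k : ℤ × (Fin n → ℤ)) :
    volume.real (dyadicCell t k) = ((2 : ℝ) ^ k.1) ^ n :=
  volume_real_cell t (by positivity) _

theorem scale_le_of_dyadicCell_subset (hn : 0 < n) {t : E n} {k l : ℤ × (Fin n → ℤ)}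
    (h : dyadicCell t k ⊆ dyadicCell t l) : k.1 ≤ l.1 := by
  have h1 := measureReal_mono (μ := volume) h
    (by rw [dyadicCell, volume_cell t (by positivity)]; exact ENNReal.pow_ne_top ENNReal.ofReal_ne_top)
  rw [volume_real_dyadicCell, volume_real_dyadicCell] at h1
  have h2 := (pow_le_pow_iff_left₀ (by positivity) (by positivity) hn.ne').1 h1
  exact (zpow_le_zpow_iff_right₀ (by norm_num)).1 h2

theorem dyadicCell_injective (hn : 0 < n) (t : E n) : Function.Injective (dyadicCell t) := by
  intro k l h
  have h1 : k.1 = l.1 :=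
    le_antisymm (scale_le_of_dyadicCell_subset hn h.le) (scale_le_of_dyadicCell_subset hn h.ge)
  refine Prod.ext h1 ?_
  obtain ⟨x, hx⟩ := cell_nonempty t (h := (2 : ℝ) ^ k.1) (by positivity) k.2
  have hx' : x ∈ dyadicCell t l := h ▸ (show x ∈ dyadicCell t k from hx)
  unfold dyadicCell at hx'
  rw [← h1] at hx'
  exact (mem_cell_iff.1 hx).symm.trans (mem_cell_iff.1 hx')

/-- The one-third trick: two nearby reals lie in the same dyadic interval of side `2 ^ k`, either in
the standard grid or in the grid translated by `2 ^ N / 3`, for every `k ≤ N`. -/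
theorem floor_eq_or_floor_eq_of_abs_sub_lt {x y : ℝ} {k N : ℤ} (hk : k ≤ N)
    (hxy : 3 * |x - y| < 2 ^ k) :
    ⌊x / 2 ^ k⌋ = ⌊y / 2 ^ k⌋ ∨
      ⌊(x - 2 ^ N / 3) / 2 ^ k⌋ = ⌊(y - 2 ^ N / 3) / 2 ^ k⌋ := by
  wlog hle : x ≤ y generalizing x y
  · rcases this (by rwa [abs_sub_comm]) (not_le.1 hle).le with h | h
    · exact Or.inl h.symm
    · exact Or.inr h.symm
  by_contra hcon
  push Not at hcon
  have hp : (0 : ℝ) < 2 ^ k := by positivity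
  set X := x / 2 ^ k with hX
  set Y := y / 2 ^ k with hY
  set M : ℕ := 2 ^ (N - k).toNat with hM
  have hMr : (2 : ℝ) ^ N / 3 / 2 ^ k = (M : ℝ) / 3 := by
    rw [hM]; push_cast
    rw [← zpow_natCast, Int.toNat_of_nonneg (by omega), zpow_sub₀ (by norm_num)]
    field_simp
  have hXY : 3 * (Y - X) < 1 := by
    rw [abs_sub_comm, abs_of_nonneg (by linarith), ← lt_div_iff₀' (by norm_num)] at hxy
    rw [hX, hY, ← sub_div, ← lt_div_iff₀' (by norm_num), div_lt_iff₀ hp]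
    linarith
  have hXleY : X ≤ Y := by rw [hX, hY]; gcongr
  rw [sub_div, sub_div, hMr, ← hX, ← hY] at hcon
  have h1 : ⌊X⌋ < ⌊Y⌋ := lt_of_le_of_ne (Int.floor_le_floor hXleY) hcon.1
  have h2 : ⌊X - M / 3⌋ < ⌊Y - M / 3⌋ :=
    lt_of_le_of_ne (Int.floor_le_floor (by linarith)) hcon.2
  have h3 := Int.floor_lt.1 h1
  have h4 := Int.floor_lt.1 h2
  have h5 := Int.floor_le Y
  have h6 := Int.floor_le (Y - M / 3)
  set m := ⌊Y⌋
  set m' := ⌊Y - M / 3⌋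
  have h7 : (3 * (m - m') - M : ℤ) < 1 := by
    have : ((3 * (m - m') - M : ℤ) : ℝ) < 1 := by push_cast; linarith
    exact_mod_cast this
  have h8 : (-1 : ℤ) < 3 * (m - m') - M := by
    have : (-1 : ℝ) < ((3 * (m - m') - M : ℤ) : ℝ) := by push_cast; linarith
    exact_mod_cast this
  have h9 : (3 : ℤ) ∣ (M : ℤ) := ⟨m - m', by omega⟩
  have h10 : 3 ∣ M := by exact_mod_cast h9
  have := (Nat.Prime.dvd_of_dvd_pow Nat.prime_three h10)
  omega

/-- The base points of the `2 ^ n` translated grids used at scales up to `2 ^ N`. -/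
noncomputable def thirdShift (N : ℤ) (s : Fin n → Bool) : E n :=
  WithLp.toLp 2 (fun i => if s i then (2 : ℝ) ^ N / 3 else 0)

/-- The one-third trick: two points at distance less than a third of a dyadic scale lie in a common
cell of that scale in one of the `2 ^ n` shifted grids. In each coordinate, adjacent end points of
the two grids of mesh `2 ^ k` are at distance at least `2 ^ k / 3`, since `3` does not divide a
power of `2`. -/
theorem exists_common_dyadicCell {x y : E n} {k N : ℤ} (hk : k ≤ N)
    (hxy : 3 * ‖x - y‖ < 2 ^ k) :
    ∃ (s : Fin n → Bool) (j : Fin n → ℤ), x ∈ dyadicCell (thirdShift N s) (k, j) ∧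
      y ∈ dyadicCell (thirdShift N s) (k, j) := by
  have h : ∀ i, ∃ c : Bool, ⌊(x i - if c then (2 : ℝ) ^ N / 3 else 0) / 2 ^ k⌋ =
      ⌊(y i - if c then (2 : ℝ) ^ N / 3 else 0) / 2 ^ k⌋ := by
    intro i
    have h1 : |x i - y i| ≤ ‖x - y‖ := by
      have := PiLp.norm_apply_le (x - y) i
      simpa using this
    rcases floor_eq_or_floor_eq_of_abs_sub_lt (x := x i) (y := y i) hk (by linarith) with h | h
    · exact ⟨false, by simpa using h⟩
    · exact ⟨true, by simpa using h⟩
  choose s hs using h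
  refine ⟨s, cellIndex (thirdShift N s) ((2 : ℝ) ^ k) x, mem_cell_cellIndex _ _ _, ?_⟩
  refine mem_cell_iff.2 (funext fun i => ?_)
  have := hs i
  simp only [cellIndex, thirdShift]
  exact this.symm

end

section

variable {n : ℕ}

/-! ### The fractional integral for two measures -/

theorem measurable_rieszKernel (α : ℝ) :
    Measurable (fun z : E n × E n => ENNReal.ofReal (rieszKernel α z.1 z.2)) := by
  unfold rieszKernel
  fun_prop

theorem rieszKernel_nonneg (α : ℝ) (x y : E n) : 0 ≤ rieszKernel α x y := by
  unfold rieszKernel; positivity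

open Classical in
/-- The kernel of the fractional integral is dominated by dyadic kernels over finitely many grids. -/
theorem rieszKernel_le_sum_dyadic (hn : 0 < n) {α : ℝ} (hαn : α < n) {N : ℤ} {x y : E n}
    (hxy : 6 * ‖x - y‖ ≤ 2 ^ N) :
    ENNReal.ofReal (rieszKernel α x y) ≤ ENNReal.ofReal ((6 : ℝ) ^ ((n : ℝ) - α)) *
      ∑ s : Fin n → Bool, ∑' k : ℤ × (Fin n → ℤ),
        ENNReal.ofReal ((((2 : ℝ) ^ k.1) ^ n) ^ (-(1 - α / n))) *
          ((dyadicCell (thirdShift N s) k).indicator 1 x *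
            (dyadicCell (thirdShift N s) k).indicator 1 y) := by
  have hna : 0 < (n : ℝ) - α := by linarith
  have hn' : (0 : ℝ) < n := by exact_mod_cast hn
  -- on the diagonal the kernel has the value `1 / 0 = 0`
  rcases eq_or_ne x y with rfl | hne
  · have : rieszKernel α x x = 0 := by
      simp [rieszKernel, Real.zero_rpow hna.ne']
    simp [this]
  have hpos : 0 < ‖x - y‖ := norm_pos_iff.2 (sub_ne_zero.2 hne)
  set k := Int.log 2 (6 * ‖x - y‖) with hk
  have h1 : (2 : ℝ) ^ k ≤ 6 * ‖x - y‖ := by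
    exact_mod_cast Int.zpow_log_le_self (b := 2) (r := 6 * ‖x - y‖) (by norm_num) (by positivity)
  have h2 : 6 * ‖x - y‖ < (2 : ℝ) ^ (k + 1) := by
    exact_mod_cast Int.lt_zpow_succ_log_self (b := 2) (by norm_num) (6 * ‖x - y‖)
  have hkN : k ≤ N := (zpow_le_zpow_iff_right₀ (a := (2 : ℝ)) (by norm_num)).1 (h1.trans hxy)
  rw [zpow_add_one₀ (by norm_num)] at h2
  obtain ⟨s, j, hx, hy⟩ := exists_common_dyadicCell (x := x) (y := y) hkN (by linarith)
  have h3 : rieszKernel α x y ≤ (6 : ℝ) ^ ((n : ℝ) - α) * (((2 : ℝ) ^ k) ^ n) ^ (-(1 - α / n)) := by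
    have e : (((2 : ℝ) ^ k) ^ n) ^ (-(1 - α / n)) = (((2 : ℝ) ^ k) ^ ((n : ℝ) - α))⁻¹ := by
      rw [← Real.rpow_natCast, ← Real.rpow_mul (by positivity), ← Real.rpow_neg (by positivity)]
      congr 1; field_simp
    rw [e, rieszKernel, ← div_eq_mul_inv, ← Real.div_rpow (by norm_num) (by positivity), one_div,
      ← Real.inv_rpow (by positivity)]
    refine Real.rpow_le_rpow (by positivity) ?_ hna.le
    rw [le_div_iff₀ (by positivity), inv_mul_le_iff₀ hpos]
    linarith
  refine (ENNReal.ofReal_le_ofReal h3).trans ?_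
  rw [ENNReal.ofReal_mul (by positivity)]
  gcongr
  refine le_trans ?_ (Finset.single_le_sum (f := fun s => ∑' k : ℤ × (Fin n → ℤ),
        ENNReal.ofReal ((((2 : ℝ) ^ k.1) ^ n) ^ (-(1 - α / n))) *
          ((dyadicCell (thirdShift N s) k).indicator 1 x *
            (dyadicCell (thirdShift N s) k).indicator 1 y)) (fun _ _ => zero_le) (Finset.mem_univ s))
  refine le_trans ?_ (ENNReal.le_tsum (k, j))
  simp [hx, hy]

/-- The joint conditions on two measures under which the fractional integral is bounded: a joint
`A_{p,q}` bound with constant `A`, and, for each measure, that a subset carrying half of the volume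
of a cell carries at least the fraction `1 / N` of the measure of that cell. Here `a = 1 / q` and
`b = 1 / p'`. -/
structure JointApq (a b A Nσ Nu : ℝ) (σ u : Measure (E n)) : Prop where
  fin_left : ∀ t h j, 0 < h → σ (cell t h j) ≠ ∞
  pos_left : ∀ t h j, 0 < h → 0 < σ.real (cell t h j)
  fin_right : ∀ t h j, 0 < h → u (cell t h j) ≠ ∞
  pos_right : ∀ t h j, 0 < h → 0 < u.real (cell t h j)
  half_left : ∀ t h j, 0 < h → ∀ F ⊆ cell t h j, MeasurableSet F →
    volume.real (cell t h j) ≤ 2 * volume.real F → σ.real (cell t h j) ≤ Nσ * σ.real F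
  half_right : ∀ t h j, 0 < h → ∀ F ⊆ cell t h j, MeasurableSet F →
    volume.real (cell t h j) ≤ 2 * volume.real F → u.real (cell t h j) ≤ Nu * u.real F
  apq : ∀ t h j, 0 < h → u.real (cell t h j) ^ a * σ.real (cell t h j) ^ b ≤
    A * volume.real (cell t h j) ^ (a + b)

/-- The dyadic bilinear form over a whole grid, as the supremum of its finite partial sums. -/
theorem tsum_dyadic_form_le (hn : 0 < n) {a b : ℝ} (ha : 0 < a) (ha1 : a < 1) (hb : 0 < b)
    (hb1 : b < 1) (hab : a + b < 1) :
    ∃ C : ℝ, 0 < C ∧ ∀ (A Nσ Nu : ℝ), 0 < A → 0 ≤ Nσ → 0 ≤ Nu → ∀ (σ u : Measure (E n)),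
      JointApq a b A Nσ Nu σ u →
      ∀ f : E n → ℝ≥0∞, Measurable f → ∫⁻ x, f x ^ (1 / (1 - b)) ∂σ ≠ ∞ →
      ∀ g : E n → ℝ≥0∞, Measurable g → ∫⁻ x, g x ^ (1 / (1 - a)) ∂u ≠ ∞ →
      ∀ t : E n, ∑' k : ℤ × (Fin n → ℤ), ENNReal.ofReal ((((2 : ℝ) ^ k.1) ^ n) ^ (-(a + b))) *
        ((∫⁻ y in dyadicCell t k, f y ∂σ) * ∫⁻ x in dyadicCell t k, g x ∂u) ≤
        ENNReal.ofReal (C * (A * (Nσ ^ a + Nu ^ b))) *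
          ((∫⁻ x, f x ^ (1 / (1 - b)) ∂σ) ^ (1 - b) * (∫⁻ x, g x ^ (1 / (1 - a)) ∂u) ^ (1 - a)) := by
  classical
  obtain ⟨C, hC, hmain⟩ := sum_dyadic_form_le (X := E n) (d := n) ha ha1 hb hb1 hab
    (by exact_mod_cast hn)
  refine ⟨C, hC, ?_⟩
  intro A Nσ Nu hA hNσ hNu σ u hJ f hf hfp g hg hgp t
  have hp1 : (1 : ℝ) ≤ 1 / (1 - b) := by rw [le_div_iff₀ (by linarith)]; linarith
  have hq1 : (1 : ℝ) ≤ 1 / (1 - a) := by rw [le_div_iff₀ (by linarith)]; linarith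
  have h2p : ∀ k : ℤ, (0 : ℝ) < 2 ^ k := fun k => by positivity
  have hinj := dyadicCell_injective hn t
  have hFfin : ∀ k, ∫⁻ y in dyadicCell t k, f y ∂σ ≠ ∞ := fun k =>
    setLIntegral_ne_top_of_rpow (hJ.fin_left _ _ _ (h2p _)) hp1 hfp
  have hGfin : ∀ k, ∫⁻ y in dyadicCell t k, g y ∂u ≠ ∞ := fun k =>
    setLIntegral_ne_top_of_rpow (hJ.fin_right _ _ _ (h2p _)) hq1 hgp
  rw [ENNReal.tsum_eq_iSup_sum]
  refine iSup_le fun s => ?_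
  set D := s.image (dyadicCell t) with hD
  have hDk : ∀ Q ∈ D, ∃ k, dyadicCell t k = Q := fun Q hQ => by
    obtain ⟨k, _, h⟩ := Finset.mem_image.1 hQ; exact ⟨k, h⟩
  let sc : Set (E n) → ℤ := fun Q => (Function.invFun (dyadicCell t) Q).1
  have hsc : ∀ k, sc (dyadicCell t k) = k.1 := fun k => by
    simp only [sc, Function.leftInverse_invFun hinj k]
  have h := hmain volume σ u D
    (fun Q hQ R hR => by
      obtain ⟨k, rfl⟩ := hDk Q hQ; obtain ⟨l, rfl⟩ := hDk R hR; exact dyadicCell_nested t k l)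
    (fun Q hQ => by obtain ⟨k, rfl⟩ := hDk Q hQ; exact cell_nonempty t (h2p _) _)
    (fun Q hQ => by obtain ⟨k, rfl⟩ := hDk Q hQ; exact measurableSet_cell t (h2p _) _)
    sc
    (fun Q hQ => by
      obtain ⟨k, rfl⟩ := hDk Q hQ
      rw [hsc, volume_real_dyadicCell, Real.rpow_natCast])
    (fun Q hQ => by
      obtain ⟨k, rfl⟩ := hDk Q hQ
      rw [dyadicCell, volume_cell t (h2p _)]; exact ENNReal.pow_ne_top ENNReal.ofReal_ne_top)
    (fun Q hQ R hR h => by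
      obtain ⟨k, rfl⟩ := hDk Q hQ; obtain ⟨l, rfl⟩ := hDk R hR
      rw [hsc, hsc]; exact scale_le_of_dyadicCell_subset hn h)
    (fun Q hQ R hR hne h => by
      obtain ⟨k, rfl⟩ := hDk Q hQ; obtain ⟨l, rfl⟩ := hDk R hR
      rw [hsc, hsc] at h
      unfold dyadicCell
      rw [h]
      refine disjoint_cell t _ fun h' => hne ?_
      rw [Prod.ext h h'])
    (fun Q hQ => by obtain ⟨k, rfl⟩ := hDk Q hQ; exact hJ.fin_left _ _ _ (h2p _))
    (fun Q hQ => by obtain ⟨k, rfl⟩ := hDk Q hQ; exact hJ.pos_left _ _ _ (h2p _))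
    (fun Q hQ => by obtain ⟨k, rfl⟩ := hDk Q hQ; exact hJ.fin_right _ _ _ (h2p _))
    (fun Q hQ => by obtain ⟨k, rfl⟩ := hDk Q hQ; exact hJ.pos_right _ _ _ (h2p _))
    Nσ hNσ (fun Q hQ => by obtain ⟨k, rfl⟩ := hDk Q hQ; exact hJ.half_left _ _ _ (h2p _))
    Nu hNu (fun Q hQ => by obtain ⟨k, rfl⟩ := hDk Q hQ; exact hJ.half_right _ _ _ (h2p _))
    A hA (fun Q hQ => by obtain ⟨k, rfl⟩ := hDk Q hQ; exact hJ.apq _ _ _ (h2p _))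
    f hf hfp g hg hgp
  rw [hD, Finset.sum_image hinj.injOn] at h
  have h' := ENNReal.ofReal_le_ofReal h
  have hCA : 0 ≤ C * (A * (Nσ ^ a + Nu ^ b)) := by positivity
  rw [ENNReal.ofReal_sum_of_nonneg (fun _ _ => by positivity), mul_assoc C,
    ENNReal.ofReal_mul hCA, ENNReal.ofReal_mul (p := ENNReal.toReal _ ^ _) (by positivity),
    ← ENNReal.ofReal_rpow_of_nonneg ENNReal.toReal_nonneg (by linarith),
    ← ENNReal.ofReal_rpow_of_nonneg ENNReal.toReal_nonneg (by linarith),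
    ENNReal.ofReal_toReal hfp, ENNReal.ofReal_toReal hgp] at h'
  refine le_trans (le_of_eq (Finset.sum_congr rfl fun k _ => ?_)) h'
  rw [mul_assoc, ENNReal.ofReal_mul (by positivity), ENNReal.ofReal_mul (by positivity),
    ENNReal.ofReal_toReal (hFfin k), ENNReal.ofReal_toReal (hGfin k), volume_real_dyadicCell]

/-- The bilinear form of the fractional integral for two measures, by domination of the kernel by
dyadic ones. The shifts of the grids depend on the largest scale `2 ^ N`, so the form is first
restricted to pairs at distance at most a multiple of `2 ^ N`; the bound does not depend on `N`. -/
theorem lintegral_riesz_form_le (hn : 0 < n) {α a b : ℝ} (hαn : α < n)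
    (ha : 0 < a) (ha1 : a < 1) (hb : 0 < b) (hb1 : b < 1) (hab : a + b < 1)
    (habα : a + b = 1 - α / n) :
    ∃ C : ℝ, 0 < C ∧ ∀ (A Nσ Nu : ℝ), 0 < A → 0 ≤ Nσ → 0 ≤ Nu →
      ∀ (σ u : Measure (E n)) [SFinite σ] [SFinite u], JointApq a b A Nσ Nu σ u →
      ∀ f : E n → ℝ≥0∞, Measurable f → ∫⁻ x, f x ^ (1 / (1 - b)) ∂σ ≠ ∞ →
      ∀ g : E n → ℝ≥0∞, Measurable g → ∫⁻ x, g x ^ (1 / (1 - a)) ∂u ≠ ∞ →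
      ∫⁻ x, g x * ∫⁻ y, ENNReal.ofReal (rieszKernel α x y) * f y ∂σ ∂u ≤
        ENNReal.ofReal (C * (A * (Nσ ^ a + Nu ^ b))) *
          ((∫⁻ x, f x ^ (1 / (1 - b)) ∂σ) ^ (1 - b) * (∫⁻ x, g x ^ (1 / (1 - a)) ∂u) ^ (1 - a)) := by
  classical
  obtain ⟨C₀, hC₀, hmain⟩ := tsum_dyadic_form_le hn ha ha1 hb hb1 hab
  set c : ℝ := (6 : ℝ) ^ ((n : ℝ) - α) with hc
  have hcp : 0 < c := by positivity
  refine ⟨c * (2 ^ n * C₀), by positivity, ?_⟩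
  intro A Nσ Nu hA hNσ hNu σ u _ _ hJ f hf hfp g hg hgp
  set Z := (∫⁻ x, f x ^ (1 / (1 - b)) ∂σ) ^ (1 - b) * (∫⁻ x, g x ^ (1 / (1 - a)) ∂u) ^ (1 - a) with hZ
  set Φ : E n × E n → ℝ≥0∞ := fun z => g z.1 * (ENNReal.ofReal (rieszKernel α z.1 z.2) * f z.2) with hΦ
  have hΦm : Measurable Φ :=
    (hg.comp measurable_fst).mul ((measurable_rieszKernel α).mul (hf.comp measurable_snd))
  have e1 : ∫⁻ x, g x * ∫⁻ y, ENNReal.ofReal (rieszKernel α x y) * f y ∂σ ∂u =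
      ∫⁻ z, Φ z ∂(u.prod σ) := by
    rw [lintegral_prod _ hΦm.aemeasurable]
    refine lintegral_congr fun x => ?_
    exact (lintegral_const_mul _
      (((measurable_rieszKernel α).comp measurable_prodMk_left).mul hf)).symm
  set B : ℕ → Set (E n × E n) := fun N => {z | 6 * ‖z.1 - z.2‖ ≤ 2 ^ (N : ℤ)} with hB
  have hBm : ∀ N, MeasurableSet (B N) := fun N =>
    measurableSet_le (by fun_prop) measurable_const
  have hBU : ⋃ N, B N = Set.univ := by
    refine Set.eq_univ_of_forall fun z => Set.mem_iUnion.2 ?_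
    obtain ⟨N, hN⟩ := pow_unbounded_of_one_lt (6 * ‖z.1 - z.2‖) (by norm_num : (1 : ℝ) < 2)
    exact ⟨N, by simpa [hB] using hN.le⟩
  have hBmono : Monotone B := fun N M hNM z hz =>
    le_trans (show 6 * ‖z.1 - z.2‖ ≤ 2 ^ (N : ℤ) from hz)
      (zpow_le_zpow_right₀ (by norm_num) (by exact_mod_cast hNM))
  rw [e1, ← setLIntegral_univ, ← hBU, setLIntegral_iUnion_of_directed _ hBmono.directed_le]
  refine iSup_le fun N => ?_
  set T : (Fin n → Bool) → E n := fun s => thirdShift (N : ℤ) s with hT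
  have hcm : ∀ t k, MeasurableSet (dyadicCell (n := n) t k) := fun t k =>
    measurableSet_cell t (by positivity) _
  set v : ℤ × (Fin n → ℤ) → ℝ≥0∞ := fun k => ENNReal.ofReal ((((2 : ℝ) ^ k.1) ^ n) ^ (-(a + b))) with hv
  set G : (Fin n → Bool) → ℤ × (Fin n → ℤ) → E n → ℝ≥0∞ :=
    fun s k => (dyadicCell (T s) k).indicator g with hG
  set F : (Fin n → Bool) → ℤ × (Fin n → ℤ) → E n → ℝ≥0∞ :=
    fun s k => (dyadicCell (T s) k).indicator f with hF
  have hGm : ∀ s k, Measurable (G s k) := fun s k => hg.indicator (hcm _ _)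
  have hFm : ∀ s k, Measurable (F s k) := fun s k => hf.indicator (hcm _ _)
  calc ∫⁻ z in B N, Φ z ∂(u.prod σ)
      ≤ ∫⁻ z, ENNReal.ofReal c * ∑ s : Fin n → Bool, ∑' k, v k * (G s k z.1 * F s k z.2)
          ∂(u.prod σ) := by
        rw [← lintegral_indicator (hBm N)]
        refine lintegral_mono fun z => ?_
        by_cases hz : z ∈ B N
        swap
        · rw [Set.indicator_of_notMem hz]; exact zero_le
        rw [Set.indicator_of_mem hz]
        have h1 := rieszKernel_le_sum_dyadic hn hαn (N := N) (x := z.1) (y := z.2) hz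
        rw [← habα] at h1
        calc Φ z ≤ g z.1 * ((ENNReal.ofReal c * ∑ s : Fin n → Bool, ∑' k, v k *
                ((dyadicCell (T s) k).indicator 1 z.1 * (dyadicCell (T s) k).indicator 1 z.2)) *
                f z.2) := by
              simp only [hΦ]
              gcongr
          _ = ENNReal.ofReal c * ∑ s : Fin n → Bool, ∑' k, g z.1 * (v k *
                ((dyadicCell (T s) k).indicator 1 z.1 * (dyadicCell (T s) k).indicator 1 z.2)) *
                f z.2 := by
              simp_rw [ENNReal.tsum_mul_right, ENNReal.tsum_mul_left, ← Finset.sum_mul,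
                ← Finset.mul_sum]
              ring
          _ = _ := by
              congr 1
              refine Finset.sum_congr rfl fun s _ => tsum_congr fun k => ?_
              simp only [hG, hF, Set.indicator]
              split_ifs <;> simp only [Pi.one_apply, mul_zero, zero_mul, mul_one]; ring
    _ = ENNReal.ofReal c * ∑ s : Fin n → Bool, ∑' k, v k *
          ((∫⁻ y in dyadicCell (T s) k, f y ∂σ) * ∫⁻ x in dyadicCell (T s) k, g x ∂u) := by
        have hm1 : ∀ s k, Measurable fun z : E n × E n => v k * (G s k z.1 * F s k z.2) := fun s k =>
          (((hGm s k).comp measurable_fst).mul ((hFm s k).comp measurable_snd)).const_mul _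
        rw [lintegral_const_mul _ (Finset.measurable_sum _ fun s _ => Measurable.tsum (hm1 s)),
          lintegral_finsetSum _ (fun s _ => Measurable.tsum (hm1 s))]
        congr 1
        refine Finset.sum_congr rfl fun s _ => ?_
        rw [lintegral_tsum (fun k => (hm1 s k).aemeasurable)]
        refine tsum_congr fun k => ?_
        have hm2 : Measurable fun z : E n × E n => G s k z.1 * F s k z.2 :=
          ((hGm s k).comp measurable_fst).mul ((hFm s k).comp measurable_snd)
        rw [lintegral_const_mul _ hm2, lintegral_prod_mul (hGm s k).aemeasurable (hFm s k).aemeasurable,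
          lintegral_indicator (hcm _ _), lintegral_indicator (hcm _ _), mul_comm (lintegral _ _)]
    _ ≤ ENNReal.ofReal c * ∑ _s : Fin n → Bool,
          ENNReal.ofReal (C₀ * (A * (Nσ ^ a + Nu ^ b))) * Z := by
        gcongr with s _
        exact hmain A Nσ Nu hA hNσ hNu σ u hJ f hf hfp g hg hgp (T s)
    _ = _ := by
        have : 0 ≤ C₀ * (A * (Nσ ^ a + Nu ^ b)) := by positivity
        rw [Finset.sum_const, nsmul_eq_mul, Finset.card_univ, Fintype.card_fun, Fintype.card_bool,
          Fintype.card_fin, ← mul_assoc, ← mul_assoc, mul_assoc c, mul_assoc (2 ^ n : ℝ),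
          ENNReal.ofReal_mul hcp.le, ENNReal.ofReal_mul (p := 2 ^ n) (by positivity), mul_assoc (ENNReal.ofReal c)]
        congr 3
        rw [ENNReal.ofReal_pow (by norm_num)]; simp

/-- The fractional integral for two measures satisfying a joint `A_{p,q}` condition, by duality. -/
theorem lintegral_riesz_rpow_le (hn : 0 < n) {α a b : ℝ} (hαn : α < n)
    (ha : 0 < a) (ha1 : a < 1) (hb : 0 < b) (hb1 : b < 1) (hab : a + b < 1)
    (habα : a + b = 1 - α / n) :
    ∃ C : ℝ, 0 < C ∧ ∀ (A Nσ Nu : ℝ), 0 < A → 0 ≤ Nσ → 0 ≤ Nu →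
      ∀ (σ u : Measure (E n)) [SFinite σ] [SFinite u], JointApq a b A Nσ Nu σ u →
      ∀ f : E n → ℝ≥0∞, Measurable f → ∫⁻ x, f x ^ (1 / (1 - b)) ∂σ ≠ ∞ →
      (∫⁻ x, (∫⁻ y, ENNReal.ofReal (rieszKernel α x y) * f y ∂σ) ^ (1 / a) ∂u) ^ a ≤
        ENNReal.ofReal (C * (A * (Nσ ^ a + Nu ^ b))) *
          (∫⁻ x, f x ^ (1 / (1 - b)) ∂σ) ^ (1 - b) := by
  obtain ⟨C, hC, hmain⟩ := lintegral_riesz_form_le hn hαn ha ha1 hb hb1 hab habα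
  refine ⟨C, hC, ?_⟩
  intro A Nσ Nu hA hNσ hNu σ u _ _ hJ f hf hfp
  set K := ENNReal.ofReal (C * (A * (Nσ ^ a + Nu ^ b))) *
          (∫⁻ x, f x ^ (1 / (1 - b)) ∂σ) ^ (1 - b) with hK
  set h : E n → ℝ≥0∞ := fun x => ∫⁻ y, ENNReal.ofReal (rieszKernel α x y) * f y ∂σ with hh
  have hhm : Measurable h :=
    ((measurable_rieszKernel α).mul (hf.comp measurable_snd)).lintegral_prod_right'
  -- truncations to bounded sets and bounded values, whose norms are finite and can be divided out
  set B : ℕ → Set (E n) := fun N => cell (WithLp.toLp 2 fun _ => -(N + 1 : ℝ)) (2 * (N + 1 : ℝ)) 0 with hB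
  have hB' : ∀ N x, x ∈ B N ↔ ∀ i, -(N + 1 : ℝ) ≤ x i ∧ x i < N + 1 := by
    intro N x
    rw [hB]; simp only
    rw [mem_cell_iff_bounds (by positivity)]
    refine forall_congr' fun i => ?_
    simp only [Pi.zero_apply, Int.cast_zero, mul_zero, add_zero]
    constructor <;> rintro ⟨h1, h2⟩ <;> constructor <;> linarith
  have hBm : ∀ N, MeasurableSet (B N) := fun N => measurableSet_cell _ (by positivity) _
  set H : ℕ → E n → ℝ≥0∞ := fun N => (B N).indicator fun x => min (h x) N with hH
  have hHm : ∀ N, Measurable (H N) := fun N => (hhm.min measurable_const).indicator (hBm N)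
  have ha' : 0 < 1 / a := by positivity
  have hqa : 1 < 1 / a := by rw [lt_div_iff₀ ha]; linarith
  have hHfin : ∀ N, ∫⁻ x, H N x ^ (1 / a) ∂u ≠ ∞ := by
    intro N
    have : ∀ x, H N x ^ (1 / a) ≤ (B N).indicator (fun _ => (N : ℝ≥0∞) ^ (1 / a)) x := by
      intro x
      simp only [hH, Set.indicator]
      split_ifs
      · exact ENNReal.rpow_le_rpow (min_le_right _ _) ha'.le
      · simp [ha]
    refine ((lintegral_mono this).trans_lt ?_).ne
    rw [lintegral_indicator (hBm N), setLIntegral_const]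
    exact ENNReal.mul_lt_top (ENNReal.rpow_lt_top_of_nonneg ha'.le (ENNReal.natCast_ne_top N))
      (hJ.fin_right _ _ _ (by positivity)).lt_top
  have hHle : ∀ N, (∫⁻ x, H N x ^ (1 / a) ∂u) ≤ K ^ (1 / a) := by
    intro N
    set I := ∫⁻ x, H N x ^ (1 / a) ∂u with hI
    rcases eq_or_ne I 0 with h0 | h0
    · rw [h0]; exact zero_le
    have hga : (1 / a - 1) * (1 / (1 - a)) = 1 / a := by
      have : (1 - a) ≠ 0 := by linarith
      field_simp
    have e1 : ∫⁻ x, (H N x ^ (1 / a - 1)) ^ (1 / (1 - a)) ∂u = I := by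
      rw [hI]
      refine lintegral_congr fun x => ?_
      rw [← ENNReal.rpow_mul, hga]
    have h1 := hmain A Nσ Nu hA hNσ hNu σ u hJ f hf hfp (fun x => H N x ^ (1 / a - 1))
      ((hHm N).pow_const _) (by rw [e1]; exact hHfin N)
    rw [e1, ← mul_assoc, ← hK] at h1
    have h2 : I ≤ K * I ^ (1 - a) := by
      refine le_trans (lintegral_mono fun x => ?_) h1
      have hle : H N x ≤ h x := by
        simp only [hH, Set.indicator]
        split_ifs
        · exact min_le_left _ _
        · exact zero_le
      calc H N x ^ (1 / a) = H N x ^ (1 / a - 1) * H N x := by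
            conv_rhs => rw [← ENNReal.rpow_one (H N x), ← ENNReal.rpow_mul,
              ← ENNReal.rpow_add_of_nonneg _ _ (by linarith) (by norm_num)]
            congr 1; ring
        _ ≤ H N x ^ (1 / a - 1) * h x := by gcongr
    have h3 : I ^ a * I ^ (1 - a) ≤ K * I ^ (1 - a) := by
      rw [← ENNReal.rpow_add_of_nonneg _ _ ha.le (by linarith)]
      simpa using h2
    have h4 : I ^ a ≤ K := by
      refine (ENNReal.mul_le_mul_iff_left ?_ ?_).1 h3
      · exact (ENNReal.rpow_pos (pos_iff_ne_zero.2 h0) (hHfin N)).ne'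
      · exact ENNReal.rpow_ne_top_of_nonneg (by linarith) (hHfin N)
    calc I = (I ^ a) ^ (1 / a) := by rw [← ENNReal.rpow_mul, mul_one_div_cancel ha.ne', ENNReal.rpow_one]
      _ ≤ K ^ (1 / a) := ENNReal.rpow_le_rpow h4 ha'.le
  have hmono : Monotone fun N x => H N x ^ (1 / a) := by
    intro N M hNM x
    have hNM' : (N : ℝ) ≤ M := by exact_mod_cast hNM
    refine ENNReal.rpow_le_rpow ?_ ha'.le
    simp only [hH]
    refine Set.indicator_le (fun x hx => ?_) x
    rw [Set.indicator_of_mem ((hB' M x).2 fun i => ?_)]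
    · exact min_le_min le_rfl (by exact_mod_cast hNM)
    · have := (hB' N x).1 hx i
      constructor <;> linarith
  have hsup : ∀ x, h x ^ (1 / a) ≤ ⨆ N, H N x ^ (1 / a) := by
    intro x
    obtain ⟨N₀, hN₀⟩ := exists_nat_ge ‖x‖
    have hx : ∀ N ≥ N₀, x ∈ B N := by
      intro N hN
      refine (hB' N x).2 fun i => ?_
      have h1 : |x i| ≤ ‖x‖ := by simpa using PiLp.norm_apply_le x i
      have h2 : (N₀ : ℝ) ≤ N := by exact_mod_cast hN
      have h3 := abs_le.1 h1
      constructor <;> linarith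
    have hval : ∀ N ≥ N₀, H N x = min (h x) N := fun N hN => by
      simp only [hH]; exact Set.indicator_of_mem (hx N hN) _
    rcases eq_or_ne (h x) ∞ with ht | ht
    · rw [ht, ENNReal.top_rpow_of_pos ha', top_le_iff, iSup_eq_top]
      intro r hr
      obtain ⟨N, hN⟩ := ENNReal.exists_nat_gt (ENNReal.rpow_ne_top_of_nonneg (y := a) ha.le hr.ne)
      refine ⟨max N N₀, ?_⟩
      rw [hval _ (le_max_right _ _), ht, min_eq_right le_top]
      have h1 : r = (r ^ a) ^ (1 / a) := by
        rw [← ENNReal.rpow_mul, mul_one_div_cancel ha.ne', ENNReal.rpow_one]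
      rw [h1]
      refine ENNReal.rpow_lt_rpow (hN.trans_le ?_) ha'
      exact_mod_cast le_max_left _ _
    · obtain ⟨N, hN⟩ := ENNReal.exists_nat_gt ht
      refine le_trans (le_of_eq ?_) (le_iSup _ (max N N₀))
      rw [hval _ (le_max_right _ _), min_eq_left]
      exact hN.le.trans (by exact_mod_cast le_max_left _ _)
  have hfinal : ∫⁻ x, h x ^ (1 / a) ∂u ≤ K ^ (1 / a) := by
    refine (lintegral_mono hsup).trans ?_
    rw [lintegral_iSup (fun N => (hHm N).pow_const _) hmono]
    exact iSup_le hHle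
  calc (∫⁻ x, h x ^ (1 / a) ∂u) ^ a ≤ (K ^ (1 / a)) ^ a := ENNReal.rpow_le_rpow hfinal ha.le
    _ = K := by rw [← ENNReal.rpow_mul, one_div_mul_cancel ha.ne', ENNReal.rpow_one]

end

section

variable {n : ℕ}

/-! ### A weighted John–Nirenberg inequality -/

/-- The average of `b` over the cell of mesh `h` containing `x`. -/
noncomputable def cellAverage (t : E n) (h : ℝ) (b : E n → ℝ) (x : E n) : ℝ :=
  ⨍ y in cell t h (cellIndex t h x), b y

theorem measurable_cellIndex (t : E n) (h : ℝ) : Measurable (cellIndex t h) := by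
  refine measurable_pi_lambda _ fun i => ?_
  unfold cellIndex
  fun_prop

theorem measurable_cellAverage (t : E n) (h : ℝ) (b : E n → ℝ) :
    Measurable (cellAverage t h b) :=
  (Measurable.of_discrete (f := fun j : Fin n → ℤ => ⨍ y in cell t h j, b y)).comp
    (measurable_cellIndex t h)

theorem setAverage_cell_eq (t : E n) {h : ℝ} (hh : 0 < h) (j : Fin n → ℤ) (b : E n → ℝ) :
    ⨍ y in cell t h j, b y = ⨍ y in cube (cellCorner t h j) h, b y := by
  rw [setAverage_congr (cell_ae_eq_cube t hh j)]

theorem cube_eq_preimage_closedBall (a : E n) {l : ℝ} (hl : 0 ≤ l) :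
    cube a l = WithLp.ofLp ⁻¹' (Metric.closedBall (fun i => a i + l / 2) (l / 2)) := by
  rw [cube_eq_preimage, closedBall_pi _ (by positivity)]
  congr 2
  funext i
  rw [Real.closedBall_eq_Icc]
  congr 1 <;> ring

/-- The averages over shrinking grid cells converge almost everywhere. Lebesgue's differentiation
theorem is applied in the sup norm of `Fin n → ℝ`, whose balls are the cubes. -/
theorem ae_tendsto_cellAverage {b : E n → ℝ} (hb : LocallyIntegrable b) (t : E n) {h : ℝ}
    (hh : 0 < h) :
    ∀ᵐ x ∂(volume : Measure (E n)),
      Tendsto (fun M : ℕ => cellAverage t (h / 2 ^ M) b x) atTop (𝓝 (b x)) := by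
  have hmp' := PiLp.volume_preserving_ofLp (Fin n)
  have hme' : MeasurableEmbedding (WithLp.ofLp : E n → (Fin n → ℝ)) :=
    (MeasurableEquiv.toLp 2 (Fin n → ℝ)).symm.measurableEmbedding
  set g : (Fin n → ℝ) → ℝ := fun y => b (WithLp.toLp 2 y) with hg
  have hgl : LocallyIntegrable g := by
    rw [locallyIntegrable_iff] at hb ⊢
    intro K hK
    have hK' : IsCompact (WithLp.ofLp ⁻¹' K : Set (E n)) :=
      (PiLp.homeomorph 2 (fun _ : Fin n => ℝ)).isCompact_preimage.2 hK
    have := hb _ hK'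
    exact (hmp'.integrableOn_comp_preimage hme').1 this
  have hae := IsUnifLocDoublingMeasure.ae_tendsto_average (volume : Measure (Fin n → ℝ)) hgl 1
  have hae' := hmp'.quasiMeasurePreserving.ae hae
  filter_upwards [hae'] with x hx
  have hδ : ∀ M : ℕ, 0 < h / 2 ^ M := fun M => by positivity
  have hlim : Tendsto (fun M : ℕ => h / 2 ^ M / 2) atTop (𝓝[>] 0) := by
    refine tendsto_nhdsWithin_iff.2 ⟨?_, Eventually.of_forall fun M => ?_⟩
    · have h1 : Tendsto (fun M : ℕ => (h / 2) * (1 / 2 : ℝ) ^ M) atTop (𝓝 ((h / 2) * 0)) :=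
        (tendsto_pow_atTop_nhds_zero_of_lt_one (by norm_num) (by norm_num)).const_mul _
      rw [mul_zero] at h1
      refine h1.congr fun M => ?_
      rw [one_div, inv_pow]; ring
    · exact half_pos (hδ M)
  have := hx (fun M => fun i => cellCorner t (h / 2 ^ M) (cellIndex t (h / 2 ^ M) x) i + h / 2 ^ M / 2)
    (fun M => h / 2 ^ M / 2) hlim (Eventually.of_forall fun M => by
      have h1 := cell_subset_cube t (hδ M) _ (mem_cell_cellIndex t (h / 2 ^ M) x)
      rw [cube_eq_preimage_closedBall _ (hδ M).le] at h1
      rw [one_mul]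
      exact h1)
  refine this.congr fun M => ?_
  rw [cellAverage, setAverage_cell_eq t (hδ M), cube_eq_preimage_closedBall _ (hδ M).le,
    setAverage_eq, setAverage_eq]
  have e1 : ∀ s : Set (Fin n → ℝ), ∫ y in WithLp.ofLp ⁻¹' s, b y = ∫ y in s, g y := fun s => by
    rw [← hmp'.setIntegral_preimage_emb hme' g s]
  have e2 : ∀ s : Set (Fin n → ℝ), volume.real (WithLp.ofLp ⁻¹' s : Set (E n)) = volume.real s := fun s => by
    rw [Measure.real, hmp'.measure_preimage_emb hme', Measure.real]
  rw [e1, e2]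

theorem integrableOn_cell {b : E n → ℝ} (hb : LocallyIntegrable b) (t : E n) {h : ℝ} (hh : 0 < h)
    (j : Fin n → ℤ) : IntegrableOn b (cell t h j) :=
  (hb.integrableOn_isCompact (isCompact_cube _ h)).mono_set (cell_subset_cube t hh j)

theorem abs_setAverage_sub_le {b : E n → ℝ} {R : Set (E n)} (hR0 : 0 < volume.real R)
    (hb : IntegrableOn b R) (c : ℝ) :
    |(⨍ y in R, b y) - c| ≤ (∫ y in R, |b y - c|) / volume.real R := by
  have hfin : volume R ≠ ∞ := fun h => by simp [Measure.real, h] at hR0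
  have : IsFiniteMeasure (volume.restrict R) := ⟨by simpa using hfin.lt_top⟩
  have e : (⨍ y in R, b y) - c = (∫ y in R, (b y - c)) / volume.real R := by
    rw [integral_sub hb (integrable_const c), setAverage_eq]
    simp only [integral_const, smul_eq_mul, MeasurableSet.univ, measureReal_restrict_apply,
      Set.univ_inter]
    field_simp
  rw [e, abs_div, abs_of_pos hR0]
  gcongr
  exact abs_integral_le_integral_abs

/-- A finite-depth weighted John–Nirenberg inequality: for the averages over the cells of depth `M`.
The cells of depth `k` are stopped at the maximal subcells on which `b` deviates by more than `2 B`
in the mean. These cover at most half of the volume, hence at most the fraction `1 - 1 / N` of the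
measure `u`, which is what makes the recursion close with `ε` of size `1 / N`. -/
theorem lintegral_exp_cellAverage_le (hn : 0 < n) {b : E n → ℝ} (hb : LocallyIntegrable b)
    {B : ℝ} (hB : 0 < B)
    (hosc : ∀ (t : E n) (h : ℝ) (j : Fin n → ℤ), 0 < h →
      ∫ y in cell t h j, |b y - ⨍ z in cell t h j, b z| ≤ B * volume.real (cell t h j))
    {u : Measure (E n)} {N : ℝ} (hN : 1 ≤ N) (hu : ∀ t h j, 0 < h → u (cell t h j) ≠ ∞)
    (huN : ∀ t h j, 0 < h → ∀ F ⊆ cell t h j, MeasurableSet F →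
      volume.real (cell t h j) ≤ 2 * volume.real F → u.real (cell t h j) ≤ N * u.real F)
    {ε : ℝ} (hε : 0 < ε) (hεN : ε * (2 ^ (n + 1) * B) ≤ 1 / (4 * N))
    (t : E n) {h : ℝ} (hh : 0 < h) (M : ℕ) :
    ∀ (d k : ℕ), k + d = M → ∀ j : Fin n → ℤ,
      ∫⁻ x in cell t (h / 2 ^ k) j, ENNReal.ofReal
        (Real.exp (ε * |cellAverage t (h / 2 ^ M) b x - ⨍ y in cell t (h / 2 ^ k) j, b y|) - 1) ∂u ≤
      u (cell t (h / 2 ^ k) j) := by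
  classical
  have hpos : ∀ k : ℕ, 0 < h / 2 ^ k := fun k => by positivity
  have hmesh : ∀ {k k' : ℕ}, k ≤ k' → h / 2 ^ k = h / 2 ^ k' * ((2 ^ (k' - k) : ℕ) : ℝ) := by
    intro k k' hkk
    push_cast
    rw [div_mul_eq_mul_div, div_eq_div_iff (by positivity) (by positivity), mul_assoc, ← pow_add,
      Nat.sub_add_cancel hkk]
  have hvol : ∀ (k : ℕ) j, volume.real (cell t (h / 2 ^ k) j) = (h / 2 ^ k) ^ n := fun k j =>
    volume_real_cell t (hpos k) j
  have hvolp : ∀ (k : ℕ) j, 0 < volume.real (cell t (h / 2 ^ k) j) := fun k j => by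
    rw [hvol]; exact pow_pos (hpos k) n
  have hsub : ∀ {k k' : ℕ}, k ≤ k' → ∀ {j j' x}, x ∈ cell t (h / 2 ^ k') j' →
      x ∈ cell t (h / 2 ^ k) j → cell t (h / 2 ^ k') j' ⊆ cell t (h / 2 ^ k) j := by
    intro k k' hkk j j' x h1 h2
    rw [hmesh hkk] at h2 ⊢
    exact cell_subset_cell_of_mem h1 h2
  set A := Real.exp (ε * (2 ^ (n + 1) * B)) with hA
  have hA1 : 1 ≤ A := Real.one_le_exp (by positivity)
  have hNp : 0 < N := by linarith
  -- the loss `A - 1` is at most half of the fraction `1 / N` of `u` that is not stopped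
  have hAle : A ≤ 1 + 1 / (2 * N) := by
    have h1 : ε * (2 ^ (n + 1) * B) ≤ 1 := hεN.trans (by
      rw [div_le_one (by positivity)]; linarith)
    have h0 : 0 ≤ ε * (2 ^ (n + 1) * B) := by positivity
    have h2 := Real.abs_exp_sub_one_le (x := ε * (2 ^ (n + 1) * B)) (by rwa [abs_of_nonneg h0])
    rw [abs_of_nonneg h0, ← hA, abs_of_nonneg (by linarith)] at h2
    have e : 1 / (2 * N) = 2 * (1 / (4 * N)) := by field_simp; norm_num
    rw [e]; linarith
  intro d
  induction d using Nat.strong_induction_on with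
  | _ d IH =>
  intro k hkd j
  have hkM : k ≤ M := by omega
  set Q := cell t (h / 2 ^ k) j with hQ
  set c := ⨍ y in Q, b y with hc
  have hQm : MeasurableSet Q := measurableSet_cell t (hpos k) j
  have hbQ : IntegrableOn b Q := integrableOn_cell hb t (hpos k) j
  have hQfin : volume Q ≠ ∞ := by
    rw [hQ, volume_cell t (hpos k)]; exact ENNReal.pow_ne_top ENNReal.ofReal_ne_top
  have hbQc : IntegrableOn (fun y => |b y - c|) Q := by
    have : IsFiniteMeasure (volume.restrict Q) := ⟨by simpa using hQfin.lt_top⟩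
    exact (hbQ.sub (integrable_const c)).abs
  -- all subcells of `Q` of depth between `k + 1` and `M`
  set fam : Finset (Set (E n)) := ((Finset.Ioc k M).biUnion fun k' =>
    (Finset.Icc (fun i => j i * (2 ^ (k' - k) : ℕ)) (fun i => (j i + 1) * (2 ^ (k' - k) : ℕ))).image
      (cell t (h / 2 ^ k'))).filter (fun R => R ⊆ Q) with hfam
  have hfam1 : ∀ R ∈ fam, R ⊆ Q ∧ ∃ k' j', k < k' ∧ k' ≤ M ∧ R = cell t (h / 2 ^ k') j' := by
    intro R hR
    obtain ⟨h1, h2⟩ := Finset.mem_filter.1 hR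
    obtain ⟨k', hk', h3⟩ := Finset.mem_biUnion.1 h1
    obtain ⟨j', _, rfl⟩ := Finset.mem_image.1 h3
    exact ⟨h2, k', j', (Finset.mem_Ioc.1 hk').1, (Finset.mem_Ioc.1 hk').2, rfl⟩
  have hfam2 : ∀ k', k < k' → k' ≤ M → ∀ x ∈ Q,
      cell t (h / 2 ^ k') (cellIndex t (h / 2 ^ k') x) ∈ fam := by
    intro k' hk' hk'M x hx
    refine Finset.mem_filter.2 ⟨Finset.mem_biUnion.2 ⟨k', Finset.mem_Ioc.2 ⟨hk', hk'M⟩,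
      Finset.mem_image.2 ⟨_, ?_, rfl⟩⟩, hsub hk'.le (mem_cell_cellIndex _ _ _) hx⟩
    have hx' := mem_cell_iff.1 hx
    rw [hmesh hk'.le, cellIndex_mul_natCast] at hx'
    have hpow : (0 : ℤ) < (2 ^ (k' - k) : ℕ) := by positivity
    rw [Finset.mem_Icc]
    constructor <;> intro i <;> have := congrFun hx' i <;> simp only at this ⊢ <;> rw [← this]
    · exact Int.ediv_mul_le _ hpow.ne'
    · exact (Int.lt_ediv_add_one_mul_self _ hpow).le
  have hfamN : IsNested fam := by
    intro R hR R' hR'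
    obtain ⟨-, k₁, j₁, -, -, rfl⟩ := hfam1 R hR
    obtain ⟨-, k₂, j₂, -, -, rfl⟩ := hfam1 R' hR'
    by_cases hd : Disjoint (cell t (h / 2 ^ k₁) j₁) (cell t (h / 2 ^ k₂) j₂)
    · exact Or.inr (Or.inr hd)
    · obtain ⟨x, h1, h2⟩ := Set.not_disjoint_iff.1 hd
      rcases le_total k₁ k₂ with h3 | h3
      · exact Or.inr (Or.inl (hsub h3 h2 h1))
      · exact Or.inl (hsub h3 h1 h2)
  -- the cells where `b` is far from `c` in the mean, and the maximal ones among them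
  set bad := fam.filter (fun R => 2 * B * volume.real R < ∫ y in R, |b y - c|) with hbad
  have hbadfam : bad ⊆ fam := Finset.filter_subset _ _
  set T := bad.filter (IsTop bad fun _ => ()) with hT
  have hTbad : T ⊆ bad := Finset.filter_subset _ _
  have hTQ : ∀ R ∈ T, R ⊆ Q := fun R hR => (hfam1 R (hbadfam (hTbad hR))).1
  have hTm : ∀ R ∈ T, MeasurableSet R := fun R hR => by
    obtain ⟨-, k', j', -, -, rfl⟩ := hfam1 R (hbadfam (hTbad hR))
    exact measurableSet_cell t (hpos k') j'
  have hTd : ∀ R ∈ T, ∀ R' ∈ T, R ≠ R' → Disjoint R R' := fun R hR R' hR' hne =>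
    (hfamN.subset hbadfam).disjoint_of_isTop (hTbad hR) (hTbad hR') (Finset.mem_filter.1 hR).2
      (Finset.mem_filter.1 hR').2 hne rfl
  have hTpd : Set.PairwiseDisjoint (↑T : Set (Set (E n))) id := fun R hR R' hR' hne =>
    hTd R hR R' hR' hne
  set U := ⋃ R ∈ T, R with hU
  have hUm : MeasurableSet U := Finset.measurableSet_biUnion _ hTm
  have hUQ : U ⊆ Q := Set.iUnion₂_subset hTQ
  set F := Q \ U with hF
  -- the stopped cells cover at most half of `Q`
  have hUvol : 2 * volume.real U ≤ volume.real Q := by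
    have h1 : volume.real U = ∑ R ∈ T, volume.real R :=
      measureReal_biUnion_finset (f := id) hTpd hTm
        (fun R hR => ((measure_mono (hTQ R hR)).trans_lt hQfin.lt_top).ne)
    have h2 : ∑ R ∈ T, 2 * B * volume.real R ≤ ∑ R ∈ T, ∫ y in R, |b y - c| :=
      Finset.sum_le_sum fun R hR => (Finset.mem_filter.1 (hTbad hR)).2.le
    have h3 : ∑ R ∈ T, ∫ y in R, |b y - c| = ∫ y in U, |b y - c| :=
      (integral_biUnion_finset T (s := id) hTm (fun R hR R' hR' hne => hTd R hR R' hR' hne)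
        (fun R hR => hbQc.mono_set (hTQ R hR))).symm
    have h4 : ∫ y in U, |b y - c| ≤ ∫ y in Q, |b y - c| :=
      setIntegral_mono_set hbQc (Eventually.of_forall fun _ => abs_nonneg _) hUQ.eventuallyLE
    have h5 := hosc t (h / 2 ^ k) j (hpos k)
    rw [← hQ, ← hc] at h5
    rw [← Finset.mul_sum, ← h1, h3] at h2
    have h6 : B * (2 * volume.real U) ≤ B * volume.real Q := by linarith
    exact le_of_mul_le_mul_left h6 hB
  have hFu : u.real Q ≤ N * u.real F := by
    refine huN t _ j (hpos k) F Set.sdiff_subset (hQm.diff hUm) ?_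
    rw [← hQ, hF, measureReal_sdiff hUQ hUm hQfin]
    linarith
  have hQu := hu t _ j (hpos k)
  rw [← hQ] at hQu
  have hUu : u.real U = u.real Q - u.real F := by
    rw [hF, measureReal_sdiff hUQ hUm hQu]; ring
  -- off the stopped cells the averages stay within `2 B` of `c`
  have hX1 : ∀ x ∈ F, |cellAverage t (h / 2 ^ M) b x - c| ≤ 2 * B := by
    intro x hx
    rcases hkM.eq_or_lt with h1 | h1
    · have : cellAverage t (h / 2 ^ M) b x = c := by
        rw [cellAverage, ← h1, mem_cell_iff.1 hx.1, ← hQ]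
      rw [this]; simp; positivity
    · have h2 := hfam2 M h1 le_rfl x hx.1
      set R := cell t (h / 2 ^ M) (cellIndex t (h / 2 ^ M) x) with hR
      have hRp : 0 < volume.real R := hvolp M _
      have h3 : R ∉ bad := by
        intro hRb
        obtain ⟨R', hR', hRR', -, htop⟩ := exists_isTop (fun _ => ()) hRb
        exact hx.2 (Set.mem_biUnion (s := {S | S ∈ T}) (Finset.mem_filter.2 ⟨hR', htop⟩)
          (hRR' (mem_cell_cellIndex t _ x)))
      have h4 : ∫ y in R, |b y - c| ≤ 2 * B * volume.real R := by
        by_contra hcon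
        exact h3 (Finset.mem_filter.2 ⟨h2, not_le.1 hcon⟩)
      refine (abs_setAverage_sub_le hRp (hbQ.mono_set (hfam1 R h2).1) c).trans ?_
      rwa [div_le_iff₀ hRp]
  -- the jump at a stopped cell is controlled through its parent
  have hjump : ∀ R ∈ T, |(⨍ y in R, b y) - c| ≤ 2 ^ (n + 1) * B := by
    intro R hR
    obtain ⟨hRQ, k', j', hk', hk'M, hRc⟩ := hfam1 R (hbadfam (hTbad hR))
    have hRp : 0 < volume.real R := by rw [hRc]; exact hvolp _ _
    obtain ⟨x, hx⟩ := cell_nonempty t (hpos k') j'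
    obtain ⟨m, rfl⟩ : ∃ m, k' = m + 1 := ⟨k' - 1, by omega⟩
    set P := cell t (h / 2 ^ m) (cellIndex t (h / 2 ^ m) x) with hP
    have hRP : R ⊆ P := by
      rw [hRc]; exact hsub (Nat.le_succ m) hx (mem_cell_cellIndex _ _ _)
    have hvRP : volume.real P = 2 ^ n * volume.real R := by
      rw [hP, hRc, hvol, hvol, ← mul_pow, pow_succ]
      congr 1; field_simp
    have hxQ : x ∈ Q := hRQ (by rw [hRc]; exact hx)
    have hPQ : P ⊆ Q := hsub (by omega) (mem_cell_cellIndex _ _ _) hxQ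
    have hPosc : ∫ y in P, |b y - c| ≤ 2 * B * volume.real P := by
      rcases (show k ≤ m by omega).eq_or_lt with h1 | h1
      · have : P = Q := by rw [hP, ← h1, hQ, mem_cell_iff.1 hxQ]
        rw [this]
        have h5 := hosc t (h / 2 ^ k) j (hpos k)
        rw [← hQ, ← hc] at h5
        refine h5.trans ?_
        have : 0 < B * volume.real Q := mul_pos hB (by rw [hQ]; exact hvolp _ _)
        linarith
      · by_contra hcon
        have hPb : P ∈ bad := Finset.mem_filter.2 ⟨hfam2 m h1 (by omega) x hxQ, not_le.1 hcon⟩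
        refine (Finset.mem_filter.1 hR).2 P hPb ⟨hRP, fun hPR => ?_⟩ rfl
        have h6 := measureReal_mono (μ := volume) hPR
          ((measure_mono hRQ).trans_lt hQfin.lt_top).ne
        rw [hvRP] at h6
        have : (2 : ℝ) ≤ 2 ^ n := by
          calc (2 : ℝ) = 2 ^ 1 := by norm_num
            _ ≤ 2 ^ n := pow_le_pow_right₀ (by norm_num) hn
        nlinarith
    refine (abs_setAverage_sub_le hRp (hbQ.mono_set hRQ) c).trans ?_
    rw [div_le_iff₀ hRp]
    calc ∫ y in R, |b y - c| ≤ ∫ y in P, |b y - c| :=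
          setIntegral_mono_set (hbQc.mono_set hPQ) (Eventually.of_forall fun _ => abs_nonneg _)
            hRP.eventuallyLE
      _ ≤ 2 * B * (2 ^ n * volume.real R) := by rw [← hvRP]; exact hPosc
      _ = _ := by ring
  set X : ℝ → E n → ℝ≥0∞ := fun c x => ENNReal.ofReal
    (Real.exp (ε * |cellAverage t (h / 2 ^ M) b x - c|) - 1) with hX
  have hIntF : ∫⁻ x in F, X c x ∂u ≤ ENNReal.ofReal (A - 1) * u F := by
    rw [← setLIntegral_const]
    refine setLIntegral_mono' (hQm.diff hUm) fun x hx => ENNReal.ofReal_le_ofReal ?_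
    have h1 := hX1 x hx
    refine sub_le_sub_right (Real.exp_le_exp.2 (mul_le_mul_of_nonneg_left ?_ hε.le)) 1
    refine h1.trans ?_
    rw [pow_succ, mul_comm (2 ^ n : ℝ), mul_assoc]
    have : (1 : ℝ) ≤ 2 ^ n := one_le_pow₀ (by norm_num)
    nlinarith
  have hIntR : ∀ R ∈ T, ∫⁻ x in R, X c x ∂u ≤
      ENNReal.ofReal A * u R + ENNReal.ofReal (A - 1) * u R := by
    intro R hR
    obtain ⟨hRQ, k', j', hk', hk'M, hRc⟩ := hfam1 R (hbadfam (hTbad hR))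
    have hIH := IH (M - k') (by omega) k' (by omega) j'
    rw [← hRc] at hIH
    calc ∫⁻ x in R, X c x ∂u
        ≤ ∫⁻ x in R, ENNReal.ofReal A * X (⨍ y in R, b y) x + ENNReal.ofReal (A - 1) ∂u := by
          refine lintegral_mono fun x => ?_
          simp only [hX]
          set v := cellAverage t (h / 2 ^ M) b x
          have h1 : |v - c| ≤ |v - ⨍ y in R, b y| + 2 ^ (n + 1) * B :=
            (abs_sub_le v (⨍ y in R, b y) c).trans (by gcongr; exact hjump R hR)
          have h0 : 1 ≤ Real.exp (ε * |v - ⨍ y in R, b y|) := Real.one_le_exp (by positivity)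
          rw [← ENNReal.ofReal_mul (by linarith), ← ENNReal.ofReal_add (by nlinarith) (by linarith)]
          refine ENNReal.ofReal_le_ofReal ?_
          have h2 : Real.exp (ε * |v - c|) ≤ A * Real.exp (ε * |v - ⨍ y in R, b y|) := by
            rw [hA, ← Real.exp_add]
            refine Real.exp_le_exp.2 ?_
            nlinarith
          linarith
      _ = ENNReal.ofReal A * ∫⁻ x in R, X (⨍ y in R, b y) x ∂u + ENNReal.ofReal (A - 1) * u R := by
          rw [lintegral_add_right _ measurable_const, lintegral_const_mul' _ _ ENNReal.ofReal_ne_top,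
            setLIntegral_const]
      _ ≤ _ := by gcongr
  have hTfin : ∀ R ∈ T, u R ≠ ∞ := fun R hR =>
    ((measure_mono (hTQ R hR)).trans_lt hQu.lt_top).ne
  calc ∫⁻ x in Q, X c x ∂u = ∫⁻ x in U, X c x ∂u + ∫⁻ x in F, X c x ∂u := by
        rw [← lintegral_inter_add_sdiff (X c) Q hUm, Set.inter_eq_right.2 hUQ]
    _ ≤ (∑ R ∈ T, (ENNReal.ofReal A * u R + ENNReal.ofReal (A - 1) * u R)) +
          ENNReal.ofReal (A - 1) * u F := by
        refine add_le_add ?_ hIntF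
        rw [hU, lintegral_biUnion_finset (t := fun R => R) hTpd hTm]
        exact Finset.sum_le_sum hIntR
    _ = ENNReal.ofReal A * u U + (ENNReal.ofReal (A - 1) * u U + ENNReal.ofReal (A - 1) * u F) := by
        rw [Finset.sum_add_distrib, ← Finset.mul_sum, ← Finset.mul_sum, add_assoc, hU]
        have := measure_biUnion_finset (μ := u) (f := id) hTpd hTm
        simp only [id] at this
        rw [this]
    _ = ENNReal.ofReal (A * u.real U + ((A - 1) * u.real U + (A - 1) * u.real F)) := by
        have hUf : u U ≠ ∞ := ((measure_mono hUQ).trans_lt hQu.lt_top).ne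
        have hFf : u F ≠ ∞ := ((measure_mono Set.sdiff_subset).trans_lt hQu.lt_top).ne
        have hA0 : 0 ≤ A - 1 := by linarith
        rw [ENNReal.ofReal_add (by positivity) (by positivity),
          ENNReal.ofReal_add (by positivity) (by positivity), ENNReal.ofReal_mul (by positivity),
          ENNReal.ofReal_mul hA0, ENNReal.ofReal_mul hA0, ofReal_measureReal hUf,
          ofReal_measureReal hFf]
    _ ≤ ENNReal.ofReal (u.real Q) := by
        refine ENNReal.ofReal_le_ofReal ?_
        rw [hUu]
        have hF0 : 0 ≤ u.real F := measureReal_nonneg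
        have h1 : u.real Q / N ≤ u.real F := by rw [div_le_iff₀ hNp]; linarith
        have hU0 : 0 ≤ u.real Q - u.real F := by rw [← hUu]; exact measureReal_nonneg
        have h2 : A * (u.real Q - u.real F) ≤ (1 + 1 / (2 * N)) * (u.real Q - u.real F) :=
          mul_le_mul_of_nonneg_right hAle hU0
        have h3 : (A - 1) * u.real Q ≤ 1 / (2 * N) * u.real Q :=
          mul_le_mul_of_nonneg_right (by linarith) measureReal_nonneg
        have h4 : 1 / (2 * N) * u.real Q = u.real Q / N / 2 := by field_simp
        have h5 : 1 / (2 * N) * (u.real Q - u.real F) = u.real Q / N / 2 - 1 / (2 * N) * u.real F := by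
          rw [mul_sub, h4]
        have h6 : 0 ≤ 1 / (2 * N) * u.real F := by positivity
        nlinarith
    _ = u Q := ofReal_measureReal hQu

/-- A weighted John–Nirenberg inequality in which the exponent depends linearly on the constant `N`
of the measure `u`, by Fatou's lemma from its finite-depth version. -/
theorem lintegral_exp_sub_average_le (hn : 0 < n) {b : E n → ℝ} (hb : LocallyIntegrable b)
    {B : ℝ} (hB : 0 < B)
    (hosc : ∀ (t : E n) (h : ℝ) (j : Fin n → ℤ), 0 < h →
      ∫ y in cell t h j, |b y - ⨍ z in cell t h j, b z| ≤ B * volume.real (cell t h j))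
    {u : Measure (E n)} (huv : u ≪ volume) {N : ℝ} (hN : 1 ≤ N)
    (hu : ∀ t h j, 0 < h → u (cell t h j) ≠ ∞)
    (huN : ∀ t h j, 0 < h → ∀ F ⊆ cell t h j, MeasurableSet F →
      volume.real (cell t h j) ≤ 2 * volume.real F → u.real (cell t h j) ≤ N * u.real F)
    {ε : ℝ} (hε : 0 < ε) (hεN : ε * (2 ^ (n + 1) * B) ≤ 1 / (4 * N))
    (t : E n) {h : ℝ} (hh : 0 < h) (j : Fin n → ℤ) :
    ∫⁻ x in cell t h j, ENNReal.ofReal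
        (Real.exp (ε * |b x - ⨍ y in cell t h j, b y|)) ∂u ≤ 2 * u (cell t h j) := by
  set Q := cell t h j with hQ
  set c := ⨍ y in Q, b y with hc
  have hdepth : ∀ M : ℕ, ∫⁻ x in Q, ENNReal.ofReal
      (Real.exp (ε * |cellAverage t (h / 2 ^ M) b x - c|)) ∂u ≤ 2 * u Q := by
    intro M
    have h1 := lintegral_exp_cellAverage_le hn hb hB hosc hN hu huN hε hεN t hh M M 0 (by omega) j
    simp only [pow_zero, div_one] at h1
    rw [← hQ, ← hc] at h1
    calc ∫⁻ x in Q, ENNReal.ofReal (Real.exp (ε * |cellAverage t (h / 2 ^ M) b x - c|)) ∂u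
        = ∫⁻ x in Q, ENNReal.ofReal (Real.exp (ε * |cellAverage t (h / 2 ^ M) b x - c|) - 1) + 1 ∂u := by
          refine lintegral_congr fun x => ?_
          have : 1 ≤ Real.exp (ε * |cellAverage t (h / 2 ^ M) b x - c|) :=
            Real.one_le_exp (by positivity)
          rw [← ENNReal.ofReal_one, ← ENNReal.ofReal_add (by linarith) (by norm_num)]
          congr 1; ring
      _ ≤ 2 * u Q := by
          rw [lintegral_add_right _ measurable_const, setLIntegral_const, two_mul, one_mul]
          gcongr
  have hae : ∀ᵐ x ∂(u.restrict Q), Tendsto (fun M : ℕ => ENNReal.ofReal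
      (Real.exp (ε * |cellAverage t (h / 2 ^ M) b x - c|))) atTop
      (𝓝 (ENNReal.ofReal (Real.exp (ε * |b x - c|)))) := by
    refine ae_restrict_of_ae (huv.ae_le ?_)
    filter_upwards [ae_tendsto_cellAverage hb t hh] with x hx
    refine ENNReal.tendsto_ofReal ?_
    exact (Real.continuous_exp.tendsto _).comp ((hx.sub_const c).abs.const_mul ε)
  calc ∫⁻ x in Q, ENNReal.ofReal (Real.exp (ε * |b x - c|)) ∂u
      = ∫⁻ x in Q, liminf (fun M : ℕ => ENNReal.ofReal
          (Real.exp (ε * |cellAverage t (h / 2 ^ M) b x - c|))) atTop ∂u :=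
        lintegral_congr_ae (hae.mono fun x hx => hx.liminf_eq.symm)
    _ ≤ liminf (fun M : ℕ => ∫⁻ x in Q, ENNReal.ofReal
          (Real.exp (ε * |cellAverage t (h / 2 ^ M) b x - c|)) ∂u) atTop := by
        refine lintegral_liminf_le fun M => ?_
        have := measurable_cellAverage t (h / 2 ^ M) b
        fun_prop
    _ ≤ 2 * u Q := by
        refine liminf_le_of_frequently_le' (Frequently.of_forall fun M => hdepth M)

end

section

variable {n : ℕ}

/-! ### Weights in `A_{p,q}` -/

theorem aemeasurable_weight {w : E n → ℝ} (hw : AEMeasurable w) (r : ℝ) :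
    AEMeasurable (fun x => ENNReal.ofReal (w x) ^ r) (volume : Measure (E n)) :=
  hw.ennreal_ofReal.pow_const r

theorem weightMeasure_absolutelyContinuous (w : E n → ℝ) (r : ℝ) :
    weightMeasure w r ≪ volume := withDensity_absolutelyContinuous _ _

theorem volume_absolutelyContinuous_weightMeasure {w : E n → ℝ} (hw : AEMeasurable w)
    (hpos : ∀ᵐ x, 0 < w x) (r : ℝ) : volume ≪ weightMeasure w r := by
  refine withDensity_absolutelyContinuous' (aemeasurable_weight hw r) ?_
  filter_upwards [hpos] with x hx
  exact (ENNReal.rpow_pos (ENNReal.ofReal_pos.2 hx) ENNReal.ofReal_ne_top).ne'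

theorem weightMeasure_apply (w : E n → ℝ) (r : ℝ) {s : Set (E n)} (hs : MeasurableSet s) :
    weightMeasure w r s = ∫⁻ x in s, ENNReal.ofReal (w x) ^ r := withDensity_apply _ hs

theorem lintegral_weightMeasure {w : E n → ℝ} (hw : AEMeasurable w) (r : ℝ) {g : E n → ℝ≥0∞}
    (hg : AEMeasurable g) :
    ∫⁻ x, g x ∂(weightMeasure w r) = ∫⁻ x, ENNReal.ofReal (w x) ^ r * g x :=
  lintegral_withDensity_eq_lintegral_mul₀ (aemeasurable_weight hw r) hg

theorem volume_cube_ne_zero (a : E n) {l : ℝ} (hl : 0 < l) : volume (cube a l) ≠ 0 := by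
  rw [volume_cube]; exact (ENNReal.pow_pos (ENNReal.ofReal_pos.2 hl) n).ne'

theorem volume_cube_ne_top (a : E n) (l : ℝ) : volume (cube a l) ≠ ∞ := by
  rw [volume_cube]; exact ENNReal.pow_ne_top ENNReal.ofReal_ne_top

theorem weightMeasure_cube_ne_zero {w : E n → ℝ} (hw : AEMeasurable w) (hpos : ∀ᵐ x, 0 < w x)
    (r : ℝ) (a : E n) {l : ℝ} (hl : 0 < l) : weightMeasure w r (cube a l) ≠ 0 := fun h =>
  volume_cube_ne_zero a hl (volume_absolutelyContinuous_weightMeasure hw hpos r h)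

theorem setLAverage_weight (w : E n → ℝ) (r : ℝ) (a : E n) (l : ℝ) :
    ⨍⁻ x in cube a l, ENNReal.ofReal (w x) ^ r ∂volume =
      weightMeasure w r (cube a l) / volume (cube a l) := by
  rw [setLAverage_eq, weightMeasure_apply _ _ (measurableSet_cube a l)]

/-- The exponent relations of the off-diagonal range. -/
structure Exponents (n : ℕ) (α p q : ℝ) : Prop where
  dim : 0 < n
  α_pos : 0 < α
  α_lt : α < n
  p_gt : 1 < p
  q_gt : 1 < q
  conj_gt : 1 < p.conjExponent
  sum_eq : 1 / q + 1 / p.conjExponent = 1 - α / n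
  sub_eq : 1 - 1 / p.conjExponent = 1 / p

theorem Exponents.of_hyp {α p q : ℝ} (hα₀ : 0 < α) (hαn : α < n) (hp₁ : 1 < p)
    (hpα : p < n / α) (hq : 1 / q + α / n = 1 / p) : Exponents n α p q := by
  have hn : (0 : ℝ) < n := hα₀.trans hαn
  have hc : 1 / p.conjExponent = 1 - 1 / p := by
    rw [Real.conjExponent]; field_simp
  have h1 : 1 / q = 1 / p - α / n := by linarith
  have h2 : 0 < 1 / q := by
    rw [h1, sub_pos, div_lt_div_iff₀ hn (by linarith)]
    rw [lt_div_iff₀ hα₀] at hpα; linarith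
  have hq0 : 0 < q := one_div_pos.1 h2
  have h3 : 1 / q < 1 := by
    have : 1 / p < 1 := by rw [div_lt_one (by linarith)]; exact hp₁
    have : 0 < α / n := by positivity
    linarith
  refine ⟨by exact_mod_cast hn, hα₀, hαn, hp₁, ?_, ?_, ?_, ?_⟩
  · rwa [div_lt_one hq0] at h3
  · rw [Real.conjExponent, lt_div_iff₀ (by linarith)]; linarith
  · rw [hc]; linarith
  · rw [hc]; ring

section
variable {α p q : ℝ} {w : E n → ℝ}

/-- The definition of `[w]_{A_{p,q}}` in terms of the two measures attached to the weight. -/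
theorem mul_weightMeasure_le (hq : 0 < q) (hp : 0 < p.conjExponent)
    (a : E n) {l : ℝ} (hl : 0 < l) :
    weightMeasure w q (cube a l) *
      weightMeasure w (-p.conjExponent) (cube a l) ^ (q / p.conjExponent) ≤
    apqConst p q w * volume (cube a l) ^ (1 + q / p.conjExponent) := by
  have hV0 := volume_cube_ne_zero a hl
  have hVt := volume_cube_ne_top a l
  have hr : 0 < q / p.conjExponent := by positivity
  have h : (⨍⁻ x in cube a l, ENNReal.ofReal (w x) ^ q ∂volume) *
      (⨍⁻ x in cube a l, ENNReal.ofReal (w x) ^ (-p.conjExponent) ∂volume) ^ (q / p.conjExponent) ≤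
      apqConst p q w := by
    unfold apqConst
    exact le_iSup_of_le a (le_iSup_of_le l (le_iSup_of_le hl le_rfl))
  rw [setLAverage_weight, setLAverage_weight] at h
  rw [ENNReal.rpow_add _ _ hV0 hVt, ENNReal.rpow_one]
  calc _ = (weightMeasure w q (cube a l) / volume (cube a l)) *
        (weightMeasure w (-p.conjExponent) (cube a l) / volume (cube a l)) ^ (q / p.conjExponent) *
        (volume (cube a l) * volume (cube a l) ^ (q / p.conjExponent)) := by
        rw [ENNReal.div_rpow_of_nonneg _ _ hr.le, mul_mul_mul_comm,
          ENNReal.div_mul_cancel hV0 hVt, ENNReal.div_mul_cancel]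
        · exact (ENNReal.rpow_pos (pos_iff_ne_zero.2 hV0) hVt).ne'
        · exact ENNReal.rpow_ne_top_of_nonneg hr.le hVt
    _ ≤ _ := by gcongr

theorem MemApq.weightMeasure_cube_ne_top (hq : 0 < q) (hp : 0 < p.conjExponent)
    (hw : MemApq p q w) (a : E n) {l : ℝ} (hl : 0 < l) :
    weightMeasure w q (cube a l) ≠ ∞ ∧ weightMeasure w (-p.conjExponent) (cube a l) ≠ ∞ := by
  have h := mul_weightMeasure_le (w := w) hq hp a hl
  have hr : 0 < q / p.conjExponent := by positivity
  have hfin : apqConst p q w * volume (cube a l) ^ (1 + q / p.conjExponent) < ∞ :=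
    ENNReal.mul_lt_top hw.2.2 (ENNReal.rpow_lt_top_of_nonneg (by positivity) (volume_cube_ne_top a l))
  have h1 := weightMeasure_cube_ne_zero hw.1 hw.2.1 q a hl
  have h2 := weightMeasure_cube_ne_zero hw.1 hw.2.1 (-p.conjExponent) a hl
  constructor
  · intro ht
    rw [ht, ENNReal.top_mul] at h
    · exact absurd (h.trans_lt hfin) (lt_irrefl _)
    · intro h0
      rcases ENNReal.rpow_eq_zero_iff.1 h0 with h3 | h3
      · exact h2 h3.1
      · linarith
  · intro ht
    rw [ht, ENNReal.top_rpow_of_pos hr, ENNReal.mul_top h1] at h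
    exact absurd (h.trans_lt hfin) (lt_irrefl _)

/-- Hölder's inequality between the two measures attached to a weight. -/
theorem volume_rpow_le (hq : 0 < q) (hp : 0 < p.conjExponent) (hw : AEMeasurable w)
    (hpos : ∀ᵐ x, 0 < w x) {F : Set (E n)} (hF : MeasurableSet F) :
    volume F ^ (1 + q / p.conjExponent) ≤ weightMeasure w q F *
      weightMeasure w (-p.conjExponent) F ^ (q / p.conjExponent) := by
  set r := q / p.conjExponent with hr
  have hr0 : 0 < r := by positivity
  have hpq : (1 + r).HolderConjugate ((1 + r) / r) := by
    rw [Real.holderConjugate_iff]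
    refine ⟨by linarith, ?_⟩
    field_simp
  have hexp : p.conjExponent * r = q := by rw [hr]; field_simp
  have h := ENNReal.lintegral_mul_le_Lp_mul_Lq (volume.restrict F) hpq
    (f := fun x => ENNReal.ofReal (w x) ^ (q / (1 + r)))
    (g := fun x => ENNReal.ofReal (w x) ^ (-(q / (1 + r))))
    (aemeasurable_weight hw _).restrict (aemeasurable_weight hw _).restrict
  have e1 : ∫⁻ x in F, ((fun x => ENNReal.ofReal (w x) ^ (q / (1 + r))) *
      fun x => ENNReal.ofReal (w x) ^ (-(q / (1 + r)))) x = volume F := by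
    rw [← setLIntegral_one]
    refine lintegral_congr_ae (ae_restrict_of_ae ?_)
    filter_upwards [hpos] with x hx
    simp only [Pi.mul_apply]
    rw [← ENNReal.rpow_add _ _ (ENNReal.ofReal_pos.2 hx).ne' ENNReal.ofReal_ne_top]
    simp
  rw [e1] at h
  simp only [← ENNReal.rpow_mul] at h
  have e2 : q / (1 + r) * (1 + r) = q := by field_simp
  have e3 : -(q / (1 + r)) * ((1 + r) / r) = -p.conjExponent := by
    rw [← hexp]; field_simp
  rw [e2, e3, ← weightMeasure_apply _ _ hF, ← weightMeasure_apply _ _ hF] at h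
  calc volume F ^ (1 + r) ≤ (weightMeasure w q F ^ (1 / (1 + r)) *
        weightMeasure w (-p.conjExponent) F ^ (1 / ((1 + r) / r))) ^ (1 + r) :=
        ENNReal.rpow_le_rpow h (by linarith)
    _ = _ := by
        rw [ENNReal.mul_rpow_of_nonneg _ _ (by linarith), ← ENNReal.rpow_mul, ← ENNReal.rpow_mul]
        have e4 : 1 / (1 + r) * (1 + r) = 1 := by field_simp
        have e5 : 1 / ((1 + r) / r) * (1 + r) = r := by field_simp
        rw [e4, e5, ENNReal.rpow_one]

theorem weightMeasure_cell (w : E n → ℝ) (r : ℝ) (t : E n) {h : ℝ} (hh : 0 < h) (j : Fin n → ℤ) :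
    weightMeasure w r (cell t h j) = weightMeasure w r (cube (cellCorner t h j) h) :=
  measure_congr ((weightMeasure_absolutelyContinuous w r).ae_eq (cell_ae_eq_cube t hh j))

theorem volume_cell_eq (t : E n) {h : ℝ} (hh : 0 < h) (j : Fin n → ℤ) :
    volume (cell t h j) = volume (cube (cellCorner t h j) h) :=
  measure_congr (cell_ae_eq_cube t hh j)

/-- Hölder's inequality on any cube bounds the constant from below by one. -/
theorem one_le_apqConst (hq : 0 < q) (hp : 0 < p.conjExponent) (hw : AEMeasurable w)
    (hpos : ∀ᵐ x, 0 < w x) : 1 ≤ apqConst p q w := by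
  have h1 := mul_weightMeasure_le (w := w) hq hp (0 : E n) one_pos
  have h2 := volume_rpow_le hq hp hw hpos (measurableSet_cube (0 : E n) 1)
  have h3 := h2.trans h1
  rw [volume_cube] at h3
  simpa using h3

/-- The measures `w ^ (-p') dx` and `w ^ q dx` satisfy a joint `A_{p,q}` condition. Hölder's inequality
on a subset of half of the volume, against the `A_{p,q}` bound on the cell, gives the two constants
`N`: a multiple of `[w]` for `w ^ q`, and its power `p' / q` for `w ^ (-p')`. -/
theorem MemApq.jointApq (hE : Exponents n α p q) (hw : MemApq p q w) :
    JointApq (1 / q) (1 / p.conjExponent) ((apqConst p q w).toReal ^ (1 / q))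
      ((2 ^ (1 + q / p.conjExponent) * (apqConst p q w).toReal) ^ (p.conjExponent / q))
      (2 ^ (1 + q / p.conjExponent) * (apqConst p q w).toReal)
      (weightMeasure w (-p.conjExponent)) (weightMeasure w q) := by
  have hq : 0 < q := by linarith [hE.q_gt]
  have hp : 0 < p.conjExponent := by linarith [hE.conj_gt]
  set r := q / p.conjExponent with hr
  have hr0 : 0 < r := by positivity
  set u := weightMeasure w q with hu
  set σ := weightMeasure w (-p.conjExponent) with hσ
  set A := (apqConst p q w).toReal with hA
  have hAe : apqConst p q w = ENNReal.ofReal A := (ENNReal.ofReal_toReal hw.2.2.ne).symm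
  have hA0 : 0 ≤ A := ENNReal.toReal_nonneg
  have hufin : ∀ t h j, 0 < h → u (cell t h j) ≠ ∞ := fun t h j hh => by
    rw [hu, weightMeasure_cell w q t hh]
    exact (hw.weightMeasure_cube_ne_top hq hp _ hh).1
  have hσfin : ∀ t h j, 0 < h → σ (cell t h j) ≠ ∞ := fun t h j hh => by
    rw [hσ, weightMeasure_cell w _ t hh]
    exact (hw.weightMeasure_cube_ne_top hq hp _ hh).2
  have hupos : ∀ t h j, 0 < h → 0 < u.real (cell t h j) := fun t h j hh => by
    refine ENNReal.toReal_pos ?_ (hufin t h j hh)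
    rw [hu, weightMeasure_cell w q t hh]
    exact weightMeasure_cube_ne_zero hw.1 hw.2.1 _ _ hh
  have hσpos : ∀ t h j, 0 < h → 0 < σ.real (cell t h j) := fun t h j hh => by
    refine ENNReal.toReal_pos ?_ (hσfin t h j hh)
    rw [hσ, weightMeasure_cell w _ t hh]
    exact weightMeasure_cube_ne_zero hw.1 hw.2.1 _ _ hh
  have hVpos : ∀ t h j, 0 < h → 0 < (volume : Measure (E n)).real (cell t h j) := fun t h j hh => by
    rw [volume_real_cell t hh]; positivity
  have hapq : ∀ t h j, 0 < h → u.real (cell t h j) * σ.real (cell t h j) ^ r ≤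
      A * (volume : Measure (E n)).real (cell t h j) ^ (1 + r) := fun t h j hh => by
    have h1 := mul_weightMeasure_le (w := w) hq hp (cellCorner t h j) hh
    rw [← weightMeasure_cell w _ t hh, ← weightMeasure_cell w _ t hh, ← volume_cell_eq t hh, hAe] at h1
    have h2 := ENNReal.toReal_mono (ENNReal.mul_ne_top ENNReal.ofReal_ne_top
      (ENNReal.rpow_ne_top_of_nonneg (by positivity) (by
        rw [volume_cell t hh]; exact ENNReal.pow_ne_top ENNReal.ofReal_ne_top))) h1
    rwa [ENNReal.toReal_mul, ENNReal.toReal_mul, ← ENNReal.toReal_rpow, ← ENNReal.toReal_rpow,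
      ENNReal.toReal_ofReal hA0] at h2
  have hhold : ∀ t h j, 0 < h → ∀ F ⊆ cell t h j, MeasurableSet F →
      (volume : Measure (E n)).real F ^ (1 + r) ≤ u.real F * σ.real F ^ r := by
    intro t h j hh F hFQ hF
    have h1 := volume_rpow_le hq hp hw.1 hw.2.1 hF
    have h2 := ENNReal.toReal_mono (ENNReal.mul_ne_top
      ((measure_mono hFQ).trans_lt (hufin t h j hh).lt_top).ne
      (ENNReal.rpow_ne_top_of_nonneg hr0.le
        ((measure_mono hFQ).trans_lt (hσfin t h j hh).lt_top).ne)) h1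
    rwa [ENNReal.toReal_mul, ← ENNReal.toReal_rpow, ← ENNReal.toReal_rpow] at h2
  have hhalf : ∀ t h j, 0 < h → ∀ F ⊆ cell t h j, MeasurableSet F →
      (volume : Measure (E n)).real (cell t h j) ≤ 2 * volume.real F →
      u.real (cell t h j) * σ.real (cell t h j) ^ r ≤
        2 ^ (1 + r) * A * (u.real F * σ.real F ^ r) := by
    intro t h j hh F hFQ hF hV
    calc _ ≤ A * (volume : Measure (E n)).real (cell t h j) ^ (1 + r) := hapq t h j hh
      _ ≤ A * (2 * (volume : Measure (E n)).real F) ^ (1 + r) := by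
          gcongr
      _ = 2 ^ (1 + r) * A * (volume : Measure (E n)).real F ^ (1 + r) := by
          rw [Real.mul_rpow (by norm_num) measureReal_nonneg]; ring
      _ ≤ _ := by
          gcongr
          exact hhold t h j hh F hFQ hF
  refine ⟨hσfin, hσpos, hufin, hupos, ?_, ?_, ?_⟩
  · intro t h j hh F hFQ hF hV
    have h1 := hhalf t h j hh F hFQ hF hV
    have h2 : u.real F ≤ u.real (cell t h j) := measureReal_mono hFQ (hufin t h j hh)
    have h3 : σ.real (cell t h j) ^ r ≤ 2 ^ (1 + r) * A * σ.real F ^ r := by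
      refine le_of_mul_le_mul_left (h1.trans ?_) (hupos t h j hh)
      calc _ ≤ 2 ^ (1 + r) * A * (u.real (cell t h j) * σ.real F ^ r) := by gcongr
        _ = _ := by ring
    have e : p.conjExponent / q = 1 / r := by rw [hr]; field_simp
    rw [e]
    calc σ.real (cell t h j) = (σ.real (cell t h j) ^ r) ^ (1 / r) := by
          rw [← Real.rpow_mul measureReal_nonneg, mul_one_div_cancel hr0.ne', Real.rpow_one]
      _ ≤ (2 ^ (1 + r) * A * σ.real F ^ r) ^ (1 / r) := by gcongr
      _ = _ := by
          rw [Real.mul_rpow (by positivity) (by positivity), ← Real.rpow_mul measureReal_nonneg,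
            mul_one_div_cancel hr0.ne', Real.rpow_one]
  · intro t h j hh F hFQ hF hV
    have h1 := hhalf t h j hh F hFQ hF hV
    have h2 : σ.real F ≤ σ.real (cell t h j) := measureReal_mono hFQ (hσfin t h j hh)
    have h4 := hσpos t h j hh
    refine le_of_mul_le_mul_right (h1.trans ?_) (Real.rpow_pos_of_pos h4 r)
    calc _ ≤ 2 ^ (1 + r) * A * (u.real F * σ.real (cell t h j) ^ r) := by gcongr
      _ = _ := by ring
  · intro t h j hh
    have h1 := hapq t h j hh
    have e1 : 1 / p.conjExponent = r * (1 / q) := by rw [hr]; field_simp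
    have e2 : 1 / q + 1 / p.conjExponent = (1 + r) * (1 / q) := by rw [e1]; ring
    have hv := hVpos t h j hh
    rw [e2, Real.rpow_mul hv.le, ← Real.mul_rpow hA0 (by positivity), e1,
      Real.rpow_mul measureReal_nonneg, ← Real.mul_rpow measureReal_nonneg (by positivity)]
    exact Real.rpow_le_rpow (by positivity) h1 (by positivity)

end

theorem measurable_rieszKernel_right (α : ℝ) (x : E n) :
    Measurable fun y : E n => ENNReal.ofReal (rieszKernel α x y) := by
  unfold rieszKernel
  fun_prop

set_option maxHeartbeats 800000 in
/-- The sharp weighted bound for the fractional integral of nonnegative functions. The two-measure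
bound is applied to `f = g w ^ p'`, for which `f w ^ (-p') = g`. -/
theorem lintegral_rieszKernel_weight_le {α p q : ℝ} (hE : Exponents n α p q) :
    ∃ C : ℝ, 0 < C ∧ ∀ w : E n → ℝ, MemApq p q w → ∀ g : E n → ℝ≥0∞, AEMeasurable g →
      ∫⁻ x, g x ^ p ∂(weightMeasure w p) ≠ ∞ →
      (∫⁻ x, (∫⁻ y, ENNReal.ofReal (rieszKernel α x y) * g y) ^ q ∂(weightMeasure w q)) ^ (1 / q) ≤
        ENNReal.ofReal C *
          apqConst p q w ^ ((1 - α / n) * max 1 (p.conjExponent / q)) *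
          (∫⁻ x, g x ^ p ∂(weightMeasure w p)) ^ (1 / p) := by
  have hq : 0 < q := by linarith [hE.q_gt]
  have hp' : 0 < p.conjExponent := by linarith [hE.conj_gt]
  have hp : 0 < p := by linarith [hE.p_gt]
  have hn := hE.dim
  have hnr : (0 : ℝ) < n := by exact_mod_cast hn
  have ha1 : 1 / q < 1 := by rw [div_lt_one hq]; exact hE.q_gt
  have hb1 : 1 / p.conjExponent < 1 := by rw [div_lt_one hp']; exact hE.conj_gt
  have hab : 1 / q + 1 / p.conjExponent < 1 := by
    rw [hE.sum_eq]; have := div_pos hE.α_pos hnr; linarith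
  obtain ⟨C, hC, hmain⟩ := lintegral_riesz_rpow_le hn hE.α_lt (one_div_pos.2 hq) ha1
    (one_div_pos.2 hp') hb1 hab hE.sum_eq
  set r := q / p.conjExponent with hr
  have hr0 : 0 < r := by positivity
  set γ := max 1 (p.conjExponent / q) with hγ
  set D : ℝ := ((2 : ℝ) ^ (1 + r)) ^ (p.conjExponent / q * (1 / q)) +
    ((2 : ℝ) ^ (1 + r)) ^ (1 / p.conjExponent) with hD
  have hD0 : 0 < D := by positivity
  refine ⟨C * D, by positivity, ?_⟩
  intro w hw g hg hgp
  set A := (apqConst p q w).toReal with hA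
  have hAe : apqConst p q w = ENNReal.ofReal A := (ENNReal.ofReal_toReal hw.2.2.ne).symm
  have hA1 : 1 ≤ A := by
    have h1 := one_le_apqConst hq hp' hw.1 hw.2.1
    rw [hAe] at h1
    exact ENNReal.one_le_ofReal.1 h1
  have hA0 : 0 < A := by linarith
  obtain ⟨w', hw'm, hww'⟩ := hw.1
  obtain ⟨g', hg'm, hgg'⟩ := hg
  set f : E n → ℝ≥0∞ := fun x => g' x * ENNReal.ofReal (w' x) ^ p.conjExponent with hf
  have hg : AEMeasurable g := ⟨g', hg'm, hgg'⟩
  have hfm : Measurable f := hg'm.mul (hw'm.ennreal_ofReal.pow_const _)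
  have hsub : 1 / (1 - 1 / p.conjExponent) = p := by rw [hE.sub_eq]; field_simp
  have hpp : p.conjExponent * p - p.conjExponent = p := by
    have : p - 1 ≠ 0 := by linarith [hE.p_gt]
    rw [Real.conjExponent]; field_simp
  have e1 : ∫⁻ x, f x ^ (1 / (1 - 1 / p.conjExponent)) ∂(weightMeasure w (-p.conjExponent)) =
      ∫⁻ x, g x ^ p ∂(weightMeasure w p) := by
    rw [hsub, lintegral_weightMeasure hw.1 _ (hfm.pow_const p).aemeasurable,
      lintegral_weightMeasure hw.1 _ (hg.pow_const p)]
    refine lintegral_congr_ae ?_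
    filter_upwards [hww', hw.2.1, hgg'] with x h1 h2 h3
    have h4 : ENNReal.ofReal (w x) ≠ 0 := (ENNReal.ofReal_pos.2 h2).ne'
    simp only [hf]
    rw [← h1, ← h3, ENNReal.mul_rpow_of_nonneg _ _ hp.le, ← ENNReal.rpow_mul, mul_left_comm,
      ← ENNReal.rpow_add _ _ h4 ENNReal.ofReal_ne_top, mul_comm, neg_add_eq_sub, hpp]
  have e2 : ∀ x, ∫⁻ y, ENNReal.ofReal (rieszKernel α x y) * f y ∂(weightMeasure w (-p.conjExponent)) =
      ∫⁻ y, ENNReal.ofReal (rieszKernel α x y) * g y := by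
    intro x
    have hKm : Measurable fun y : E n => ENNReal.ofReal (rieszKernel α x y) :=
      measurable_rieszKernel_right α x
    refine (lintegral_weightMeasure hw.1 _ (hKm.mul hfm).aemeasurable).trans ?_
    refine lintegral_congr_ae ?_
    filter_upwards [hww', hw.2.1, hgg'] with y h1 h2 h3
    have h4 : ENNReal.ofReal (w y) ≠ 0 := (ENNReal.ofReal_pos.2 h2).ne'
    simp only [Pi.mul_apply, hf]
    rw [← h1, ← h3]
    have h5 : ENNReal.ofReal (w y) ^ (-p.conjExponent) * ENNReal.ofReal (w y) ^ p.conjExponent =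
        1 := by
      rw [← ENNReal.rpow_add _ _ h4 ENNReal.ofReal_ne_top, neg_add_cancel, ENNReal.rpow_zero]
    generalize ENNReal.ofReal (w y) ^ (-p.conjExponent) = s at h5 ⊢
    generalize ENNReal.ofReal (w y) ^ p.conjExponent = s' at h5 ⊢
    rw [show s * (ENNReal.ofReal (rieszKernel α x y) * (g y * s')) =
      ENNReal.ofReal (rieszKernel α x y) * g y * (s * s') by ring, h5, mul_one]
  have : SFinite (weightMeasure w (-p.conjExponent)) := by unfold weightMeasure; infer_instance
  have : SFinite (weightMeasure w q) := by unfold weightMeasure; infer_instance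
  have h := hmain (A ^ (1 / q)) ((2 ^ (1 + r) * A) ^ (p.conjExponent / q)) (2 ^ (1 + r) * A)
    (by positivity) (by positivity) (by positivity) (weightMeasure w (-p.conjExponent))
    (weightMeasure w q) (hw.jointApq hE) f hfm (by rw [e1]; exact hgp)
  simp only [e2, one_div_one_div] at h
  rw [e1, hE.sub_eq] at h
  refine h.trans ?_
  rw [hAe, ENNReal.ofReal_rpow_of_pos hA0, ← ENNReal.ofReal_mul (by positivity)]
  refine mul_le_mul_left (ENNReal.ofReal_le_ofReal ?_) _
  -- comparison of the exponents of the `A_{p,q}` constant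
  have hκ : 0 < 1 - α / n := by rw [← hE.sum_eq]; positivity
  have k1 : A ^ (1 / q) * A ^ (p.conjExponent / q * (1 / q)) ≤ A ^ ((1 - α / n) * γ) := by
    rw [← Real.rpow_add hA0]
    refine Real.rpow_le_rpow_of_exponent_le hA1 ?_
    have : 1 / q + p.conjExponent / q * (1 / q) = (1 - α / n) * (p.conjExponent / q) := by
      rw [← hE.sum_eq]; field_simp; ring
    rw [this]
    exact mul_le_mul_of_nonneg_left (le_max_right _ _) hκ.le
  have k2 : A ^ (1 / q) * A ^ (1 / p.conjExponent) ≤ A ^ ((1 - α / n) * γ) := by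
    rw [← Real.rpow_add hA0]
    refine Real.rpow_le_rpow_of_exponent_le hA1 ?_
    rw [hE.sum_eq]
    exact le_mul_of_one_le_right hκ.le (le_max_left _ _)
  rw [← Real.rpow_mul (by positivity), Real.mul_rpow (by positivity) hA0.le,
    Real.mul_rpow (by positivity) hA0.le, mul_assoc]
  refine mul_le_mul_of_nonneg_left ?_ hC.le
  calc A ^ (1 / q) * (((2 : ℝ) ^ (1 + r)) ^ (p.conjExponent / q * (1 / q)) *
        A ^ (p.conjExponent / q * (1 / q)) +
        ((2 : ℝ) ^ (1 + r)) ^ (1 / p.conjExponent) * A ^ (1 / p.conjExponent))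
      = ((2 : ℝ) ^ (1 + r)) ^ (p.conjExponent / q * (1 / q)) *
          (A ^ (1 / q) * A ^ (p.conjExponent / q * (1 / q))) +
        ((2 : ℝ) ^ (1 + r)) ^ (1 / p.conjExponent) * (A ^ (1 / q) * A ^ (1 / p.conjExponent)) := by
        ring
    _ ≤ ((2 : ℝ) ^ (1 + r)) ^ (p.conjExponent / q * (1 / q)) * A ^ ((1 - α / n) * γ) +
        ((2 : ℝ) ^ (1 + r)) ^ (1 / p.conjExponent) * A ^ ((1 - α / n) * γ) := by gcongr
    _ = _ := by rw [hD]; ring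

end

section

variable {n : ℕ}

/-! ### Stability of `A_{p,q}` under multiplication by exponentials of BMO functions -/

theorem integral_abs_sub_average_cell_le {b : E n → ℝ} (hb : LocallyIntegrable b)
    {B : ℝ} (hB0 : 0 ≤ B) (hB : bmoNorm b ≤ ENNReal.ofReal B) (t : E n) (h : ℝ) (j : Fin n → ℤ)
    (hh : 0 < h) :
    ∫ y in cell t h j, |b y - ⨍ z in cell t h j, b z| ≤ B * volume.real (cell t h j) := by
  set a := cellCorner t h j with ha
  have hc : ⨍ z in cell t h j, b z = ⨍ z in cube a h, b z := setAverage_congr (cell_ae_eq_cube t hh j)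
  have hV : volume.real (cell t h j) = volume.real (cube a h) :=
    congrArg ENNReal.toReal (volume_cell_eq t hh j)
  rw [hc, hV, setIntegral_congr_set (cell_ae_eq_cube t hh j)]
  set c := ⨍ z in cube a h, b z with hcdef
  have hm : AEStronglyMeasurable (fun y => b y - c) (volume.restrict (cube a h)) :=
    (hb.aestronglyMeasurable.restrict).sub aestronglyMeasurable_const
  have h1 : ⨍⁻ x in cube a h, ‖b x - c‖ₑ ∂volume ≤ ENNReal.ofReal B := by
    refine le_trans ?_ hB
    unfold bmoNorm
    exact le_iSup_of_le a (le_iSup_of_le h (le_iSup_of_le hh le_rfl))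
  rw [setLAverage_eq, ENNReal.div_le_iff (volume_cube_ne_zero a hh) (volume_cube_ne_top a h)] at h1
  have h2 := integral_norm_eq_lintegral_enorm hm
  simp only [Real.norm_eq_abs] at h2
  rw [h2]
  have h3 := ENNReal.toReal_mono
    (ENNReal.mul_ne_top ENNReal.ofReal_ne_top (volume_cube_ne_top a h)) h1
  rwa [ENNReal.toReal_mul, ENNReal.toReal_ofReal hB0] at h3

theorem ofReal_mul_exp_rpow (v t s : ℝ) :
    ENNReal.ofReal (v * Real.exp t) ^ s =
      ENNReal.ofReal v ^ s * ENNReal.ofReal (Real.exp (s * t)) := by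
  rw [ENNReal.ofReal_mul' (Real.exp_pos t).le,
    ENNReal.mul_rpow_of_ne_top ENNReal.ofReal_ne_top ENNReal.ofReal_ne_top,
    ENNReal.ofReal_rpow_of_pos (Real.exp_pos t), ← Real.exp_mul, mul_comm t]

/-- The factor `exp (s η b)` is split into a constant and the exponential of the oscillation of `b`
about `c`. -/
theorem weightMeasure_mul_exp_cell_le {w b : E n → ℝ} (hw : AEMeasurable w) (hb : AEMeasurable b)
    (s η c : ℝ) (t : E n) {h : ℝ} (hh : 0 < h) (j : Fin n → ℤ) :
    weightMeasure (fun x => w x * Real.exp (η * b x)) s (cell t h j) ≤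
      ENNReal.ofReal (Real.exp (s * η * c)) *
        ∫⁻ x in cell t h j, ENNReal.ofReal (Real.exp (|s * η| * |b x - c|)) ∂(weightMeasure w s) := by
  have hQ := measurableSet_cell t hh j
  rw [weightMeasure_apply _ _ hQ]
  have hm : AEMeasurable (fun x => ENNReal.ofReal (Real.exp (|s * η| * |b x - c|))) := by fun_prop
  have e : ∫⁻ x in cell t h j, ENNReal.ofReal (Real.exp (|s * η| * |b x - c|)) ∂(weightMeasure w s) =
      ∫⁻ x in cell t h j, ENNReal.ofReal (w x) ^ s *
        ENNReal.ofReal (Real.exp (|s * η| * |b x - c|)) := by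
    rw [weightMeasure, restrict_withDensity hQ]
    exact lintegral_withDensity_eq_lintegral_mul₀ (aemeasurable_weight hw s).restrict hm.restrict
  rw [e, ← lintegral_const_mul' _ _ ENNReal.ofReal_ne_top]
  refine lintegral_mono fun x => ?_
  rw [ofReal_mul_exp_rpow, mul_left_comm (ENNReal.ofReal (Real.exp (s * η * c))), ← ENNReal.ofReal_mul (Real.exp_pos _).le, ← Real.exp_add]
  gcongr
  have := le_abs_self (s * η * (b x - c))
  rw [abs_mul] at this
  linarith

/-- The class `A_{p,q}` is stable under multiplication by `exp (η b)`, `b ∈ BMO`, with uniform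
control of the constant as long as `|η| ‖b‖_BMO [w] ^ max 1 (p'/q)` is small. -/
theorem exists_memApq_mul_exp {α p q : ℝ} (hE : Exponents n α p q) :
    ∃ c₀ : ℝ, 0 < c₀ ∧ ∀ w : E n → ℝ, MemApq p q w → ∀ b : E n → ℝ, LocallyIntegrable b →
      ∀ B : ℝ, 0 < B → bmoNorm b ≤ ENNReal.ofReal B → ∀ η : ℝ, η ≠ 0 →
      |η| * (B * (apqConst p q w).toReal ^ max 1 (p.conjExponent / q)) ≤ c₀ →
      MemApq p q (fun x => w x * Real.exp (η * b x)) ∧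
        apqConst p q (fun x => w x * Real.exp (η * b x)) ≤
          ENNReal.ofReal (2 ^ (1 + q / p.conjExponent)) * apqConst p q w := by
  have hq : 0 < q := by linarith [hE.q_gt]
  have hp : 0 < p.conjExponent := by linarith [hE.conj_gt]
  set r := q / p.conjExponent with hr
  have hr0 : 0 < r := by positivity
  have h2r : (1 : ℝ) ≤ 2 ^ (1 + r) := Real.one_le_rpow (by norm_num) (by linarith)
  set γ := max 1 (p.conjExponent / q) with hγ
  set c₁ : ℝ := 1 / (4 * (q * 2 ^ (n + 1) * 2 ^ (1 + r))) with hc₁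
  set c₂ : ℝ := 1 / (4 * (p.conjExponent * 2 ^ (n + 1) * (2 ^ (1 + r)) ^ (p.conjExponent / q))) with hc₂
  have hc₁0 : 0 < c₁ := by positivity
  have hc₂0 : 0 < c₂ := by positivity
  refine ⟨min c₁ c₂, lt_min hc₁0 hc₂0, ?_⟩
  intro w hw b hb B hB0 hB η hη hsmall
  have hbm : AEMeasurable b := hb.aestronglyMeasurable.aemeasurable
  set A := (apqConst p q w).toReal with hA
  have hA1 : 1 ≤ A := by
    have h1 := one_le_apqConst hq hp hw.1 hw.2.1
    rw [← ENNReal.ofReal_toReal hw.2.2.ne] at h1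
    exact ENNReal.one_le_ofReal.1 h1
  have hA0 : 0 < A := by linarith
  have hJ := hw.jointApq hE
  rw [← hr, ← hA] at hJ
  have hosc := integral_abs_sub_average_cell_le hb hB0.le hB
  have hAγ : A ≤ A ^ γ := by
    simpa using Real.rpow_le_rpow_of_exponent_le hA1 (le_max_left 1 (p.conjExponent / q))
  have hAγ' : A ^ (p.conjExponent / q) ≤ A ^ γ :=
    Real.rpow_le_rpow_of_exponent_le hA1 (le_max_right 1 (p.conjExponent / q))
  have hη0 : 0 < |η| := abs_pos.2 hη
  have hs1 : |η| * (B * A) ≤ c₁ :=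
    le_trans (by gcongr) (hsmall.trans (min_le_left _ _))
  have hs2 : |η| * (B * A ^ (p.conjExponent / q)) ≤ c₂ :=
    le_trans (by gcongr) (hsmall.trans (min_le_right _ _))
  -- the exponential integrability of `b` with respect to both measures
  have hu : ∀ t h j, 0 < h → weightMeasure (fun x => w x * Real.exp (η * b x)) q (cell t h j) ≤
      ENNReal.ofReal (Real.exp (q * η * ⨍ y in cell t h j, b y)) *
        (2 * weightMeasure w q (cell t h j)) := by
    intro t h j hh
    refine (weightMeasure_mul_exp_cell_le hw.1 hbm q η (⨍ y in cell t h j, b y) t hh j).trans ?_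
    refine mul_le_mul_right (lintegral_exp_sub_average_le hE.dim hb hB0 hosc
      (weightMeasure_absolutelyContinuous w q) (N := 2 ^ (1 + r) * A) (one_le_mul_of_one_le_of_one_le h2r hA1)
      hJ.fin_right hJ.half_right (by positivity) ?_ t hh j) _
    rw [abs_mul, abs_of_pos hq, le_div_iff₀ (by positivity)]
    rw [hc₁, le_div_iff₀ (by positivity)] at hs1
    linarith
  have hσ : ∀ t h j, 0 < h →
      weightMeasure (fun x => w x * Real.exp (η * b x)) (-p.conjExponent) (cell t h j) ≤
      ENNReal.ofReal (Real.exp (-p.conjExponent * η * ⨍ y in cell t h j, b y)) *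
        (2 * weightMeasure w (-p.conjExponent) (cell t h j)) := by
    intro t h j hh
    refine (weightMeasure_mul_exp_cell_le hw.1 hbm _ η (⨍ y in cell t h j, b y) t hh j).trans ?_
    refine mul_le_mul_right (lintegral_exp_sub_average_le hE.dim hb hB0 hosc
      (weightMeasure_absolutelyContinuous w _) (N := (2 ^ (1 + r) * A) ^ (p.conjExponent / q))
      (Real.one_le_rpow (one_le_mul_of_one_le_of_one_le h2r hA1) (by positivity))
      hJ.fin_left hJ.half_left (by
        have : 0 < |(-p.conjExponent)| := by rw [abs_neg]; positivity
        rw [abs_mul]; positivity) ?_ t hh j) _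
    rw [abs_mul, abs_neg, abs_of_pos hp, le_div_iff₀ (by positivity),
      Real.mul_rpow (by positivity) hA0.le]
    rw [hc₂, le_div_iff₀ (by positivity)] at hs2
    linarith
  have hle : apqConst p q (fun x => w x * Real.exp (η * b x)) ≤
      ENNReal.ofReal (2 ^ (1 + r)) * apqConst p q w := by
    refine iSup_le fun a => iSup_le fun l => iSup_le fun hl => ?_
    set e := Real.exp (q * η * ⨍ y in cell a l 0, b y) with he
    have he0 : 0 < e := Real.exp_pos _
    have hV0 := volume_cube_ne_zero a hl
    have hVt := volume_cube_ne_top a l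
    have hcube : ∀ (v : E n → ℝ) s, weightMeasure v s (cell a l 0) = weightMeasure v s (cube a l) :=
      fun v s => by rw [weightMeasure_cell v s a hl, cellCorner_zero]
    have h1 := hu a l 0 hl
    have h2 := hσ a l 0 hl
    rw [hcube, hcube] at h1 h2
    have h3 : ENNReal.ofReal (Real.exp (-p.conjExponent * η * ⨍ y in cell a l 0, b y)) ^ r =
        ENNReal.ofReal e⁻¹ := by
      rw [ENNReal.ofReal_rpow_of_pos (Real.exp_pos _), ← Real.exp_mul, he, ← Real.exp_neg]
      congr 2
      rw [hr]; field_simp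
    have h4 := mul_weightMeasure_le (w := w) hq hp a hl
    rw [← hr] at h4
    rw [setLAverage_weight, setLAverage_weight]
    have hVr0 : volume (cube a l) ^ r ≠ 0 := (ENNReal.rpow_pos (pos_iff_ne_zero.2 hV0) hVt).ne'
    have hVrt : volume (cube a l) ^ r ≠ ∞ := ENNReal.rpow_ne_top_of_nonneg hr0.le hVt
    rw [ENNReal.div_rpow_of_nonneg _ _ hr0.le, ← ENNReal.mul_div_mul_comm (Or.inl hV0) (Or.inl hVt),
      ENNReal.div_le_iff (mul_ne_zero hV0 hVr0) (ENNReal.mul_ne_top hVt hVrt)]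
    rw [ENNReal.rpow_add _ _ hV0 hVt, ENNReal.rpow_one] at h4
    have h22 : (2 : ℝ≥0∞) * 2 ^ r = ENNReal.ofReal (2 ^ (1 + r)) := by
      rw [Real.rpow_add (by norm_num), Real.rpow_one, ENNReal.ofReal_mul (by norm_num),
        ← ENNReal.ofReal_rpow_of_pos (by norm_num)]
      norm_num
    -- the contributions of the average of `b` to the two measures cancel in the product
    have hee : ENNReal.ofReal e * ENNReal.ofReal e⁻¹ = 1 := by
      rw [← ENNReal.ofReal_mul he0.le, mul_inv_cancel₀ he0.ne', ENNReal.ofReal_one]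
    calc _ ≤ (ENNReal.ofReal e * (2 * weightMeasure w q (cube a l))) *
          (ENNReal.ofReal (Real.exp (-p.conjExponent * η * ⨍ y in cell a l 0, b y)) *
            (2 * weightMeasure w (-p.conjExponent) (cube a l))) ^ r := by gcongr
      _ = (ENNReal.ofReal e * ENNReal.ofReal e⁻¹) * (2 * 2 ^ r) *
          (weightMeasure w q (cube a l) * weightMeasure w (-p.conjExponent) (cube a l) ^ r) := by
          rw [ENNReal.mul_rpow_of_nonneg _ _ hr0.le, ENNReal.mul_rpow_of_nonneg _ _ hr0.le, h3]
          ring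
      _ ≤ _ := by
          rw [hee, one_mul, h22, mul_assoc]
          gcongr
  refine ⟨⟨hw.1.mul (by fun_prop), ?_, ?_⟩, hle⟩
  · filter_upwards [hw.2.1] with x hx
    positivity
  · exact hle.trans_lt (ENNReal.mul_lt_top ENNReal.ofReal_lt_top hw.2.2)

/-- Multiplying the weight by `exp (η b)` and the function by `exp (-η b)` does not change the
weighted norm. -/
theorem lintegral_rpow_weightMeasure_mul_exp {w b : E n → ℝ} (hw : AEMeasurable w)
    (hb : AEMeasurable b) {s : ℝ} (hs : 0 ≤ s) (η : ℝ) {g : E n → ℝ≥0∞} (hg : AEMeasurable g) :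
    ∫⁻ x, g x ^ s ∂(weightMeasure (fun x => w x * Real.exp (η * b x)) s) =
      ∫⁻ x, (ENNReal.ofReal (Real.exp (η * b x)) * g x) ^ s ∂(weightMeasure w s) := by
  have hw' : AEMeasurable fun x => w x * Real.exp (η * b x) := by fun_prop
  rw [lintegral_weightMeasure hw' s (hg.pow_const s),
    lintegral_weightMeasure hw s (by fun_prop)]
  refine lintegral_congr fun x => ?_
  rw [ofReal_mul_exp_rpow, ENNReal.mul_rpow_of_nonneg _ _ hs, mul_assoc,
    ENNReal.ofReal_rpow_of_pos (Real.exp_pos _), ← Real.exp_mul, mul_comm (η * b x)]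

end

section

variable {n : ℕ} {𝕜 : Type*} [RCLike 𝕜]

/-! ### Iterated commutators as integral operators -/

theorem integrable_rieszKernel_sub_pow {α : ℝ} {b : E n → ℝ} {x : E n} {m : ℕ} {f : E n → 𝕜}
    (h : ∀ j ≤ m, Integrable (fun y => rieszKernel α x y • (b y ^ j • f y))) :
    Integrable (fun y => rieszKernel α x y • ((b x - b y) ^ m • f y)) := by
  induction m generalizing f with
  | zero => simpa using h 0 le_rfl
  | succ m ih =>
    have h1 := (ih fun j hj => h j (hj.trans m.le_succ)).smul (b x)
    have h2 := ih (f := fun y => b y • f y) fun j hj => by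
      simpa only [pow_succ, mul_smul] using h (j + 1) (Nat.succ_le_succ hj)
    refine (h1.sub h2).congr (Eventually.of_forall fun y => ?_)
    simp only [Pi.sub_apply, Pi.smul_apply, smul_smul, ← sub_smul]
    congr 1; ring

/-- Where all the integrals converge, the iterated commutator is the integral operator with kernel
`(b x - b y) ^ m / |x - y| ^ (n - α)`. -/
theorem fracCommutator_eq_integral {α : ℝ} {b : E n → ℝ} {x : E n} {m : ℕ} {f : E n → 𝕜}
    (h : ∀ j ≤ m, Integrable (fun y => rieszKernel α x y • (b y ^ j • f y))) :
    fracCommutator α b m f x = ∫ y, rieszKernel α x y • ((b x - b y) ^ m • f y) := by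
  induction m generalizing f with
  | zero => simp [fracCommutator, iterCommutator, fracIntegral]
  | succ m ih =>
    have h1 : ∀ j ≤ m, Integrable (fun y => rieszKernel α x y • (b y ^ j • f y)) :=
      fun j hj => h j (hj.trans m.le_succ)
    have h2 : ∀ j ≤ m, Integrable (fun y => rieszKernel α x y • (b y ^ j • (b y • f y))) :=
      fun j hj => by simpa only [pow_succ, mul_smul] using h (j + 1) (Nat.succ_le_succ hj)
    have e : fracCommutator α b (m + 1) f x =
        b x • fracCommutator α b m f x - fracCommutator α b m (fun y => b y • f y) x := rfl
    have hI : Integrable (fun y => b x • rieszKernel α x y • ((b x - b y) ^ m • f y)) :=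
      (integrable_rieszKernel_sub_pow h1).smul (b x)
    rw [e, ih h1, ih h2, ← integral_smul, ← integral_sub hI (integrable_rieszKernel_sub_pow h2)]
    refine integral_congr_ae (Eventually.of_forall fun y => ?_)
    simp only [smul_smul, ← sub_smul]
    congr 1; ring

/-- The fractional integral of a nonnegative function, with values in `[0, ∞]`. -/
noncomputable def rieszLIntegral (α : ℝ) (g : E n → ℝ≥0∞) (x : E n) : ℝ≥0∞ :=
  ∫⁻ y, ENNReal.ofReal (rieszKernel α x y) * g y

theorem aemeasurable_rieszLIntegral (α : ℝ) {g : E n → ℝ≥0∞} (hg : AEMeasurable g) :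
    AEMeasurable (rieszLIntegral α g) := by
  have h : AEMeasurable (fun z : E n × E n => ENNReal.ofReal (rieszKernel α z.1 z.2) * g z.2)
      (volume.prod volume) := (measurable_rieszKernel α).aemeasurable.mul hg.comp_snd
  exact h.lintegral_prod_right'

theorem abs_pow_le_factorial_mul_exp (m : ℕ) {ε : ℝ} (hε : 0 < ε) (t : ℝ) :
    |t| ^ m ≤ m.factorial / ε ^ m * Real.exp (ε * |t|) := by
  have h := Real.pow_div_factorial_le_exp (ε * |t|) (by positivity) m
  rw [mul_pow, div_le_iff₀ (by positivity)] at h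
  rw [div_mul_eq_mul_div, le_div_iff₀ (by positivity)]
  linarith

theorem exp_mul_abs_le (ε t : ℝ) :
    Real.exp (ε * |t|) ≤ Real.exp (ε * t) + Real.exp (-ε * t) := by
  have h1 := Real.exp_pos (ε * t)
  have h2 := Real.exp_pos (-ε * t)
  rcases abs_cases t with ⟨h, -⟩ | ⟨h, -⟩ <;> rw [h]
  · linarith
  · rw [mul_neg, ← neg_mul]; linarith

/-- The bound for the fractional integral conjugated by an exponential of `b`: it amounts to the
unconjugated bound for the weight `w * exp (η b)`. -/
theorem exists_lintegral_conj_le {α p q : ℝ} (hE : Exponents n α p q) :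
    ∃ c₀ C : ℝ, 0 < c₀ ∧ 0 < C ∧ ∀ w : E n → ℝ, MemApq p q w → ∀ b : E n → ℝ,
      LocallyIntegrable b → ∀ B : ℝ, 0 < B → bmoNorm b ≤ ENNReal.ofReal B → ∀ η : ℝ, η ≠ 0 →
      |η| * (B * (apqConst p q w).toReal ^ max 1 (p.conjExponent / q)) ≤ c₀ →
      ∀ g : E n → ℝ≥0∞, AEMeasurable g → ∫⁻ x, g x ^ p ∂(weightMeasure w p) ≠ ∞ →
      (∫⁻ x, (ENNReal.ofReal (Real.exp (η * b x)) *
        rieszLIntegral α (fun y => ENNReal.ofReal (Real.exp (-η * b y)) * g y) x) ^ q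
          ∂(weightMeasure w q)) ^ (1 / q) ≤
        ENNReal.ofReal C *
          apqConst p q w ^ ((1 - α / n) * max 1 (p.conjExponent / q)) *
          (∫⁻ x, g x ^ p ∂(weightMeasure w p)) ^ (1 / p) := by
  obtain ⟨c₀, hc₀, hstab⟩ := exists_memApq_mul_exp hE
  obtain ⟨C, hC, hmain⟩ := lintegral_rieszKernel_weight_le hE
  have hq : 0 < q := by linarith [hE.q_gt]
  have hp' : 0 < p.conjExponent := by linarith [hE.conj_gt]
  have hp : 0 < p := by linarith [hE.p_gt]
  set θ := (1 - α / n) * max 1 (p.conjExponent / q) with hθ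
  have hθ0 : 0 ≤ θ := by
    have : 0 < 1 - α / n := by rw [← hE.sum_eq]; positivity
    positivity
  set R : ℝ := 2 ^ (1 + q / p.conjExponent) with hR
  have hR0 : 0 < R := by positivity
  refine ⟨c₀, C * R ^ θ, hc₀, by positivity, ?_⟩
  intro w hw b hb B hB0 hB η hη hsmall g hg hgp
  obtain ⟨hw', hA'⟩ := hstab w hw b hb B hB0 hB η hη hsmall
  have hbm : AEMeasurable b := hb.aestronglyMeasurable.aemeasurable
  have hgm : AEMeasurable (fun y => ENNReal.ofReal (Real.exp (-η * b y)) * g y) := by fun_prop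
  have e1 : ∫⁻ x, (ENNReal.ofReal (Real.exp (-η * b x)) * g x) ^ p
      ∂(weightMeasure (fun x => w x * Real.exp (η * b x)) p) = ∫⁻ x, g x ^ p ∂(weightMeasure w p) := by
    rw [lintegral_rpow_weightMeasure_mul_exp hw.1 hbm hp.le η hgm]
    refine lintegral_congr fun x => ?_
    rw [← mul_assoc, ← ENNReal.ofReal_mul (Real.exp_pos _).le, ← Real.exp_add]
    simp
  have h := hmain _ hw' _ hgm (by rw [e1]; exact hgp)
  rw [e1] at h
  have e2 := lintegral_rpow_weightMeasure_mul_exp hw.1 hbm hq.le η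
    (aemeasurable_rieszLIntegral α hgm)
  rw [← e2]
  refine h.trans ?_
  have hRA : ENNReal.ofReal (C * R ^ θ) * apqConst p q w ^ θ =
      ENNReal.ofReal C * (ENNReal.ofReal R * apqConst p q w) ^ θ := by
    rw [ENNReal.mul_rpow_of_nonneg _ _ hθ0, ENNReal.ofReal_rpow_of_pos hR0,
      ENNReal.ofReal_mul hC.le, mul_assoc]
  rw [hRA]
  gcongr

/-- The quantitative bound for the iterated commutator, for any `B` dominating `‖b‖_BMO`. -/
theorem exists_fracCommutator_bound {α p q : ℝ} (hE : Exponents n α p q) (m : ℕ) :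
    ∃ C : ℝ, 0 < C ∧ ∀ w b : E n → ℝ, MemApq p q w → LocallyIntegrable b → ∀ B : ℝ, 0 < B →
      bmoNorm b ≤ ENNReal.ofReal B → ∀ f : E n → 𝕜, MemWLp w p f →
        CommutatorConverges α b m f ∧ MemWLp w q (fracCommutator α b m f) ∧
        wNorm w q (fracCommutator α b m f) ≤ ENNReal.ofReal C * ENNReal.ofReal B ^ m *
          apqConst p q w ^ ((m + 1 - α / n) * max 1 (p.conjExponent / q)) * wNorm w p f := by
  obtain ⟨c₀, C, hc₀, hC, hmain⟩ := exists_lintegral_conj_le hE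
  have hq : 0 < q := by linarith [hE.q_gt]
  have hp' : 0 < p.conjExponent := by linarith [hE.conj_gt]
  have hp : 0 < p := by linarith [hE.p_gt]
  set γ := max 1 (p.conjExponent / q) with hγ
  have hκ : 0 < 1 - α / n := by rw [← hE.sum_eq]; positivity
  refine ⟨m.factorial / c₀ ^ m * (2 * C), by positivity, ?_⟩
  intro w b hw hb B hB0 hB f hf
  set A := (apqConst p q w).toReal with hA
  have hAe : apqConst p q w = ENNReal.ofReal A := (ENNReal.ofReal_toReal hw.2.2.ne).symm
  have hA1 : 1 ≤ A := by
    have h1 := one_le_apqConst hq hp' hw.1 hw.2.1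
    rw [hAe] at h1
    exact ENNReal.one_le_ofReal.1 h1
  have hA0 : 0 < A := by linarith
  have hbm : AEMeasurable b := hb.aestronglyMeasurable.aemeasurable
  have hvol : ∀ s, volume ≪ weightMeasure w s :=
    volume_absolutelyContinuous_weightMeasure hw.1 hw.2.1
  have hfm : AEStronglyMeasurable f volume := hf.1.mono_ac (hvol p)
  set g : E n → ℝ≥0∞ := fun y => ‖f y‖ₑ with hg
  have hgm : AEMeasurable g := hfm.enorm
  have hp0 : ENNReal.ofReal p ≠ 0 := (ENNReal.ofReal_pos.2 hp).ne'
  have hq0 : ENNReal.ofReal q ≠ 0 := (ENNReal.ofReal_pos.2 hq).ne'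
  have hnormf : wNorm w p f = (∫⁻ x, g x ^ p ∂(weightMeasure w p)) ^ (1 / p) := by
    rw [wNorm, eLpNorm_eq_lintegral_rpow_enorm_toReal hp0 ENNReal.ofReal_ne_top,
      ENNReal.toReal_ofReal hp.le]
  have hfin : wNorm w p f ≠ ∞ := hf.2.ne
  have hgp : ∫⁻ x, g x ^ p ∂(weightMeasure w p) ≠ ∞ := by
    intro h
    rw [hnormf, h, ENNReal.top_rpow_of_pos (by positivity)] at hfin
    exact hfin rfl
  -- the parameter of the exponential is as large as stability of the weight class permits; each of
  -- the `m` factors `ε⁻¹` then costs `B [w] ^ γ`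
  set ε := c₀ / (B * A ^ γ) with hε
  have hε0 : 0 < ε := by positivity
  have hsm : |ε| * (B * A ^ γ) ≤ c₀ := by
    rw [abs_of_pos hε0, hε, div_mul_cancel₀ _ (by positivity)]
  have hsm' : |(-ε)| * (B * A ^ γ) ≤ c₀ := by rwa [abs_neg]
  set P : E n → ℝ≥0∞ := fun x => ENNReal.ofReal (Real.exp (ε * b x)) *
    rieszLIntegral α (fun y => ENNReal.ofReal (Real.exp (-ε * b y)) * g y) x with hP
  set M : E n → ℝ≥0∞ := fun x => ENNReal.ofReal (Real.exp (-ε * b x)) *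
    rieszLIntegral α (fun y => ENNReal.ofReal (Real.exp (ε * b y)) * g y) x with hM
  have hPm : AEMeasurable P := by
    refine AEMeasurable.mul (by fun_prop) (aemeasurable_rieszLIntegral α (by fun_prop))
  have hMm : AEMeasurable M := by
    refine AEMeasurable.mul (by fun_prop) (aemeasurable_rieszLIntegral α (by fun_prop))
  set N := ENNReal.ofReal C * apqConst p q w ^ ((1 - α / n) * γ) * wNorm w p f with hN
  have hNt : N ≠ ∞ := by
    refine ENNReal.mul_ne_top (ENNReal.mul_ne_top ENNReal.ofReal_ne_top ?_) hfin
    exact ENNReal.rpow_ne_top_of_nonneg (by positivity) hw.2.2.ne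
  have hPb : (∫⁻ x, P x ^ q ∂(weightMeasure w q)) ^ (1 / q) ≤ N := by
    rw [hN, hnormf]
    exact hmain w hw b hb B hB0 hB ε hε0.ne' hsm g hgm hgp
  have hMb : (∫⁻ x, M x ^ q ∂(weightMeasure w q)) ^ (1 / q) ≤ N := by
    rw [hN, hnormf]
    have := hmain w hw b hb B hB0 hB (-ε) (neg_ne_zero.2 hε0.ne') hsm' g hgm hgp
    simpa only [neg_neg] using this
  have hfinite : ∀ G : E n → ℝ≥0∞, AEMeasurable G →
      (∫⁻ x, G x ^ q ∂(weightMeasure w q)) ^ (1 / q) ≤ N → ∀ᵐ x, G x ≠ ∞ := by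
    intro G hG hGN
    have h1 : ∫⁻ x, G x ^ q ∂(weightMeasure w q) ≠ ∞ := by
      intro h
      rw [h, ENNReal.top_rpow_of_pos (by positivity)] at hGN
      exact hNt (top_le_iff.1 hGN)
    have h2 := ae_lt_top' ((hG.mono_ac (weightMeasure_absolutelyContinuous w q)).pow_const q) h1
    filter_upwards [(hvol q).ae_le h2] with x hx ht
    rw [ht, ENNReal.top_rpow_of_pos hq] at hx
    exact lt_irrefl _ hx
  have hKfm : ∀ x, AEStronglyMeasurable (fun y => rieszKernel α x y) (volume : Measure (E n)) := by
    intro x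
    have : Measurable fun y => rieszKernel α x y := by unfold rieszKernel; fun_prop
    exact this.aestronglyMeasurable
  have henorm : ∀ (x y : E n) (t : ℝ), ‖rieszKernel α x y • (t • f y)‖ₑ =
      ENNReal.ofReal (rieszKernel α x y) * (ENNReal.ofReal |t| * g y) := by
    intro x y t
    rw [enorm_smul, enorm_smul, Real.enorm_eq_ofReal (rieszKernel_nonneg α x y),
      Real.enorm_eq_ofReal_abs]
  -- a pointwise bound: `∫ |b x - b y| ^ m K |f| ≤ m! ε⁻ᵐ (P x + M x)`
  have hpt : ∀ x, P x + M x =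
      ∫⁻ y, ENNReal.ofReal (rieszKernel α x y) *
        (ENNReal.ofReal (Real.exp (ε * (b x - b y)) + Real.exp (-ε * (b x - b y))) * g y) := by
    intro x
    have hK := measurable_rieszKernel_right (n := n) α x
    rw [hP, hM]
    simp only [rieszLIntegral]
    rw [← lintegral_const_mul' _ _ ENNReal.ofReal_ne_top,
      ← lintegral_const_mul' _ _ ENNReal.ofReal_ne_top, ← lintegral_add_left' (by fun_prop)]
    refine lintegral_congr fun y => ?_
    rw [ENNReal.ofReal_add (Real.exp_pos _).le (Real.exp_pos _).le,
      show ε * (b x - b y) = ε * b x + -ε * b y by ring,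
      show -ε * (b x - b y) = -ε * b x + ε * b y by ring, Real.exp_add, Real.exp_add,
      ENNReal.ofReal_mul (Real.exp_pos _).le, ENNReal.ofReal_mul (Real.exp_pos _).le]
    ring
  have hdom : ∀ (φ : E n → ℝ) (D : ℝ), 0 ≤ D → ∀ x,
      (∀ y, |φ y| ≤ D * (Real.exp (ε * (b x - b y)) + Real.exp (-ε * (b x - b y)))) →
      ∫⁻ y, ‖rieszKernel α x y • (φ y • f y)‖ₑ ≤ ENNReal.ofReal D * (P x + M x) := by
    intro φ D hD x hφ
    rw [hpt, ← lintegral_const_mul' _ _ ENNReal.ofReal_ne_top]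
    refine lintegral_mono fun y => ?_
    rw [henorm, mul_left_comm (ENNReal.ofReal D), ← mul_assoc (ENNReal.ofReal D),
      ← ENNReal.ofReal_mul hD]
    gcongr
    exact hφ y
  have hconv : CommutatorConverges α b m f := by
    filter_upwards [hfinite P hPm hPb, hfinite M hMm hMb] with x hxP hxM j _
    refine ⟨((hKfm x).smul (((hbm.aestronglyMeasurable).pow j).smul hfm)), ?_⟩
    refine lt_of_le_of_lt (hdom (fun y => b y ^ j) (j.factorial / ε ^ j * Real.exp (ε * |b x|))
      (by positivity) x fun y => ?_)
      (ENNReal.mul_lt_top ENNReal.ofReal_lt_top (ENNReal.add_lt_top.2 ⟨hxP.lt_top, hxM.lt_top⟩))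
    rw [abs_pow]
    refine (abs_pow_le_factorial_mul_exp j hε0 (b y)).trans ?_
    rw [mul_assoc]
    refine mul_le_mul_of_nonneg_left ?_ (by positivity)
    refine le_trans ?_ (mul_le_mul_of_nonneg_left (exp_mul_abs_le ε (b x - b y)) (Real.exp_pos _).le)
    rw [← Real.exp_add, ← mul_add]
    refine Real.exp_le_exp.2 (mul_le_mul_of_nonneg_left ?_ hε0.le)
    have := abs_sub_abs_le_abs_sub (b y) (b x)
    rw [abs_sub_comm] at this
    linarith
  have hcomm : ∀ᵐ x, fracCommutator α b m f x =
      ∫ y, rieszKernel α x y • ((b x - b y) ^ m • f y) := by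
    filter_upwards [hconv] with x hx using fracCommutator_eq_integral hx
  have hmeas : AEStronglyMeasurable (fracCommutator α b m f) volume := by
    have hK : Measurable fun z : E n × E n => rieszKernel α z.1 z.2 := by
      unfold rieszKernel; fun_prop
    have hb2 : AEStronglyMeasurable (fun z : E n × E n => (b z.1 - b z.2) ^ m)
        ((volume : Measure (E n)).prod volume) :=
      ((hbm.comp_fst.sub hbm.comp_snd).pow_const m).aestronglyMeasurable
    have h := (hK.aestronglyMeasurable.smul (hb2.smul hfm.comp_snd)).integral_prod_right'
    refine h.congr ?_
    filter_upwards [hcomm] with x hx using hx.symm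
  set D : ℝ := m.factorial / ε ^ m with hD
  have hD0 : 0 < D := by positivity
  have hle : ∀ᵐ x, ‖fracCommutator α b m f x‖ₑ ≤ ENNReal.ofReal D * (P + M) x := by
    filter_upwards [hcomm] with x hx
    rw [hx]
    refine (enorm_integral_le_lintegral_enorm _).trans
      (hdom (fun y => (b x - b y) ^ m) D hD0.le x fun y => ?_)
    rw [abs_pow]
    exact (abs_pow_le_factorial_mul_exp m hε0 _).trans
      (mul_le_mul_of_nonneg_left (exp_mul_abs_le ε _) hD0.le)
  have hac := weightMeasure_absolutelyContinuous w q
  have hbound : wNorm w q (fracCommutator α b m f) ≤ ENNReal.ofReal D * (N + N) := by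
    rw [wNorm, eLpNorm_eq_lintegral_rpow_enorm_toReal hq0 ENNReal.ofReal_ne_top,
      ENNReal.toReal_ofReal hq.le]
    calc _ ≤ (∫⁻ x, (ENNReal.ofReal D * (P + M) x) ^ q ∂(weightMeasure w q)) ^ (1 / q) := by
          refine ENNReal.rpow_le_rpow (lintegral_mono_ae ?_) (by positivity)
          filter_upwards [hac.ae_le hle] with x hx
          exact ENNReal.rpow_le_rpow hx hq.le
      _ = ENNReal.ofReal D * (∫⁻ x, ((P + M) x) ^ q ∂(weightMeasure w q)) ^ (1 / q) := by
          simp_rw [ENNReal.mul_rpow_of_nonneg _ _ hq.le]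
          rw [lintegral_const_mul' _ _ (ENNReal.rpow_ne_top_of_nonneg hq.le ENNReal.ofReal_ne_top),
            ENNReal.mul_rpow_of_nonneg _ _ (by positivity), ← ENNReal.rpow_mul,
            mul_one_div_cancel hq.ne', ENNReal.rpow_one]
      _ ≤ _ := by
          gcongr
          exact (ENNReal.lintegral_Lp_add_le (hPm.mono_ac hac) (hMm.mono_ac hac)
            hE.q_gt.le).trans (add_le_add hPb hMb)
  have hconst : ENNReal.ofReal D * (N + N) = ENNReal.ofReal (m.factorial / c₀ ^ m * (2 * C)) *
      ENNReal.ofReal B ^ m * apqConst p q w ^ ((m + 1 - α / n) * γ) * wNorm w p f := by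
    have hDe : D = m.factorial / c₀ ^ m * (B ^ m * A ^ (m * γ)) := by
      rw [hD, hε, div_pow, mul_pow, ← Real.rpow_natCast (A ^ γ), ← Real.rpow_mul hA0.le,
        mul_comm γ]
      field_simp
    have he : ((m : ℝ) + 1 - α / n) * γ = m * γ + (1 - α / n) * γ := by ring
    rw [he, hN, ← two_mul, hAe, ENNReal.ofReal_rpow_of_pos hA0, ENNReal.ofReal_rpow_of_pos hA0,
      ← ENNReal.ofReal_pow hB0.le, ← ENNReal.ofReal_ofNat 2]
    simp only [← mul_assoc]
    rw [← ENNReal.ofReal_mul (by positivity), ← ENNReal.ofReal_mul (by positivity),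
      ← ENNReal.ofReal_mul (by positivity), ← ENNReal.ofReal_mul (by positivity),
      ← ENNReal.ofReal_mul (by positivity), hDe, Real.rpow_add hA0]
    congr 2
    ring
  refine ⟨hconv, ⟨hmeas.mono_ac hac, ?_⟩, hbound.trans hconst.le⟩
  exact hbound.trans_lt (ENNReal.mul_lt_top ENNReal.ofReal_lt_top
    (ENNReal.add_lt_top.2 ⟨hNt.lt_top, hNt.lt_top⟩))

/-- The weighted bound for the iterated commutators of the fractional integral. -/
theorem exists_wNorm_fracCommutator_le {α p q : ℝ} (hE : Exponents n α p q) (m : ℕ) :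
    ∃ c : ℝ≥0, ∀ (w b : E n → ℝ), MemApq p q w → MemBMO b →
      ∀ f : E n → 𝕜, MemWLp w p f →
        CommutatorConverges α b m f ∧
        MemWLp w q (fracCommutator α b m f) ∧
        wNorm w q (fracCommutator α b m f) ≤
          c * bmoNorm b ^ m *
            apqConst p q w ^ ((m + 1 - α / n) * max 1 (p.conjExponent / q)) * wNorm w p f := by
  obtain ⟨C, hC, hmain⟩ := exists_fracCommutator_bound (𝕜 := 𝕜) hE m
  refine ⟨C.toNNReal, fun w b hw hb f hf => ?_⟩
  set θ := ((m : ℝ) + 1 - α / n) * max 1 (p.conjExponent / q) with hθ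
  have hθ0 : 0 ≤ θ := by
    have h1 : 0 < 1 - α / n := by
      have := hE.q_gt
      have := hE.conj_gt
      rw [← hE.sum_eq]; positivity
    have h2 : (0 : ℝ) ≤ m := by positivity
    have h3 : (0 : ℝ) ≤ m + 1 - α / n := by linarith
    positivity
  set β := (bmoNorm b).toReal with hβ
  have hβe : bmoNorm b = ENNReal.ofReal β := (ENNReal.ofReal_toReal hb.2.ne).symm
  have hβ0 : 0 ≤ β := ENNReal.toReal_nonneg
  have key : ∀ δ : ℝ, 0 < δ → _ := fun δ hδ => hmain w b hw hb.1 (β + δ) (by linarith)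
    (by rw [hβe]; exact ENNReal.ofReal_le_ofReal (by linarith)) f hf
  refine ⟨(key 1 one_pos).1, (key 1 one_pos).2.1, ?_⟩
  -- the norm of `b` may vanish, so the bound is obtained by letting `B` decrease to it
  have hX : apqConst p q w ^ θ * wNorm w p f ≠ ∞ :=
    ENNReal.mul_ne_top (ENNReal.rpow_ne_top_of_nonneg hθ0 hw.2.2.ne) hf.2.ne
  have hlim : Tendsto (fun δ : ℝ => ENNReal.ofReal (C * (β + δ) ^ m) *
      (apqConst p q w ^ θ * wNorm w p f)) (𝓝[>] 0)
      (𝓝 (ENNReal.ofReal (C * (β + 0) ^ m) * (apqConst p q w ^ θ * wNorm w p f))) := by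
    refine ENNReal.Tendsto.mul_const ?_ (Or.inr hX)
    refine ENNReal.tendsto_ofReal (tendsto_nhdsWithin_of_tendsto_nhds ?_)
    exact (Continuous.tendsto (by fun_prop) 0)
  have hle : wNorm w q (fracCommutator α b m f) ≤
      ENNReal.ofReal (C * (β + 0) ^ m) * (apqConst p q w ^ θ * wNorm w p f) := by
    refine ge_of_tendsto hlim ?_
    filter_upwards [self_mem_nhdsWithin] with δ hδ
    have hδ' : 0 < δ := hδ
    refine (key δ hδ').2.2.trans (le_of_eq ?_)
    rw [← ENNReal.ofReal_pow (by linarith), ← ENNReal.ofReal_mul hC.le, mul_assoc]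
  refine hle.trans (le_of_eq ?_)
  rw [add_zero, ENNReal.ofReal_mul hC.le, ENNReal.ofReal_pow hβ0, hβe, mul_assoc, mul_assoc, mul_assoc]
  rfl

end

section

variable {n : ℕ}

/-! ### Radial powers and oscillation over cubes -/

theorem norm_sub_le_of_mem_cube {a x y : E n} {l : ℝ} (hl : 0 ≤ l) (hx : x ∈ cube a l)
    (hy : y ∈ cube a l) : ‖x - y‖ ≤ n * l := by
  have h : ‖x - y‖ ^ 2 ≤ (n * l) ^ 2 := by
    rw [EuclideanSpace.norm_sq_eq]
    calc ∑ i, ‖(x - y) i‖ ^ 2 ≤ ∑ _i : Fin n, l ^ 2 := by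
          refine Finset.sum_le_sum fun i _ => ?_
          have h1 := hx i
          have h2 := hy i
          rw [PiLp.sub_apply, Real.norm_eq_abs]
          exact pow_le_pow_left₀ (abs_nonneg _)
            (abs_le.2 ⟨by linarith [h1.1, h2.2], by linarith [h1.2, h2.1]⟩) 2
      _ = n * l ^ 2 := by simp
      _ ≤ (n * l) ^ 2 := by
          rw [mul_pow]
          refine mul_le_mul_of_nonneg_right ?_ (by positivity)
          exact_mod_cast Nat.le_self_pow two_ne_zero n
  exact le_of_sq_le_sq h (by positivity)

theorem corner_mem_cube (a : E n) {l : ℝ} (hl : 0 ≤ l) : a ∈ cube a l :=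
  fun i => ⟨le_rfl, by linarith⟩

/-- To bound the BMO norm it suffices to bound the oscillation about arbitrary constants. -/
theorem bmoNorm_le_of_forall {b : E n → ℝ} (hb : LocallyIntegrable b) {C : ℝ≥0∞}
    (h : ∀ (a : E n) (l : ℝ), 0 < l → ∃ t : ℝ,
      ∫⁻ x in cube a l, ‖b x - t‖ₑ ≤ C * volume (cube a l)) : bmoNorm b ≤ 2 * C := by
  refine iSup_le fun a => iSup_le fun l => iSup_le fun hl => ?_
  obtain ⟨t, ht⟩ := h a l hl
  have hV0 := volume_cube_ne_zero a hl
  have hVt := volume_cube_ne_top a l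
  have hbi : IntegrableOn b (cube a l) := hb.integrableOn_isCompact (isCompact_cube a l)
  set c := ⨍ y in cube a l, b y with hc
  have hct : ‖c - t‖ₑ * volume (cube a l) ≤ C * volume (cube a l) := by
    have e : volume.real (cube a l) * (c - t) = ∫ y in cube a l, (b y - t) := by
      have hV : volume.real (cube a l) ≠ 0 := (ENNReal.toReal_pos hV0 hVt).ne'
      rw [integral_sub hbi (integrableOn_const (hs := hVt)), setIntegral_const, hc, setAverage_eq,
        smul_eq_mul, smul_eq_mul, mul_sub, mul_inv_cancel_left₀ hV]
    calc ‖c - t‖ₑ * volume (cube a l) = ‖volume.real (cube a l) * (c - t)‖ₑ := by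
          rw [enorm_mul, Real.enorm_eq_ofReal measureReal_nonneg, ofReal_measureReal hVt, mul_comm]
      _ ≤ _ := by
          rw [e]
          exact (enorm_integral_le_lintegral_enorm _).trans ht
  rw [setLAverage_eq, ENNReal.div_le_iff hV0 hVt]
  calc ∫⁻ x in cube a l, ‖b x - c‖ₑ ≤ ∫⁻ x in cube a l, (‖b x - t‖ₑ + ‖c - t‖ₑ) := by
        refine lintegral_mono fun x => ?_
        have : b x - c = (b x - t) - (c - t) := by ring
        rw [this]
        exact enorm_sub_le
    _ = (∫⁻ x in cube a l, ‖b x - t‖ₑ) + ‖c - t‖ₑ * volume (cube a l) := by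
        rw [lintegral_add_right _ measurable_const, setLIntegral_const]
    _ ≤ C * volume (cube a l) + C * volume (cube a l) := add_le_add ht hct
    _ = 2 * C * volume (cube a l) := by ring

/-- The surface measure of the unit sphere of `ℝⁿ`. -/
noncomputable def sphereArea (n : ℕ) : ℝ := n * volume.real (Metric.ball (0 : E n) 1)

theorem sphereArea_pos (hn : 0 < n) : 0 < sphereArea n := by
  have h : 0 < volume.real (Metric.ball (0 : E n) 1) :=
    ENNReal.toReal_pos (Metric.measure_ball_pos _ _ one_pos).ne' measure_ball_lt_top.ne
  have : (0 : ℝ) < n := by exact_mod_cast hn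
  unfold sphereArea; positivity

theorem pow_pred_mul_rpow (hn : 0 < n) {y : ℝ} (hy : 0 < y) (s : ℝ) :
    y ^ (n - 1) * y ^ (s - n) = y ^ (s - 1) := by
  rw [← Real.rpow_natCast, ← Real.rpow_add hy, Nat.cast_sub hn]
  congr 1; push_cast; ring

/-- Integration in polar coordinates of a power of the norm over a radial set `S`, the points of which
are described by the set `s` of their norms. -/
theorem lintegral_radial (hn : 0 < n) {s : Set ℝ} (hs : MeasurableSet s) (hs0 : s ⊆ Set.Ioi 0)
    {S : Set (E n)} (hS : MeasurableSet S) (hSs : ∀ x : E n, x ≠ 0 → (x ∈ S ↔ ‖x‖ ∈ s)) {δ : ℝ}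
    (hint : IntegrableOn (fun y : ℝ => y ^ (δ - 1)) s) :
    ∫⁻ x in S, ENNReal.ofReal (‖x‖ ^ (δ - n)) =
      ENNReal.ofReal (sphereArea n * ∫ y in s, y ^ (δ - 1)) := by
  have : Nonempty (Fin n) := ⟨⟨0, hn⟩⟩
  have hae : ∀ᵐ x : E n, x ≠ 0 := by
    rw [ae_iff]; simp
  have hfin : Module.finrank ℝ (E n) = n := finrank_euclideanSpace_fin
  set f : ℝ → ℝ := s.indicator fun y => y ^ (δ - n) with hf
  have e0 : ∀ y ∈ Set.Ioi (0 : ℝ), y ^ (n - 1) • f y = s.indicator (fun y => y ^ (δ - 1)) y := by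
    intro y hy
    by_cases hys : y ∈ s
    · rw [hf, Set.indicator_of_mem hys, Set.indicator_of_mem hys, smul_eq_mul,
        pow_pred_mul_rpow hn hy]
    · rw [hf, Set.indicator_of_notMem hys, Set.indicator_of_notMem hys, smul_zero]
  have hrad : Integrable (fun x : E n => f ‖x‖) := by
    rw [integrable_fun_norm_addHaar volume, hfin]
    refine (integrableOn_congr_fun e0 measurableSet_Ioi).2 ?_
    exact ((integrable_indicator_iff hs).2 hint).integrableOn
  have hval : ∫ x : E n, f ‖x‖ = sphereArea n * ∫ y in s, y ^ (δ - 1) := by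
    rw [integral_fun_norm_addHaar volume f, hfin, setIntegral_congr_fun measurableSet_Ioi e0,
      setIntegral_indicator hs, Set.inter_eq_right.2 hs0, sphereArea]
    simp [mul_assoc]
  rw [← hval, ofReal_integral_eq_lintegral_ofReal hrad, ← lintegral_indicator hS]
  · refine lintegral_congr_ae ?_
    filter_upwards [hae] with x hx
    by_cases hxS : x ∈ S
    · rw [Set.indicator_of_mem hxS, hf, Set.indicator_of_mem ((hSs x hx).1 hxS)]
    · rw [Set.indicator_of_notMem hxS, hf, Set.indicator_of_notMem (fun h => hxS ((hSs x hx).2 h)),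
        ENNReal.ofReal_zero]
  · refine Eventually.of_forall fun x => ?_
    exact Set.indicator_nonneg (fun y hy => Real.rpow_nonneg (le_of_lt (hs0 hy)) _) _

theorem lintegral_norm_rpow_ball (hn : 0 < n) {δ : ℝ} (hδ : 0 < δ) {R : ℝ} (hR : 0 < R) :
    ∫⁻ x in Metric.ball (0 : E n) R, ENNReal.ofReal (‖x‖ ^ (δ - n)) =
      ENNReal.ofReal (sphereArea n * (R ^ δ / δ)) := by
  rw [lintegral_radial hn (s := Set.Ioo 0 R) measurableSet_Ioo (fun y hy => hy.1)
    measurableSet_ball]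
  · rw [← integral_Ioc_eq_integral_Ioo, ← intervalIntegral.integral_of_le hR.le,
      integral_rpow (Or.inl (by linarith)), sub_add_cancel, Real.zero_rpow hδ.ne', sub_zero]
  · intro x hx
    simp [hx]
  · rw [intervalIntegral.integrableOn_Ioo_rpow_iff hR]
    linarith

theorem lintegral_norm_rpow_compl_ball (hn : 0 < n) {δ : ℝ} (hδ : 0 < δ) {R : ℝ} (hR : 0 < R) :
    ∫⁻ x in (Metric.ball (0 : E n) R)ᶜ, ENNReal.ofReal (‖x‖ ^ (-δ - n)) =
      ENNReal.ofReal (sphereArea n * (R ^ (-δ) / δ)) := by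
  rw [lintegral_radial hn (s := Set.Ici R) measurableSet_Ici (fun y hy => lt_of_lt_of_le hR hy)
    measurableSet_ball.compl]
  · rw [integral_Ici_eq_integral_Ioi, integral_Ioi_rpow_of_lt (by linarith) hR, sub_add_cancel,
      neg_div_neg_eq]
  · intro x _
    simp
  · rw [integrableOn_Ici_iff_integrableOn_Ioi]
    exact integrableOn_Ioi_rpow_of_lt (by linarith) hR

end

section

variable {n : ℕ} {𝕜 : Type*} [RCLike 𝕜]

/-! ### Necessity of BMO -/

theorem fracIntegral_congr_ae {α : ℝ} {f g : E n → 𝕜} (h : f =ᵐ[volume] g) (x : E n) :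
    fracIntegral α f x = fracIntegral α g x :=
  integral_congr_ae (h.mono fun y hy => by simp only [hy])

/-- The commutator is unchanged if `f` is modified on a null set and `b` on a null set not containing
`x`. -/
theorem fracCommutator_congr_ae {α : ℝ} {b b' : E n → ℝ} (hb : b =ᵐ[volume] b') (m : ℕ)
    {f g : E n → 𝕜} (h : f =ᵐ[volume] g) {x : E n} (hx : b x = b' x) :
    fracCommutator α b m f x = fracCommutator α b' m g x := by
  induction m generalizing f g with
  | zero => exact fracIntegral_congr_ae h x
  | succ m ih =>
    change b x • fracCommutator α b m f x - fracCommutator α b m (fun y => b y • f y) x =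
      b' x • fracCommutator α b' m g x - fracCommutator α b' m (fun y => b' y • g y) x
    rw [hx, ih h, ih (f := fun y => b y • f y) (g := fun y => b' y • g y)]
    filter_upwards [hb, h] with y h1 h2
    rw [h1, h2]

/-- Every measurable function has a median with respect to a finite measure. -/
theorem exists_median {X : Type*} [MeasurableSpace X] (μ : Measure X) [IsFiniteMeasure μ]
    (hμ : μ Set.univ ≠ 0) {b : X → ℝ} (hb : Measurable b) :
    ∃ t : ℝ, μ Set.univ / 2 ≤ μ {x | t ≤ b x} ∧ μ Set.univ / 2 ≤ μ {x | b x ≤ t} := by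
  set V := μ Set.univ with hV
  have hVt : V ≠ ∞ := measure_ne_top μ _
  have hV2 : V / 2 < V := ENNReal.half_lt_self hμ hVt
  set S : Set ℝ := {s | V / 2 ≤ μ {x | s ≤ b x}} with hS
  have hmeas : ∀ s, MeasurableSet {x | s ≤ b x} := fun s => measurableSet_le measurable_const hb
  have hne : S.Nonempty := by
    have hmono : Monotone fun k : ℕ => {x | -(k : ℝ) ≤ b x} := fun i j hij x hx => by
      have : (i : ℝ) ≤ j := by exact_mod_cast hij
      simp only [Set.mem_ofPred_eq] at hx ⊢; linarith
    have h := tendsto_measure_iUnion_atTop (μ := μ) hmono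
    have hU : ⋃ k : ℕ, {x | -(k : ℝ) ≤ b x} = Set.univ := by
      refine Set.eq_univ_of_forall fun x => Set.mem_iUnion.2 ?_
      obtain ⟨k, hk⟩ := exists_nat_ge (-b x)
      exact ⟨k, by simp only [Set.mem_ofPred_eq]; linarith⟩
    rw [hU] at h
    obtain ⟨k, hk⟩ := (h.eventually (lt_mem_nhds hV2)).exists
    exact ⟨-(k : ℝ), hk.le⟩
  have hbdd : BddAbove S := by
    have hanti : Antitone fun k : ℕ => {x | (k : ℝ) ≤ b x} := fun i j hij x hx => by
      have : (i : ℝ) ≤ j := by exact_mod_cast hij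
      simp only [Set.mem_ofPred_eq] at hx ⊢; linarith
    have h := tendsto_measure_iInter_atTop (μ := μ) (fun k : ℕ => (hmeas k).nullMeasurableSet) hanti
      ⟨0, measure_ne_top μ _⟩
    have hU : ⋂ k : ℕ, {x | (k : ℝ) ≤ b x} = ∅ := by
      refine Set.eq_empty_of_forall_notMem fun x hx => ?_
      obtain ⟨k, hk⟩ := exists_nat_gt (b x)
      have := Set.mem_iInter.1 hx k
      simp only [Set.mem_ofPred_eq] at this; linarith
    rw [hU, measure_empty] at h
    obtain ⟨k, hk⟩ := (h.eventually (gt_mem_nhds (ENNReal.half_pos hμ))).exists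
    refine ⟨k, fun s hs => ?_⟩
    by_contra hsk
    push Not at hsk
    have h1 : μ {x | s ≤ b x} ≤ μ {x | (k : ℝ) ≤ b x} := measure_mono fun x hx => by
      simp only [Set.mem_ofPred_eq] at hx ⊢; linarith
    exact absurd ((le_trans hs h1).trans_lt hk) (lt_irrefl _)
  refine ⟨sSup S, ?_, ?_⟩
  · obtain ⟨u, hum, hut, huS⟩ := exists_seq_tendsto_sSup hne hbdd
    have hanti : Antitone fun k : ℕ => {x | u k ≤ b x} := fun i j hij x hx => by
      have := hum hij
      simp only [Set.mem_ofPred_eq] at hx ⊢; linarith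
    have h := tendsto_measure_iInter_atTop (μ := μ) (fun k : ℕ => (hmeas (u k)).nullMeasurableSet)
      hanti ⟨0, measure_ne_top μ _⟩
    have hU : ⋂ k : ℕ, {x | u k ≤ b x} ⊆ {x | sSup S ≤ b x} := fun x hx =>
      le_of_tendsto' hut fun k => Set.mem_iInter.1 hx k
    exact (ge_of_tendsto' h huS).trans (measure_mono hU)
  · have hmono : Monotone fun k : ℕ => {x | sSup S + 1 / ((k : ℝ) + 1) ≤ b x} := fun i j hij x hx => by
      have := one_div_le_one_div_of_le (α := ℝ) (by positivity : (0 : ℝ) < (i : ℝ) + 1)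
        (by exact_mod_cast Nat.succ_le_succ hij : (i : ℝ) + 1 ≤ j + 1)
      simp only [Set.mem_ofPred_eq] at hx ⊢; linarith
    have h := tendsto_measure_iUnion_atTop (μ := μ) hmono
    have hle : ∀ k : ℕ, μ {x | sSup S + 1 / ((k : ℝ) + 1) ≤ b x} ≤ V / 2 := fun k => by
      by_contra hk
      push Not at hk
      have h1 := le_csSup hbdd (show sSup S + 1 / ((k : ℝ) + 1) ∈ S from hk.le)
      have h2 : 0 < 1 / ((k : ℝ) + 1) := by positivity
      linarith
    have hU : {x | b x ≤ sSup S}ᶜ ⊆ ⋃ k : ℕ, {x | sSup S + 1 / ((k : ℝ) + 1) ≤ b x} := fun x hx => by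
      simp only [Set.mem_compl_iff, Set.mem_ofPred_eq, not_le] at hx
      obtain ⟨k, hk⟩ := exists_nat_one_div_lt (sub_pos.2 hx)
      exact Set.mem_iUnion.2 ⟨k, by simp only [Set.mem_ofPred_eq]; linarith⟩
    have h2 : μ {x | b x ≤ sSup S}ᶜ ≤ V / 2 := (measure_mono hU).trans (le_of_tendsto' h hle)
    have h3 := measure_add_measure_compl (μ := μ) (measurableSet_le hb measurable_const :
      MeasurableSet {x | b x ≤ sSup S})
    by_contra hlt
    push Not at hlt
    have h4 : V < V / 2 + V / 2 := by
      refine lt_of_eq_of_lt h3.symm ?_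
      exact ENNReal.add_lt_add_of_lt_of_le (h2.trans_lt (hV2.trans hVt.lt_top)).ne hlt h2
    rw [ENNReal.add_halves] at h4
    exact lt_irrefl _ h4

/-- The Riesz kernel is integrable over bounded sets, uniformly in the pole. -/
theorem exists_lintegral_rieszKernel_cube_le {α : ℝ} (hn : 0 < n) (hα : 0 < α) (a : E n) {l : ℝ}
    (hl : 0 < l) : ∃ C : ℝ, ∀ y ∈ cube a l,
      ∫⁻ x in cube a l, ENNReal.ofReal (rieszKernel α x y) ≤ ENNReal.ofReal C := by
  have hn' : (0 : ℝ) < n := by exact_mod_cast hn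
  have hR : 0 < (n : ℝ) * l + 1 := by positivity
  refine ⟨sphereArea n * ((n * l + 1) ^ α / α), fun y hy => ?_⟩
  calc ∫⁻ x in cube a l, ENNReal.ofReal (rieszKernel α x y)
      ≤ ∫⁻ x in Metric.ball y (n * l + 1), ENNReal.ofReal (rieszKernel α x y) := by
        refine lintegral_mono_set fun x hx => ?_
        rw [Metric.mem_ball, dist_eq_norm]
        linarith [norm_sub_le_of_mem_cube hl.le hx hy]
    _ = ∫⁻ x in Metric.ball (0 : E n) (n * l + 1), ENNReal.ofReal (‖x‖ ^ (α - n)) := by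
        rw [← lintegral_indicator measurableSet_ball, ← lintegral_indicator measurableSet_ball,
          ← lintegral_add_right_eq_self _ y]
        refine lintegral_congr fun x => ?_
        by_cases hx : x ∈ Metric.ball (0 : E n) (n * l + 1)
        · have hx' : x + y ∈ Metric.ball y (n * l + 1) := by
            rwa [Metric.mem_ball, dist_eq_norm, add_sub_cancel_right, ← mem_ball_zero_iff]
          rw [Set.indicator_of_mem hx, Set.indicator_of_mem hx', rieszKernel, add_sub_cancel_right,
            one_div, ← Real.rpow_neg (norm_nonneg _), neg_sub]
        · have hx' : x + y ∉ Metric.ball y (n * l + 1) := by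
            rwa [Metric.mem_ball, dist_eq_norm, add_sub_cancel_right, ← mem_ball_zero_iff]
          rw [Set.indicator_of_notMem hx, Set.indicator_of_notMem hx']
    _ ≤ _ := (lintegral_norm_rpow_ball hn hα hR).le

/-- The integrals in the commutator of an indicator function converge almost everywhere on a cube
containing its support. -/
theorem ae_integrable_rieszKernel_pow_indicator {α : ℝ} (hn : 0 < n) (hα : 0 < α) {b : E n → ℝ}
    (hb : Measurable b) {m : ℕ} (hbm : MemLmLoc m b) (a : E n) {l : ℝ} (hl : 0 < l) {F : Set (E n)}
    (hF : MeasurableSet F) (hFQ : F ⊆ cube a l) :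
    ∀ᵐ x ∂(volume.restrict (cube a l)), ∀ j ≤ m,
      Integrable (fun y => rieszKernel α x y • (b y ^ j • F.indicator (fun _ => (1 : 𝕜)) y)) := by
  have hfin : IsFiniteMeasure (volume.restrict (cube a l)) :=
    ⟨by rw [Measure.restrict_apply_univ]; exact (volume_cube_ne_top a l).lt_top⟩
  obtain ⟨C, hC⟩ := exists_lintegral_rieszKernel_cube_le hn hα a hl
  have key : ∀ j ≤ m, ∀ᵐ x ∂(volume.restrict (cube a l)),
      Integrable (fun y => rieszKernel α x y • (b y ^ j • F.indicator (fun _ => (1 : 𝕜)) y)) := by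
    intro j hj
    have h1 : ∫⁻ y in cube a l, ‖b y‖ₑ ^ j < ∞ := by
      rcases Nat.eq_zero_or_pos j with rfl | hj0
      · simpa using (volume_cube_ne_top a l).lt_top
      · have h2 := (hbm (cube a l) (isCompact_cube a l)).mono_exponent
          (p := (j : ℝ≥0∞)) (by exact_mod_cast hj)
        have h3 := lintegral_rpow_enorm_lt_top_of_eLpNorm_lt_top (p := (j : ℝ≥0∞)) (by
          exact_mod_cast hj0.ne') (ENNReal.natCast_ne_top j) h2.2
        simpa using h3
    have hmK : Measurable fun z : E n × E n =>
        ENNReal.ofReal (rieszKernel α z.1 z.2) * (F.indicator 1 z.2 * ‖b z.2‖ₑ ^ j) :=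
      (measurable_rieszKernel α).mul
        (((measurable_one.indicator hF).comp measurable_snd).mul
          ((hb.enorm.pow_const j).comp measurable_snd))
    have h4 : ∫⁻ x in cube a l, ∫⁻ y, ENNReal.ofReal (rieszKernel α x y) *
        (F.indicator 1 y * ‖b y‖ₑ ^ j) < ∞ := by
      rw [lintegral_lintegral_swap hmK.aemeasurable]
      calc ∫⁻ y, ∫⁻ x in cube a l, ENNReal.ofReal (rieszKernel α x y) *
            (F.indicator 1 y * ‖b y‖ₑ ^ j)
          ≤ ∫⁻ y, (cube a l).indicator (fun y => ENNReal.ofReal C * ‖b y‖ₑ ^ j) y := by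
            refine lintegral_mono fun y => ?_
            have hmx : Measurable fun x : E n => ENNReal.ofReal (rieszKernel α x y) := by
              unfold rieszKernel; fun_prop
            rw [lintegral_mul_const _ hmx]
            by_cases hy : y ∈ F
            · rw [Set.indicator_of_mem hy, Set.indicator_of_mem (hFQ hy), Pi.one_apply, one_mul]
              gcongr
              exact hC y (hFQ hy)
            · rw [Set.indicator_of_notMem hy, zero_mul, mul_zero]
              exact zero_le
        _ = ENNReal.ofReal C * ∫⁻ y in cube a l, ‖b y‖ₑ ^ j := by
            rw [lintegral_indicator (measurableSet_cube a l),
              lintegral_const_mul' _ _ ENNReal.ofReal_ne_top]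
        _ < ∞ := ENNReal.mul_lt_top ENNReal.ofReal_lt_top h1
    have h5 := ae_lt_top' (hmK.lintegral_prod_right'.aemeasurable) h4.ne
    filter_upwards [h5] with x hx
    refine ⟨?_, ?_⟩
    · have hK : Measurable fun y => rieszKernel α x y := by unfold rieszKernel; fun_prop
      exact hK.aestronglyMeasurable.smul ((hb.pow_const j).aestronglyMeasurable.smul
        (aestronglyMeasurable_const.indicator hF))
    · refine lt_of_le_of_lt (lintegral_mono fun y => ?_) hx
      by_cases hy : y ∈ F
      · simp only
        rw [Set.indicator_of_mem hy, Set.indicator_of_mem hy, enorm_smul, enorm_smul, enorm_pow,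
          Real.enorm_eq_ofReal (rieszKernel_nonneg α x y), Pi.one_apply, one_mul]
        simp
      · simp [hy]
  filter_upwards [ae_all_iff.2 fun j => ae_all_iff.2 fun hj => key j hj] with x hx using hx

/-- If `b x - b y` keeps a constant sign, there is no cancellation in the commutator of a
nonnegative function. -/
theorem enorm_fracCommutator_indicator_eq {α : ℝ} {b : E n → ℝ} {m : ℕ} {S : Set (E n)}
    (hS : MeasurableSet S) {g : E n → ℝ} (hg : ∀ y, 0 ≤ g y) {x : E n}
    (hxt : (∀ y ∈ S, b y ≤ b x) ∨ ∀ y ∈ S, b x ≤ b y)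
    (hint : ∀ j ≤ m, Integrable
      (fun y => rieszKernel α x y • (b y ^ j • S.indicator (fun y => ((g y : ℝ) : 𝕜)) y))) :
    ‖fracCommutator α b m (S.indicator fun y => ((g y : ℝ) : 𝕜)) x‖ₑ =
      ∫⁻ y in S, ENNReal.ofReal (rieszKernel α x y * (|b x - b y| ^ m * g y)) := by
  rw [fracCommutator_eq_integral hint]
  have hI := integrable_rieszKernel_sub_pow hint
  set φ : E n → ℝ := fun y => rieszKernel α x y * ((b x - b y) ^ m * g y) with hφ
  set ψ : E n → ℝ := fun y => rieszKernel α x y * (|b x - b y| ^ m * g y) with hψ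
  have hψ0 : ∀ y, 0 ≤ ψ y := fun y =>
    mul_nonneg (rieszKernel_nonneg α x y) (mul_nonneg (by positivity) (hg y))
  have e1 : ∀ y, rieszKernel α x y • ((b x - b y) ^ m • S.indicator (fun y => ((g y : ℝ) : 𝕜)) y) =
      ((S.indicator φ y : ℝ) : 𝕜) := by
    intro y
    by_cases hy : y ∈ S
    · rw [Set.indicator_of_mem hy, Set.indicator_of_mem hy, RCLike.real_smul_eq_coe_mul,
        RCLike.real_smul_eq_coe_mul, ← RCLike.ofReal_mul, ← RCLike.ofReal_mul]
    · rw [Set.indicator_of_notMem hy, Set.indicator_of_notMem hy]; simp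
  simp only [e1] at hI ⊢
  rw [integral_ofReal, integral_indicator hS, ← ofReal_norm, RCLike.norm_ofReal]
  have hI' : IntegrableOn φ S := by
    rw [← integrable_indicator_iff hS]
    have := hI.re
    simpa using this
  have hIψ : IntegrableOn ψ S := by
    refine hI'.norm.congr (Eventually.of_forall fun y => ?_)
    simp only [hφ, hψ, norm_mul, norm_pow, Real.norm_eq_abs,
      abs_of_nonneg (rieszKernel_nonneg α x y), abs_of_nonneg (hg y)]
  have hsign : |∫ y in S, φ y| = ∫ y in S, ψ y := by
    rcases hxt with h | h
    · have e3 : ∀ y ∈ S, φ y = ψ y := fun y hy => by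
        simp only [hφ, hψ]
        rw [abs_of_nonneg (sub_nonneg.2 (h y hy))]
      rw [setIntegral_congr_fun hS e3, abs_of_nonneg (integral_nonneg hψ0)]
    · have e3 : ∀ y ∈ S, φ y = (-1) ^ m * ψ y := fun y hy => by
        simp only [hφ, hψ]
        rw [abs_of_nonpos (sub_nonpos.2 (h y hy)), mul_left_comm ((-1) ^ m), ← mul_assoc ((-1) ^ m),
          ← mul_pow, neg_one_mul, neg_neg]
      rw [setIntegral_congr_fun hS e3, integral_const_mul, abs_mul, abs_pow, abs_neg, abs_one,
        one_pow, one_mul, abs_of_nonneg (integral_nonneg hψ0)]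
  rw [hsign, ofReal_integral_eq_lintegral_ofReal hIψ (Eventually.of_forall hψ0)]

/-- On one side of a level `t` of `b`, the commutator of the indicator of the other side dominates
a power of `|b - t|`, since the kernel is positive and `b x - b y` keeps a constant sign. -/
theorem enorm_fracCommutator_indicator_ge {α : ℝ} (hn : 0 < n) (hαn : α < n) {b : E n → ℝ} {m : ℕ}
    {a : E n} {l : ℝ} (hl : 0 < l) {F : Set (E n)} (hF : MeasurableSet F) (hFQ : F ⊆ cube a l)
    {x : E n} (hx : x ∈ cube a l) {t : ℝ}
    (hxt : (∀ y ∈ F, b y ≤ t ∧ t ≤ b x) ∨ ∀ y ∈ F, t ≤ b y ∧ b x ≤ t)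
    (hint : ∀ j ≤ m,
      Integrable (fun y => rieszKernel α x y • (b y ^ j • F.indicator (fun _ => (1 : 𝕜)) y))) :
    ENNReal.ofReal ((n * l) ^ (α - n)) * volume F * ‖b x - t‖ₑ ^ m ≤
      ‖fracCommutator α b m (F.indicator fun _ => (1 : 𝕜)) x‖ₑ := by
  have : Nonempty (Fin n) := ⟨⟨0, hn⟩⟩
  have hn' : (0 : ℝ) < n := by exact_mod_cast hn
  have hne : ∀ᵐ y : E n, y ≠ x := by rw [ae_iff]; simp
  have hsgn : (∀ y ∈ F, b y ≤ b x) ∨ ∀ y ∈ F, b x ≤ b y :=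
    hxt.imp (fun h y hy => (h y hy).1.trans (h y hy).2) fun h y hy => (h y hy).2.trans (h y hy).1
  have e : F.indicator (fun _ => (1 : 𝕜)) = F.indicator fun _ => (((1 : ℝ) : ℝ) : 𝕜) := by simp
  rw [e] at hint ⊢
  rw [enorm_fracCommutator_indicator_eq hF (fun _ => zero_le_one) hsgn hint]
  calc ENNReal.ofReal ((n * l) ^ (α - n)) * volume F * ‖b x - t‖ₑ ^ m
      = ∫⁻ _y in F, ENNReal.ofReal (((n : ℝ) * l) ^ (α - n) * (|b x - t| ^ m * 1)) := by
        rw [setLIntegral_const, ENNReal.ofReal_mul (by positivity), Real.enorm_eq_ofReal_abs,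
          mul_one, ENNReal.ofReal_pow (abs_nonneg _)]
        ring
    _ ≤ _ := by
        refine lintegral_mono_ae ?_
        filter_upwards [ae_restrict_of_ae hne, ae_restrict_mem hF] with y hyx hy
        have hpos : 0 < ‖x - y‖ := norm_pos_iff.2 (sub_ne_zero.2 hyx.symm)
        refine ENNReal.ofReal_le_ofReal (mul_le_mul ?_ ?_ (by positivity) (rieszKernel_nonneg α x y))
        · rw [rieszKernel, one_div, ← Real.rpow_neg hpos.le, neg_sub]
          exact Real.rpow_le_rpow_of_nonpos hpos (norm_sub_le_of_mem_cube hl.le hx (hFQ hy))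
            (by linarith)
        · rw [mul_one, mul_one]
          refine pow_le_pow_left₀ (abs_nonneg _) ?_ m
          rcases hxt with h | h
          · have := h y hy
            rw [abs_of_nonneg (by linarith [this.1, this.2]), abs_of_nonneg (by linarith [this.1, this.2])]
            linarith [this.1]
          · have := h y hy
            rw [abs_of_nonpos (by linarith [this.1, this.2]), abs_of_nonpos (by linarith [this.1, this.2])]
            linarith [this.1]

end

section

variable {n : ℕ} {𝕜 : Type*} [RCLike 𝕜]

/-! ### The restricted bound controls the mean oscillation -/

theorem lintegral_rpow_le_rpow_measure {X : Type*} [MeasurableSpace X] {μ : Measure X} {s t : ℝ}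
    (hs : 0 < s) (hst : s ≤ t) {f : X → ℝ≥0∞} (hf : AEMeasurable f μ) :
    (∫⁻ x, f x ^ s ∂μ) ^ (1 / s) ≤
      (∫⁻ x, f x ^ t ∂μ) ^ (1 / t) * μ Set.univ ^ (1 / s - 1 / t) := by
  have h := eLpNorm'_le_eLpNorm'_mul_rpow_measure_univ hs hst hf.aestronglyMeasurable
  simpa only [eLpNorm', enorm_eq_self] using h

/-- Since `p ≤ q` and `q' ≤ p'`, Hölder's inequality on a cube turns the `A_{p,q}` bound into one for the
exponents `p` and `q'` of the restricted inequality. -/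
theorem MemApq.weightMeasure_rpow_mul_le {α p q : ℝ} (hE : Exponents n α p q) {w : E n → ℝ}
    (hw : MemApq p q w) (a : E n) {l : ℝ} (hl : 0 < l) :
    weightMeasure w p (cube a l) ^ (1 / p) *
      weightMeasure w (-q.conjExponent) (cube a l) ^ (1 / q.conjExponent) ≤
      apqConst p q w ^ (1 / q) * volume (cube a l) ^ (1 + α / n) := by
  have hq : 0 < q := by linarith [hE.q_gt]
  have hp : 0 < p := by linarith [hE.p_gt]
  have hp' : 0 < p.conjExponent := by linarith [hE.conj_gt]
  have hq1 := hE.q_gt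
  have hqc : 1 / q.conjExponent = 1 - 1 / q := by
    have : q - 1 ≠ 0 := by linarith
    rw [Real.conjExponent]; field_simp
  have hq' : 0 < q.conjExponent := by
    rw [Real.conjExponent]; exact div_pos hq (by linarith)
  have hn : (0 : ℝ) < n := by exact_mod_cast hE.dim
  have hαn : 0 < α / n := div_pos hE.α_pos hn
  have hsum := hE.sum_eq
  have hsub := hE.sub_eq
  have hpq : p ≤ q := by
    rw [← one_div_le_one_div hq hp]; linarith
  have hqp : q.conjExponent ≤ p.conjExponent := by
    rw [← one_div_le_one_div hp' hq']; linarith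
  set Q := cube a l with hQ
  have hQm := measurableSet_cube a l
  have hV0 : volume Q ≠ 0 := volume_cube_ne_zero a hl
  have hVt : volume Q ≠ ∞ := volume_cube_ne_top a l
  have hWm : AEMeasurable (fun x => ENNReal.ofReal (w x)) (volume.restrict Q) :=
    hw.1.ennreal_ofReal.restrict
  have hinv : ∀ s : ℝ, weightMeasure w (-s) Q = ∫⁻ x in Q, ((ENNReal.ofReal (w x))⁻¹) ^ s := fun s => by
    rw [weightMeasure_apply _ _ hQm]
    exact lintegral_congr fun x => by rw [ENNReal.inv_rpow, ENNReal.rpow_neg]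
  have h1 := lintegral_rpow_le_rpow_measure hp hpq hWm
  have h2 := lintegral_rpow_le_rpow_measure hq' hqp hWm.inv
  simp only [Pi.inv_apply] at h2
  rw [Measure.restrict_apply_univ, ← weightMeasure_apply _ _ hQm, ← weightMeasure_apply _ _ hQm] at h1
  rw [Measure.restrict_apply_univ, ← hinv, ← hinv] at h2
  have h3 := mul_weightMeasure_le (w := w) hq hp' a hl
  have h4 := ENNReal.rpow_le_rpow h3 (one_div_pos.2 hq).le
  have e1 : q / p.conjExponent * (1 / q) = 1 / p.conjExponent := by field_simp
  rw [ENNReal.mul_rpow_of_nonneg _ _ (by positivity), ENNReal.mul_rpow_of_nonneg _ _ (by positivity),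
    ← ENNReal.rpow_mul, ← ENNReal.rpow_mul, add_mul, e1, one_mul, ← hQ] at h4
  calc _ ≤ (weightMeasure w q Q ^ (1 / q) * volume Q ^ (1 / p - 1 / q)) *
        (weightMeasure w (-p.conjExponent) Q ^ (1 / p.conjExponent) *
          volume Q ^ (1 / q.conjExponent - 1 / p.conjExponent)) := mul_le_mul' h1 h2
    _ = (weightMeasure w q Q ^ (1 / q) * weightMeasure w (-p.conjExponent) Q ^ (1 / p.conjExponent)) *
        (volume Q ^ (1 / p - 1 / q) * volume Q ^ (1 / q.conjExponent - 1 / p.conjExponent)) := by ring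
    _ ≤ (apqConst p q w ^ (1 / q) * volume Q ^ (1 / q + 1 / p.conjExponent)) *
        (volume Q ^ (1 / p - 1 / q) * volume Q ^ (1 / q.conjExponent - 1 / p.conjExponent)) := by
        gcongr
    _ = _ := by
        rw [mul_assoc, ← ENNReal.rpow_add _ _ hV0 hVt, ← ENNReal.rpow_add _ _ hV0 hVt]
        congr 2
        linarith

/-- Hölder's inequality for an integral over a set against a weight. -/
theorem setLIntegral_le_weightMeasure {q : ℝ} (hq : 1 < q) {w : E n → ℝ} (hw : AEMeasurable w)
    (hpos : ∀ᵐ x, 0 < w x) {S : Set (E n)} (hS : MeasurableSet S) {H : E n → ℝ≥0∞}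
    (hH : Measurable H) :
    ∫⁻ x in S, H x ≤ (∫⁻ x in S, H x ^ q ∂(weightMeasure w q)) ^ (1 / q) *
      weightMeasure w (-q.conjExponent) S ^ (1 / q.conjExponent) := by
  have hc := Real.HolderConjugate.conjExponent hq
  have h := ENNReal.lintegral_mul_le_Lp_mul_Lq (volume.restrict S) hc
    (f := fun x => ENNReal.ofReal (w x) * H x) (g := fun x => (ENNReal.ofReal (w x))⁻¹)
    (hw.ennreal_ofReal.restrict.mul hH.aemeasurable) hw.ennreal_ofReal.restrict.inv
  have e1 : ∫⁻ x in S, H x ^ q ∂(weightMeasure w q) =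
      ∫⁻ x in S, (ENNReal.ofReal (w x) * H x) ^ q := by
    rw [weightMeasure, restrict_withDensity hS]
    refine (lintegral_withDensity_eq_lintegral_mul₀ (aemeasurable_weight hw q).restrict
      (hH.pow_const q).aemeasurable).trans (lintegral_congr fun x => ?_)
    rw [Pi.mul_apply, ENNReal.mul_rpow_of_nonneg _ _ (by linarith)]
  have e2 : weightMeasure w (-q.conjExponent) S =
      ∫⁻ x in S, ((ENNReal.ofReal (w x))⁻¹) ^ q.conjExponent := by
    rw [weightMeasure_apply _ _ hS]
    exact lintegral_congr fun x => by rw [ENNReal.inv_rpow, ENNReal.rpow_neg]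
  rw [e1, e2]
  refine le_trans (le_of_eq (lintegral_congr_ae (ae_restrict_of_ae ?_))) h
  filter_upwards [hpos] with x hx
  rw [Pi.mul_apply, mul_right_comm,
    ENNReal.mul_inv_cancel (ENNReal.ofReal_pos.2 hx).ne' ENNReal.ofReal_ne_top, one_mul]

/-- A restricted bound for the commutator controls the oscillation of `b` on every cube. The constant
`t` is a median of `b` on the cube: both sides of it carry half of the volume, and the oscillation
on either side is tested by the indicator of the other one. -/
theorem exists_lintegral_sub_pow_le {α p q : ℝ} (hE : Exponents n α p q) {m : ℕ} {w b : E n → ℝ}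
    (hw : MemApq p q w) (hb : Measurable b) (hbm : MemLmLoc m b) {c : ℝ≥0}
    (hc : ∀ F : Set (E n), MeasurableSet F → volume F < ∞ →
      wNorm w q (fracCommutator α b m (F.indicator fun _ => (1 : 𝕜))) ≤
        c * weightMeasure w p F ^ (1 / p)) :
    ∃ C : ℝ≥0, ∀ (a : E n) (l : ℝ), 0 < l → ∃ t : ℝ,
      ∫⁻ x in cube a l, ‖b x - t‖ₑ ^ m ≤ C * volume (cube a l) := by
  have hn := hE.dim
  have hn' : (0 : ℝ) < n := by exact_mod_cast hn
  have hq : 0 < q := by linarith [hE.q_gt]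
  have hp : 0 < p := by linarith [hE.p_gt]
  set k : ℝ := (n : ℝ) ^ (α - n) / 2 with hk
  have hk0 : 0 < k := by positivity
  have hAt : apqConst p q w ^ (1 / q) ≠ ∞ :=
    ENNReal.rpow_ne_top_of_nonneg (by positivity) hw.2.2.ne
  set C₀ : ℝ≥0∞ := c * apqConst p q w ^ (1 / q) / ENNReal.ofReal k with hC₀
  have hC₀t : C₀ ≠ ∞ := ENNReal.div_ne_top (ENNReal.mul_ne_top ENNReal.coe_ne_top hAt)
    (ENNReal.ofReal_pos.2 hk0).ne'
  refine ⟨(C₀ + C₀).toNNReal, fun a l hl => ?_⟩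
  rw [ENNReal.coe_toNNReal (ENNReal.add_ne_top.2 ⟨hC₀t, hC₀t⟩)]
  set Q := cube a l with hQ
  have hQm : MeasurableSet Q := measurableSet_cube a l
  have hV0 : volume Q ≠ 0 := volume_cube_ne_zero a hl
  have hVt : volume Q ≠ ∞ := volume_cube_ne_top a l
  have hfin : IsFiniteMeasure (volume.restrict Q) :=
    ⟨by rw [Measure.restrict_apply_univ]; exact hVt.lt_top⟩
  obtain ⟨t, ht1, ht2⟩ := exists_median (volume.restrict Q)
    (by rwa [Measure.restrict_apply_univ]) hb
  have hm1 : MeasurableSet {x | t ≤ b x} := measurableSet_le measurable_const hb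
  have hm2 : MeasurableSet {x | b x ≤ t} := measurableSet_le hb measurable_const
  rw [Measure.restrict_apply_univ, Measure.restrict_apply hm1] at ht1
  rw [Measure.restrict_apply_univ, Measure.restrict_apply hm2] at ht2
  -- the lower bound of the kernel times half of the volume of the cube
  have hkl : ENNReal.ofReal ((n * l) ^ (α - n)) * (volume Q / 2) =
      ENNReal.ofReal k * ENNReal.ofReal (l ^ α) := by
    rw [hQ, volume_cube, ← ENNReal.ofReal_pow hl.le, ← ENNReal.ofReal_ofNat 2,
      ← ENNReal.ofReal_div_of_pos (by norm_num), ← ENNReal.ofReal_mul (by positivity),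
      ← ENNReal.ofReal_mul (by positivity)]
    congr 1
    rw [Real.mul_rpow hn'.le hl.le, hk, Real.rpow_sub hl, Real.rpow_natCast]
    field_simp
  have hside : ∀ S F : Set (E n), MeasurableSet S → MeasurableSet F → S ⊆ Q → F ⊆ Q →
      volume Q / 2 ≤ volume F →
      (∀ x ∈ S, (∀ y ∈ F, b y ≤ t ∧ t ≤ b x) ∨ ∀ y ∈ F, t ≤ b y ∧ b x ≤ t) →
      ∫⁻ x in S, ‖b x - t‖ₑ ^ m ≤ C₀ * volume Q := by
    intro S F hS hF hSQ hFQ hFV hSF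
    set κ : ℝ≥0∞ := ENNReal.ofReal k * ENNReal.ofReal (l ^ α) with hκ
    set H : E n → ℝ≥0∞ := fun x => κ * ‖b x - t‖ₑ ^ m with hH
    have hHm : Measurable H := by
      have : Measurable fun x => ‖b x - t‖ₑ := (hb.sub_const t).enorm
      exact (this.pow_const m).const_mul κ
    have hpt : ∀ᵐ x ∂(volume.restrict S),
        H x ≤ ‖fracCommutator α b m (F.indicator fun _ => (1 : 𝕜)) x‖ₑ := by
      have h1 := ae_restrict_of_ae_restrict_of_subset hSQ
        (ae_integrable_rieszKernel_pow_indicator (𝕜 := 𝕜) hn hE.α_pos hb hbm a hl hF hFQ)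
      filter_upwards [h1, ae_restrict_mem hS] with x hx hxS
      refine le_trans ?_ (enorm_fracCommutator_indicator_ge hn hE.α_lt hl hF hFQ (hSQ hxS)
        (hSF x hxS) hx)
      change κ * ‖b x - t‖ₑ ^ m ≤ _
      rw [← hkl]
      gcongr
    have hFt : volume F < ∞ := (measure_mono hFQ).trans_lt hVt.lt_top
    have hHn : (∫⁻ x in S, H x ^ q ∂(weightMeasure w q)) ^ (1 / q) ≤
        c * weightMeasure w p F ^ (1 / p) := by
      refine le_trans ?_ (hc F hF hFt)
      rw [wNorm, eLpNorm_eq_lintegral_rpow_enorm_toReal (ENNReal.ofReal_pos.2 hq).ne'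
        ENNReal.ofReal_ne_top, ENNReal.toReal_ofReal hq.le]
      refine ENNReal.rpow_le_rpow (le_trans (lintegral_mono_ae ?_) (setLIntegral_le_lintegral S _))
        (by positivity)
      have hac : (weightMeasure w q).restrict S ≪ volume.restrict S :=
        (weightMeasure_absolutelyContinuous w q).restrict S
      filter_upwards [hac.ae_le hpt] with x hx
      exact ENNReal.rpow_le_rpow hx hq.le
    have hmain : κ * ∫⁻ x in S, ‖b x - t‖ₑ ^ m ≤
        c * (apqConst p q w ^ (1 / q) * volume Q ^ (1 + α / n)) := by
      have hκt : κ ≠ ∞ := ENNReal.mul_ne_top ENNReal.ofReal_ne_top ENNReal.ofReal_ne_top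
      calc κ * ∫⁻ x in S, ‖b x - t‖ₑ ^ m = ∫⁻ x in S, H x := (lintegral_const_mul' _ _ hκt).symm
        _ ≤ _ := setLIntegral_le_weightMeasure hE.q_gt hw.1 hw.2.1 hS hHm
        _ ≤ (c * weightMeasure w p F ^ (1 / p)) *
            weightMeasure w (-q.conjExponent) Q ^ (1 / q.conjExponent) := by
            refine mul_le_mul' hHn (ENNReal.rpow_le_rpow (measure_mono hSQ) ?_)
            rw [Real.conjExponent]
            exact one_div_nonneg.2 (div_nonneg hq.le (by linarith [hE.q_gt]))
        _ ≤ (c * weightMeasure w p Q ^ (1 / p)) *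
            weightMeasure w (-q.conjExponent) Q ^ (1 / q.conjExponent) := by
            gcongr
        _ ≤ _ := by
            rw [mul_assoc]
            exact mul_le_mul_right (hw.weightMeasure_rpow_mul_le hE a hl) _
    have hVα : volume Q ^ (1 + α / n) = volume Q * ENNReal.ofReal (l ^ α) := by
      rw [ENNReal.rpow_add _ _ hV0 hVt, ENNReal.rpow_one, hQ, volume_cube,
        ← ENNReal.ofReal_pow hl.le, ENNReal.ofReal_rpow_of_pos (by positivity),
        ← Real.rpow_natCast l n, ← Real.rpow_mul hl.le, mul_div_cancel₀ _ hn'.ne']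
    have hl0 : ENNReal.ofReal (l ^ α) ≠ 0 := (ENNReal.ofReal_pos.2 (by positivity)).ne'
    have hk' : ENNReal.ofReal k ≠ 0 := (ENNReal.ofReal_pos.2 hk0).ne'
    have hκ0 : κ ≠ 0 := mul_ne_zero hk' hl0
    have hκt : κ ≠ ∞ := ENNReal.mul_ne_top ENNReal.ofReal_ne_top ENNReal.ofReal_ne_top
    rw [hVα] at hmain
    refine (ENNReal.mul_le_mul_iff_right hκ0 hκt).1 (hmain.trans (le_of_eq ?_))
    calc _ = (c * apqConst p q w ^ (1 / q)) * volume Q * ENNReal.ofReal (l ^ α) := by ring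
      _ = (C₀ * ENNReal.ofReal k) * volume Q * ENNReal.ofReal (l ^ α) := by
          rw [hC₀, ENNReal.div_mul_cancel hk' ENNReal.ofReal_ne_top]
      _ = _ := by rw [hκ]; ring
  refine ⟨t, ?_⟩
  set S₁ := {x | t ≤ b x} ∩ Q with hS₁
  set S₂ := {x | b x ≤ t} ∩ Q with hS₂
  have hcover : Q ⊆ S₁ ∪ S₂ := fun x hx => by
    rcases le_total t (b x) with h | h
    · exact Or.inl ⟨h, hx⟩
    · exact Or.inr ⟨h, hx⟩
  calc ∫⁻ x in Q, ‖b x - t‖ₑ ^ m ≤ ∫⁻ x in S₁ ∪ S₂, ‖b x - t‖ₑ ^ m := lintegral_mono_set hcover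
    _ ≤ (∫⁻ x in S₁, ‖b x - t‖ₑ ^ m) + ∫⁻ x in S₂, ‖b x - t‖ₑ ^ m := lintegral_union_le _ _ _
    _ ≤ C₀ * volume Q + C₀ * volume Q := add_le_add
        (hside S₁ S₂ (hm1.inter hQm) (hm2.inter hQm) Set.inter_subset_right Set.inter_subset_right ht2
          fun x hx => Or.inl fun y hy => ⟨hy.1, hx.1⟩)
        (hside S₂ S₁ (hm2.inter hQm) (hm1.inter hQm) Set.inter_subset_right Set.inter_subset_right ht1
          fun x hx => Or.inr fun y hy => ⟨hy.1, hx.1⟩)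
    _ = _ := (add_mul _ _ _).symm

/-- The restricted strong type bound for the commutator forces `b` to have bounded mean
oscillation. -/
theorem memBMO_of_restricted_bound {α p q : ℝ} (hE : Exponents n α p q) {m : ℕ} (hm : 0 < m)
    {w b : E n → ℝ} (hw : MemApq p q w) (hbm : MemLmLoc m b) {c : ℝ≥0}
    (hc : ∀ F : Set (E n), MeasurableSet F → volume F < ∞ →
      wNorm w q (fracCommutator α b m (F.indicator fun _ => (1 : 𝕜))) ≤
        c * weightMeasure w p F ^ (1 / p)) : MemBMO b := by
  have hloc : LocallyIntegrable b := by
    rw [locallyIntegrable_iff]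
    intro K hK
    have : IsFiniteMeasure (volume.restrict K) :=
      ⟨by rw [Measure.restrict_apply_univ]; exact hK.measure_lt_top⟩
    exact (hbm K hK).integrable (by exact_mod_cast hm)
  -- medians are taken of a measurable representative of `b`
  obtain ⟨b', hb'm, hbb'⟩ := hloc.aestronglyMeasurable.aemeasurable
  have hbm' : MemLmLoc m b' := fun K hK => (hbm K hK).ae_eq (ae_restrict_of_ae hbb')
  have hc' : ∀ F : Set (E n), MeasurableSet F → volume F < ∞ →
      wNorm w q (fracCommutator α b' m (F.indicator fun _ => (1 : 𝕜))) ≤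
        c * weightMeasure w p F ^ (1 / p) := fun F hF hFt => by
    refine le_trans (le_of_eq ?_) (hc F hF hFt)
    refine eLpNorm_congr_ae ((weightMeasure_absolutelyContinuous w q).ae_le ?_)
    filter_upwards [hbb'] with x hx
    exact (fracCommutator_congr_ae hbb' m EventuallyEq.rfl hx).symm
  obtain ⟨C, hC⟩ := exists_lintegral_sub_pow_le hE hw hb'm hbm' hc'
  refine ⟨hloc, lt_of_le_of_lt (bmoNorm_le_of_forall hloc (C := 1 + C) fun a l hl => ?_)
    (ENNReal.mul_lt_top (by norm_num) (by rw [ENNReal.add_lt_top]; exact ⟨ENNReal.one_lt_top, ENNReal.coe_lt_top⟩))⟩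
  obtain ⟨t, ht⟩ := hC a l hl
  refine ⟨t, ?_⟩
  calc ∫⁻ x in cube a l, ‖b x - t‖ₑ = ∫⁻ x in cube a l, ‖b' x - t‖ₑ :=
        lintegral_congr_ae (ae_restrict_of_ae (hbb'.mono fun x hx => by simp only [hx]))
    _ ≤ ∫⁻ x in cube a l, (1 + ‖b' x - t‖ₑ ^ m) := by
        refine lintegral_mono fun x => ?_
        rcases le_total ‖b' x - t‖ₑ 1 with h | h
        · exact h.trans le_self_add
        · exact (le_self_pow₀ h hm.ne').trans le_add_self
    _ = volume (cube a l) + ∫⁻ x in cube a l, ‖b' x - t‖ₑ ^ m := by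
        rw [lintegral_add_left measurable_const, setLIntegral_one]
    _ ≤ volume (cube a l) + C * volume (cube a l) := by gcongr
    _ = _ := by ring

end

section

variable {n : ℕ}

/-! ### Power weights and the logarithm -/

theorem ae_ne_zero (hn : 0 < n) : ∀ᵐ x : E n, x ≠ 0 := by
  have : Nonempty (Fin n) := ⟨⟨0, hn⟩⟩
  rw [ae_iff]; simp

/-- Away from the origin the norm is essentially constant on a cube. -/
theorem norm_bounds_of_mem_cube_of_le {a x : E n} {l : ℝ} (hl : 0 < l) (hx : x ∈ cube a l)
    (h : 2 * (n * l) ≤ ‖a‖) : ‖a‖ / 2 ≤ ‖x‖ ∧ ‖x‖ ≤ 2 * ‖a‖ := by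
  have h1 := norm_sub_le_of_mem_cube hl.le hx (corner_mem_cube a hl.le)
  have h2 := abs_le.1 ((abs_norm_sub_norm_le x a).trans h1)
  have h3 : 0 ≤ (n : ℝ) * l := by positivity
  constructor <;> linarith [h2.1, h2.2]

/-- Near the origin a cube is contained in a ball of comparable size. -/
theorem norm_lt_of_mem_cube_of_lt {a x : E n} {l : ℝ} (hl : 0 < l) (hx : x ∈ cube a l)
    (h : ‖a‖ < 2 * (n * l)) : ‖x‖ < 3 * (n * l) := by
  have h1 := norm_sub_le_of_mem_cube hl.le hx (corner_mem_cube a hl.le)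
  have h2 := norm_le_norm_add_norm_sub' x a
  linarith

/-- The constant in `lintegral_cube_norm_rpow_mul_le`. -/
noncomputable def powerWeightConst (n : ℕ) : ℝ := 4 ^ (n : ℝ) + sphereArea n * (3 * n) ^ (n : ℝ)

theorem powerWeightConst_pos (hn : 0 < n) : 0 < powerWeightConst n := by
  have := sphereArea_pos hn
  unfold powerWeightConst; positivity

/-- The product of averages which enters the `A_{p,q}` constant of a power weight whose exponent is
at distance `d` from the critical one. -/
theorem lintegral_cube_norm_rpow_mul_le (hn : 0 < n) {d r : ℝ} (hd : 0 < d) (hd1 : d ≤ 1)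
    (hr : 0 < r) (a : E n) {l : ℝ} (hl : 0 < l) :
    (⨍⁻ x in cube a l, ENNReal.ofReal (‖x‖ ^ (d - n)) ∂volume) *
      (⨍⁻ x in cube a l, ENNReal.ofReal (‖x‖ ^ ((n - d) / r)) ∂volume) ^ r ≤
      ENNReal.ofReal (powerWeightConst n / d) := by
  have hn' : (1 : ℝ) ≤ n := by exact_mod_cast hn
  have hn0 : (0 : ℝ) < n := by linarith
  have hdn : 0 ≤ n - d := by linarith
  have hV0 := volume_cube_ne_zero a hl
  have hVt := volume_cube_ne_top a l
  have hQm := measurableSet_cube a l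
  have hσ := sphereArea_pos hn
  -- bounding an average by a pointwise bound
  have havg : ∀ (f : E n → ℝ) (M : ℝ), (∀ x ∈ cube a l, f x ≤ M) →
      ⨍⁻ x in cube a l, ENNReal.ofReal (f x) ∂volume ≤ ENNReal.ofReal M := by
    intro f M hM
    rw [setLAverage_eq, ENNReal.div_le_iff hV0 hVt, ← setLIntegral_const]
    exact setLIntegral_mono' hQm fun x hx => ENNReal.ofReal_le_ofReal (hM x hx)
  have hsecond : ∀ M : ℝ, 0 < M → (∀ x ∈ cube a l, ‖x‖ ≤ M) →
      (⨍⁻ x in cube a l, ENNReal.ofReal (‖x‖ ^ ((n - d) / r)) ∂volume) ^ r ≤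
        ENNReal.ofReal (M ^ (n - d)) := by
    intro M hM hMx
    calc _ ≤ ENNReal.ofReal (M ^ ((n - d) / r)) ^ r := by
          refine ENNReal.rpow_le_rpow (havg _ _ fun x hx => ?_) hr.le
          exact Real.rpow_le_rpow (norm_nonneg _) (hMx x hx) (by positivity)
      _ = _ := by
          rw [ENNReal.ofReal_rpow_of_pos (by positivity), ← Real.rpow_mul hM.le,
            div_mul_cancel₀ _ hr.ne']
  by_cases hcase : 2 * (n * l) ≤ ‖a‖
  · have ha : 0 < ‖a‖ := lt_of_lt_of_le (by positivity) hcase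
    have h1 := havg (fun x => ‖x‖ ^ (d - n)) ((‖a‖ / 2) ^ (d - n)) fun x hx =>
      Real.rpow_le_rpow_of_nonpos (by positivity) (norm_bounds_of_mem_cube_of_le hl hx hcase).1
        (by linarith)
    have h2 := hsecond (2 * ‖a‖) (by positivity) fun x hx =>
      (norm_bounds_of_mem_cube_of_le hl hx hcase).2
    refine (mul_le_mul' h1 h2).trans ?_
    rw [← ENNReal.ofReal_mul (by positivity)]
    refine ENNReal.ofReal_le_ofReal ?_
    have e : (‖a‖ / 2) ^ (d - n) * (2 * ‖a‖) ^ (n - d) = 4 ^ (n - d) := by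
      rw [← neg_sub (n : ℝ) d, Real.rpow_neg (by positivity), inv_mul_eq_div,
        ← Real.div_rpow (by positivity) (by positivity)]
      congr 1
      field_simp
      norm_num
    rw [e, le_div_iff₀ hd]
    calc (4 : ℝ) ^ (n - d) * d ≤ 4 ^ (n : ℝ) * 1 := by
          gcongr
          · norm_num
          · linarith
      _ ≤ _ := by unfold powerWeightConst; nlinarith [Real.rpow_pos_of_pos (by positivity : (0:ℝ) < 3 * n) n]
  · push Not at hcase
    have hR : 0 < 3 * (n * l) := by positivity
    have h2 := hsecond (3 * (n * l)) hR fun x hx => (norm_lt_of_mem_cube_of_lt hl hx hcase).le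
    have h1 : ⨍⁻ x in cube a l, ENNReal.ofReal (‖x‖ ^ (d - n)) ∂volume ≤
        ENNReal.ofReal (sphereArea n * ((3 * (n * l)) ^ d / d) / l ^ n) := by
      rw [setLAverage_eq, ENNReal.ofReal_div_of_pos (by positivity), volume_cube,
        ENNReal.ofReal_pow hl.le]
      gcongr
      rw [← lintegral_norm_rpow_ball hn hd hR]
      exact lintegral_mono_set fun x hx =>
        mem_ball_zero_iff.2 (norm_lt_of_mem_cube_of_lt hl hx hcase)
    refine (mul_le_mul' h1 h2).trans ?_
    rw [← ENNReal.ofReal_mul (by positivity)]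
    refine ENNReal.ofReal_le_ofReal ?_
    have e : (3 * (n * l)) ^ d * (3 * (n * l)) ^ (n - d) = (3 * n) ^ (n : ℝ) * l ^ n := by
      rw [← Real.rpow_add hR, add_sub_cancel, ← mul_assoc, Real.mul_rpow (by positivity) hl.le,
        Real.rpow_natCast l]
    calc sphereArea n * ((3 * (n * l)) ^ d / d) / l ^ n * (3 * (n * l)) ^ (n - d)
        = sphereArea n * ((3 * (n * l)) ^ d * (3 * (n * l)) ^ (n - d)) / l ^ n / d := by ring
      _ = sphereArea n * (3 * n) ^ (n : ℝ) / d := by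
          rw [e]; field_simp
      _ ≤ _ := by
          unfold powerWeightConst
          gcongr
          linarith [Real.rpow_pos_of_pos (by norm_num : (0:ℝ) < 4) n]

theorem ofReal_norm_rpow_rpow {x : E n} (hx : x ≠ 0) (s t : ℝ) :
    ENNReal.ofReal (‖x‖ ^ s) ^ t = ENNReal.ofReal (‖x‖ ^ (s * t)) := by
  have h : 0 < ‖x‖ := norm_pos_iff.2 hx
  rw [ENNReal.ofReal_rpow_of_pos (by positivity), ← Real.rpow_mul h.le]

theorem measurable_norm_rpow (s : ℝ) : Measurable fun x : E n => ‖x‖ ^ s := by fun_prop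

/-- The `A_{p,q}` constant of a power weight, in terms of the exponents of the two densities. -/
theorem apqConst_norm_rpow_le (hn : 0 < n) {p q s M : ℝ}
    (h : ∀ (a : E n) (l : ℝ), 0 < l →
      (⨍⁻ x in cube a l, ENNReal.ofReal (‖x‖ ^ (s * q)) ∂volume) *
        (⨍⁻ x in cube a l, ENNReal.ofReal (‖x‖ ^ (s * -p.conjExponent)) ∂volume) ^
          (q / p.conjExponent) ≤ ENNReal.ofReal M) :
    MemApq p q (fun x : E n => ‖x‖ ^ s) ∧
      apqConst p q (fun x : E n => ‖x‖ ^ s) ≤ ENNReal.ofReal M := by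
  have hle : apqConst p q (fun x : E n => ‖x‖ ^ s) ≤ ENNReal.ofReal M := by
    refine iSup_le fun a => iSup_le fun l => iSup_le fun hl => ?_
    have e : ∀ t, ⨍⁻ x in cube a l, ENNReal.ofReal (‖x‖ ^ s) ^ t ∂volume =
        ⨍⁻ x in cube a l, ENNReal.ofReal (‖x‖ ^ (s * t)) ∂volume := fun t => by
      rw [setLAverage_eq, setLAverage_eq]
      congr 1
      refine lintegral_congr_ae (ae_restrict_of_ae ?_)
      filter_upwards [ae_ne_zero hn] with x hx using ofReal_norm_rpow_rpow hx s t
    rw [e, e]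
    exact h a l hl
  refine ⟨⟨(measurable_norm_rpow s).aemeasurable, ?_, hle.trans_lt ENNReal.ofReal_lt_top⟩, hle⟩
  filter_upwards [ae_ne_zero hn] with x hx
  have : 0 < ‖x‖ := norm_pos_iff.2 hx
  positivity

/-- The weight whose dual density `w ^ (-p')` is nearly critical at the origin. -/
theorem apqConst_dual_critical_le (hn : 0 < n) {p q d : ℝ} (hp : 0 < p.conjExponent) (hq : 0 < q)
    (hd : 0 < d) (hd1 : d ≤ 1) :
    MemApq p q (fun x : E n => ‖x‖ ^ ((n - d) / p.conjExponent)) ∧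
      apqConst p q (fun x : E n => ‖x‖ ^ ((n - d) / p.conjExponent)) ≤
        ENNReal.ofReal ((powerWeightConst n / d) ^ (q / p.conjExponent)) := by
  refine apqConst_norm_rpow_le hn fun a l hl => ?_
  have h := lintegral_cube_norm_rpow_mul_le hn hd hd1 (div_pos hp hq) a hl
  have h2 := ENNReal.rpow_le_rpow h (div_pos hq hp).le
  have hC : 0 < powerWeightConst n / d := div_pos (powerWeightConst_pos hn) hd
  rw [ENNReal.ofReal_rpow_of_pos hC, ENNReal.mul_rpow_of_nonneg _ _ (div_pos hq hp).le,
    ← ENNReal.rpow_mul, div_mul_div_cancel₀ hq.ne', div_self hp.ne', ENNReal.rpow_one, mul_comm] at h2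
  have e1 : (n - d) / p.conjExponent * q = (n - d) / (p.conjExponent / q) := by field_simp
  have e2 : (n - d) / p.conjExponent * -p.conjExponent = d - n := by field_simp; ring
  rw [e1, e2]
  exact h2

/-- The weight whose density `w ^ q` is nearly critical at the origin. -/
theorem apqConst_critical_le (hn : 0 < n) {p q d : ℝ} (hp : 0 < p.conjExponent) (hq : 0 < q)
    (hd : 0 < d) (hd1 : d ≤ 1) :
    MemApq p q (fun x : E n => ‖x‖ ^ ((d - n) / q)) ∧
      apqConst p q (fun x : E n => ‖x‖ ^ ((d - n) / q)) ≤
        ENNReal.ofReal (powerWeightConst n / d) := by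
  refine apqConst_norm_rpow_le hn fun a l hl => ?_
  have h := lintegral_cube_norm_rpow_mul_le hn hd hd1 (div_pos hq hp) a hl
  have e1 : (d - n) / q * q = d - n := by field_simp
  have e2 : (d - n) / q * -p.conjExponent = (n - d) / (q / p.conjExponent) := by field_simp; ring
  rw [e1, e2]
  exact h

/-- A logarithm is dominated by a small negative power. -/
theorem log_div_le {R t : ℝ} (hR : 0 < R) (ht : 0 < t) :
    Real.log (R / t) ≤ 2 * R ^ (1 / 2 : ℝ) * t ^ (-(1 / 2) : ℝ) := by
  have h := Real.log_le_rpow_div (div_pos hR ht).le (by norm_num : (0 : ℝ) < 1 / 2)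
  rw [Real.div_rpow hR.le ht.le] at h
  rw [Real.rpow_neg ht.le]
  refine h.trans (le_of_eq ?_)
  field_simp

/-- The logarithm oscillates boundedly on balls centred at the origin. -/
theorem lintegral_log_norm_sub_ball_le (hn : 0 < n) {R : ℝ} (hR : 0 < R) :
    ∫⁻ x in Metric.ball (0 : E n) R, ‖Real.log ‖x‖ - Real.log R‖ₑ ≤
      ENNReal.ofReal (2 * (sphereArea n * (R ^ (n : ℝ) / (n - 1 / 2)))) := by
  have hn' : (1 : ℝ) ≤ n := by exact_mod_cast hn
  have hδ : (0 : ℝ) < n - 1 / 2 := by linarith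
  have h := lintegral_norm_rpow_ball hn hδ hR
  rw [show ((n : ℝ) - 1 / 2) - n = -(1 / 2) by ring] at h
  calc ∫⁻ x in Metric.ball (0 : E n) R, ‖Real.log ‖x‖ - Real.log R‖ₑ
      ≤ ∫⁻ x in Metric.ball (0 : E n) R,
          ENNReal.ofReal (2 * R ^ (1 / 2 : ℝ)) * ENNReal.ofReal (‖x‖ ^ (-(1 / 2) : ℝ)) := by
        refine lintegral_mono_ae ?_
        filter_upwards [ae_restrict_of_ae (ae_ne_zero hn), ae_restrict_mem measurableSet_ball]
          with x hx hxR
        have hx0 : 0 < ‖x‖ := norm_pos_iff.2 hx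
        have hxR' : ‖x‖ < R := mem_ball_zero_iff.1 hxR
        rw [← ENNReal.ofReal_mul (by positivity), Real.enorm_eq_ofReal_abs, abs_sub_comm,
          ← Real.log_div hR.ne' hx0.ne',
          abs_of_nonneg (Real.log_nonneg ((one_le_div hx0).2 hxR'.le))]
        exact ENNReal.ofReal_le_ofReal (log_div_le hR hx0)
    _ = _ := by
        rw [lintegral_const_mul' _ _ ENNReal.ofReal_ne_top, h, ← ENNReal.ofReal_mul (by positivity)]
        congr 1
        rw [show (n : ℝ) = 1 / 2 + (n - 1 / 2) by ring, Real.rpow_add hR]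
        ring_nf

theorem locallyIntegrable_log_norm (hn : 0 < n) :
    LocallyIntegrable (fun x : E n => Real.log ‖x‖) := by
  rw [locallyIntegrable_iff]
  intro K hK
  obtain ⟨R, hRpos, hR⟩ := hK.isBounded.subset_ball_lt 0 0
  have h : IntegrableOn (fun x : E n => Real.log ‖x‖ - Real.log R) (Metric.ball 0 R) :=
    ⟨((Real.measurable_log.comp measurable_norm).sub_const _).aestronglyMeasurable,
      (lintegral_log_norm_sub_ball_le hn hRpos).trans_lt ENNReal.ofReal_lt_top⟩
  have h2 : IntegrableOn (fun _ : E n => Real.log R) (Metric.ball 0 R) :=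
    integrableOn_const (hs := measure_ball_lt_top.ne)
  refine ((h.add h2).mono_set hR).congr (Eventually.of_forall fun x => ?_)
  simp

theorem memBMO_log_norm (hn : 0 < n) : MemBMO (fun x : E n => Real.log ‖x‖) := by
  have hloc := locallyIntegrable_log_norm hn
  have hn' : (1 : ℝ) ≤ n := by exact_mod_cast hn
  have hn0 : (0 : ℝ) < n := by linarith
  have hσ := sphereArea_pos hn
  set M : ℝ := 2 * (sphereArea n * ((3 * n) ^ (n : ℝ) / (n - 1 / 2))) with hM
  have hM0 : 0 ≤ M := by
    have : (0 : ℝ) < n - 1 / 2 := by linarith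
    positivity
  refine ⟨hloc, lt_of_le_of_lt (bmoNorm_le_of_forall hloc (C := ENNReal.ofReal (Real.log 2 + M))
    fun a l hl => ?_) (ENNReal.mul_lt_top (by norm_num) ENNReal.ofReal_lt_top)⟩
  by_cases hcase : 2 * (n * l) ≤ ‖a‖
  · have ha : 0 < ‖a‖ := lt_of_lt_of_le (by positivity) hcase
    refine ⟨Real.log ‖a‖, ?_⟩
    rw [← setLIntegral_const]
    refine setLIntegral_mono' (measurableSet_cube a l) fun x hx => ?_
    have h := norm_bounds_of_mem_cube_of_le hl hx hcase
    have hx0 : 0 < ‖x‖ := lt_of_lt_of_le (by positivity) h.1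
    rw [Real.enorm_eq_ofReal_abs]
    refine ENNReal.ofReal_le_ofReal ?_
    have h1 := Real.log_le_log (by positivity) h.1
    have h2 := Real.log_le_log hx0 h.2
    rw [Real.log_div ha.ne' (by norm_num)] at h1
    rw [Real.log_mul (by norm_num) ha.ne'] at h2
    have : |Real.log ‖x‖ - Real.log ‖a‖| ≤ Real.log 2 := abs_le.2 ⟨by linarith, by linarith⟩
    linarith
  · push Not at hcase
    have hR : 0 < 3 * (n * l) := by positivity
    refine ⟨Real.log (3 * (n * l)), ?_⟩
    calc ∫⁻ x in cube a l, ‖Real.log ‖x‖ - Real.log (3 * (n * l))‖ₑ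
        ≤ ∫⁻ x in Metric.ball (0 : E n) (3 * (n * l)),
            ‖Real.log ‖x‖ - Real.log (3 * (n * l))‖ₑ :=
          lintegral_mono_set fun x hx => mem_ball_zero_iff.2 (norm_lt_of_mem_cube_of_lt hl hx hcase)
      _ ≤ _ := lintegral_log_norm_sub_ball_le hn hR
      _ = ENNReal.ofReal (M * l ^ n) := by
          congr 1
          rw [hM, ← mul_assoc 3, Real.mul_rpow (by positivity) hl.le, Real.rpow_natCast l]
          ring
      _ ≤ _ := by
          rw [volume_cube, ← ENNReal.ofReal_pow hl.le, ← ENNReal.ofReal_mul (by positivity)]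
          refine ENNReal.ofReal_le_ofReal ?_
          gcongr
          linarith [Real.log_pos (by norm_num : (1 : ℝ) < 2)]

end

section

variable {n : ℕ} {𝕜 : Type*} [RCLike 𝕜]

/-! ### Sharpness of the exponent -/

theorem lintegral_weightMeasure_norm_rpow (hn : 0 < n) (a r : ℝ) {S : Set (E n)}
    (hS : MeasurableSet S) (u : ℝ) :
    ∫⁻ x in S, ENNReal.ofReal (‖x‖ ^ u) ^ r ∂(weightMeasure (fun x : E n => ‖x‖ ^ a) r) =
      ∫⁻ x in S, ENNReal.ofReal (‖x‖ ^ ((a + u) * r)) := by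
  have hm : ∀ t : ℝ, AEMeasurable (fun x : E n => ENNReal.ofReal (‖x‖ ^ t) ^ r) (volume.restrict S) :=
    fun t => ((measurable_norm_rpow t).ennreal_ofReal.pow_const r).aemeasurable
  rw [weightMeasure, restrict_withDensity hS]
  refine (lintegral_withDensity_eq_lintegral_mul₀ (hm a) (hm u)).trans
    (lintegral_congr_ae (ae_restrict_of_ae ?_))
  filter_upwards [ae_ne_zero hn] with x hx
  have h : 0 < ‖x‖ := norm_pos_iff.2 hx
  rw [Pi.mul_apply, ofReal_norm_rpow_rpow hx, ofReal_norm_rpow_rpow hx,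
    ← ENNReal.ofReal_mul (by positivity), ← Real.rpow_add h, add_mul]

theorem wNorm_indicator_norm_rpow (hn : 0 < n) {r : ℝ} (hr : 0 < r) (a s : ℝ) {S : Set (E n)}
    (hS : MeasurableSet S) :
    wNorm (fun x : E n => ‖x‖ ^ a) r (S.indicator fun x => ((‖x‖ ^ s : ℝ) : 𝕜)) =
      (∫⁻ x in S, ENNReal.ofReal (‖x‖ ^ ((a + s) * r))) ^ (1 / r) := by
  rw [wNorm, eLpNorm_indicator_eq_eLpNorm_restrict hS,
    eLpNorm_eq_lintegral_rpow_enorm_toReal (ENNReal.ofReal_pos.2 hr).ne' ENNReal.ofReal_ne_top,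
    ENNReal.toReal_ofReal hr.le, ← lintegral_weightMeasure_norm_rpow hn a r hS s]
  congr 1
  refine lintegral_congr fun x => ?_
  rw [← ofReal_norm, RCLike.norm_ofReal, abs_of_nonneg (by positivity)]

theorem memWLp_indicator_norm_rpow (hn : 0 < n) {r : ℝ} (hr : 0 < r) (a s : ℝ) {S : Set (E n)}
    (hS : MeasurableSet S) (h : ∫⁻ x in S, ENNReal.ofReal (‖x‖ ^ ((a + s) * r)) ≠ ∞) :
    MemWLp (fun x : E n => ‖x‖ ^ a) r (S.indicator fun x => ((‖x‖ ^ s : ℝ) : 𝕜)) := by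
  refine ⟨?_, ?_⟩
  · have hm : Measurable fun x : E n => ((‖x‖ ^ s : ℝ) : 𝕜) :=
      RCLike.measurable_ofReal.comp (measurable_norm_rpow s)
    exact (hm.indicator hS).aestronglyMeasurable
  · have := wNorm_indicator_norm_rpow (𝕜 := 𝕜) hn hr a s hS
    rw [wNorm] at this
    rw [this]
    exact (ENNReal.rpow_ne_top_of_nonneg (by positivity) h).lt_top

/-- A pointwise lower bound by a multiple of `‖x‖ ^ u` on `S` bounds the weighted norm from below. -/
theorem le_wNorm_norm_rpow (hn : 0 < n) {r M : ℝ} (hr : 0 < r) (a u : ℝ)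
    {S : Set (E n)} (hS : MeasurableSet S) {G : E n → 𝕜}
    (h : ∀ᵐ x ∂(volume.restrict S), ENNReal.ofReal M * ENNReal.ofReal (‖x‖ ^ u) ≤ ‖G x‖ₑ) :
    ENNReal.ofReal M * (∫⁻ x in S, ENNReal.ofReal (‖x‖ ^ ((a + u) * r))) ^ (1 / r) ≤
      wNorm (fun x : E n => ‖x‖ ^ a) r G := by
  rw [wNorm, eLpNorm_eq_lintegral_rpow_enorm_toReal (ENNReal.ofReal_pos.2 hr).ne'
    ENNReal.ofReal_ne_top, ENNReal.toReal_ofReal hr.le, ← lintegral_weightMeasure_norm_rpow hn a r hS u]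
  set μ := weightMeasure (fun x : E n => ‖x‖ ^ a) r with hμ
  have hac : μ.restrict S ≪ volume.restrict S := (weightMeasure_absolutelyContinuous _ r).restrict S
  calc ENNReal.ofReal M * (∫⁻ x in S, ENNReal.ofReal (‖x‖ ^ u) ^ r ∂μ) ^ (1 / r)
      = (∫⁻ x in S, (ENNReal.ofReal M * ENNReal.ofReal (‖x‖ ^ u)) ^ r ∂μ) ^ (1 / r) := by
        simp_rw [ENNReal.mul_rpow_of_nonneg _ _ hr.le]
        rw [lintegral_const_mul' _ _ (ENNReal.rpow_ne_top_of_nonneg hr.le ENNReal.ofReal_ne_top),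
          ENNReal.mul_rpow_of_nonneg _ _ (by positivity), ← ENNReal.rpow_mul,
          mul_one_div_cancel hr.ne', ENNReal.rpow_one]
    _ ≤ (∫⁻ x in S, ‖G x‖ₑ ^ r ∂μ) ^ (1 / r) := by
        refine ENNReal.rpow_le_rpow (lintegral_mono_ae ?_) (by positivity)
        filter_upwards [hac.ae_le h] with x hx
        exact ENNReal.rpow_le_rpow hx hr.le
    _ ≤ _ := ENNReal.rpow_le_rpow (setLIntegral_le_lintegral S _) (by positivity)

/-- Lower bound for the commutator at points outside the unit ball. Only the part
`‖y‖ < exp (-1 / d)` of the ball is used, where `log ‖x‖ - log ‖y‖ ≥ 1 / d`. -/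
theorem le_enorm_fracCommutator_log_ball {α : ℝ} (hn : 0 < n) (hαn : α < n) {m : ℕ} {d : ℝ}
    (hd : 0 < d) {x : E n} (hx : 1 ≤ ‖x‖)
    (hint : ∀ j ≤ m, Integrable (fun y => rieszKernel α x y • (Real.log ‖y‖ ^ j •
      (Metric.ball (0 : E n) 1).indicator (fun y => ((‖y‖ ^ (d - n) : ℝ) : 𝕜)) y))) :
    ENNReal.ofReal (2 ^ (α - n) * sphereArea n * Real.exp (-1) * (1 / d) ^ (m + 1)) *
      ENNReal.ofReal (‖x‖ ^ (α - n)) ≤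
      ‖fracCommutator α (fun y : E n => Real.log ‖y‖) m
        ((Metric.ball (0 : E n) 1).indicator fun y => ((‖y‖ ^ (d - n) : ℝ) : 𝕜)) x‖ₑ := by
  have hx0 : 0 < ‖x‖ := by linarith
  have hlogx := Real.log_nonneg hx
  have hσ := sphereArea_pos hn
  set ρ := Real.exp (-1 / d) with hρ
  have hρ0 : 0 < ρ := Real.exp_pos _
  have hρ1 : ρ ≤ 1 := Real.exp_le_one_iff.2 (div_nonpos_of_nonpos_of_nonneg (by norm_num) hd.le)
  have hρd : ρ ^ d = Real.exp (-1) := by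
    rw [hρ, ← Real.exp_mul, div_mul_cancel₀ _ hd.ne']
  rw [enorm_fracCommutator_indicator_eq measurableSet_ball (fun y => by positivity)
    (Or.inl fun y hy => (Real.log_nonpos (norm_nonneg y) (mem_ball_zero_iff.1 hy).le).trans hlogx)
    hint]
  have hball := lintegral_norm_rpow_ball hn hd hρ0
  rw [hρd] at hball
  calc _ = ENNReal.ofReal ((2 * ‖x‖) ^ (α - n) * (1 / d) ^ m) *
        ∫⁻ y in Metric.ball (0 : E n) ρ, ENNReal.ofReal (‖y‖ ^ (d - n)) := by
        rw [hball, ← ENNReal.ofReal_mul (by positivity), ← ENNReal.ofReal_mul (by positivity),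
          Real.mul_rpow (by norm_num) hx0.le]
        congr 1
        rw [pow_succ]
        ring
    _ = ∫⁻ y in Metric.ball (0 : E n) ρ,
          ENNReal.ofReal ((2 * ‖x‖) ^ (α - n) * ((1 / d) ^ m * ‖y‖ ^ (d - n))) := by
        rw [← lintegral_const_mul' _ _ ENNReal.ofReal_ne_top]
        refine lintegral_congr fun y => ?_
        rw [← ENNReal.ofReal_mul (by positivity), mul_assoc]
    _ ≤ ∫⁻ y in Metric.ball (0 : E n) ρ, ENNReal.ofReal (rieszKernel α x y *
          (|Real.log ‖x‖ - Real.log ‖y‖| ^ m * ‖y‖ ^ (d - n))) := by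
        refine lintegral_mono_ae ?_
        filter_upwards [ae_restrict_of_ae (ae_ne_zero hn), ae_restrict_mem measurableSet_ball]
          with y hy0 hy
        have hyρ : ‖y‖ < ρ := mem_ball_zero_iff.1 hy
        have hypos : 0 < ‖y‖ := norm_pos_iff.2 hy0
        have hxy : 0 < ‖x - y‖ := by
          have := norm_sub_norm_le x y
          linarith
        have hxy2 : ‖x - y‖ ≤ 2 * ‖x‖ := by
          have := norm_sub_le x y
          linarith
        have hlog : Real.log ‖y‖ ≤ -1 / d := by
          rw [← Real.log_exp (-1 / d)]
          exact Real.log_le_log hypos hyρ.le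
        refine ENNReal.ofReal_le_ofReal (mul_le_mul ?_ ?_ (by positivity) (rieszKernel_nonneg α x y))
        · rw [rieszKernel, one_div, ← Real.rpow_neg hxy.le, neg_sub]
          exact Real.rpow_le_rpow_of_nonpos hxy hxy2 (by linarith)
        · refine mul_le_mul_of_nonneg_right (pow_le_pow_left₀ (by positivity) ?_ m) (by positivity)
          refine le_trans ?_ (le_abs_self _)
          rw [neg_div] at hlog
          linarith
    _ ≤ _ := lintegral_mono_set (Metric.ball_subset_ball hρ1)

/-- Lower bound for the commutator at points of the unit ball. Only the part
`‖y‖ ≥ exp (1 / d)` of the complement is used, where `log ‖y‖ - log ‖x‖ ≥ 1 / d`. -/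
theorem le_enorm_fracCommutator_log_compl_ball {α : ℝ} (hn : 0 < n) (hαn : α < n) {m : ℕ} {d : ℝ}
    (hd : 0 < d) {x : E n} (hx : ‖x‖ < 1)
    (hint : ∀ j ≤ m, Integrable (fun y => rieszKernel α x y • (Real.log ‖y‖ ^ j •
      (Metric.ball (0 : E n) 1)ᶜ.indicator (fun y => ((‖y‖ ^ (-α - d) : ℝ) : 𝕜)) y))) :
    ENNReal.ofReal (2 ^ (α - n) * sphereArea n * Real.exp (-1) * (1 / d) ^ (m + 1)) ≤
      ‖fracCommutator α (fun y : E n => Real.log ‖y‖) m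
        ((Metric.ball (0 : E n) 1)ᶜ.indicator fun y => ((‖y‖ ^ (-α - d) : ℝ) : 𝕜)) x‖ₑ := by
  have hlogx := Real.log_nonpos (norm_nonneg x) hx.le
  have hσ := sphereArea_pos hn
  have hmem : ∀ {R : ℝ} {y : E n}, y ∈ (Metric.ball (0 : E n) R)ᶜ ↔ R ≤ ‖y‖ := by simp
  set ρ := Real.exp (1 / d) with hρ
  have hρ0 : 0 < ρ := Real.exp_pos _
  have hρ1 : 1 < ρ := Real.one_lt_exp_iff.2 (by positivity)
  have hρd : ρ ^ (-d) = Real.exp (-1) := by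
    rw [hρ, ← Real.exp_mul]
    congr 1
    field_simp
  rw [enorm_fracCommutator_indicator_eq measurableSet_ball.compl (fun y => by positivity)
    (Or.inr fun y hy => hlogx.trans (Real.log_nonneg (hmem.1 hy))) hint]
  have hball := lintegral_norm_rpow_compl_ball hn hd hρ0
  rw [hρd] at hball
  calc _ = ENNReal.ofReal (2 ^ (α - n) * (1 / d) ^ m) *
        ∫⁻ y in (Metric.ball (0 : E n) ρ)ᶜ, ENNReal.ofReal (‖y‖ ^ (-d - n)) := by
        rw [hball, ← ENNReal.ofReal_mul (by positivity)]
        congr 1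
        rw [pow_succ]
        ring
    _ = ∫⁻ y in (Metric.ball (0 : E n) ρ)ᶜ,
          ENNReal.ofReal ((2 ^ (α - n) * (1 / d) ^ m) * ‖y‖ ^ (-d - n)) := by
        rw [← lintegral_const_mul' _ _ ENNReal.ofReal_ne_top]
        refine lintegral_congr fun y => ?_
        rw [← ENNReal.ofReal_mul (by positivity)]
    _ ≤ ∫⁻ y in (Metric.ball (0 : E n) ρ)ᶜ, ENNReal.ofReal (rieszKernel α x y *
          (|Real.log ‖x‖ - Real.log ‖y‖| ^ m * ‖y‖ ^ (-α - d))) := by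
        refine setLIntegral_mono' measurableSet_ball.compl fun y hy => ?_
        have hyρ : ρ ≤ ‖y‖ := hmem.1 hy
        have hypos : 0 < ‖y‖ := by linarith
        have hxy : 0 < ‖x - y‖ := by
          have := norm_sub_norm_le y x
          rw [norm_sub_rev] at this
          linarith
        have hxy2 : ‖x - y‖ ≤ 2 * ‖y‖ := by
          have := norm_sub_le x y
          linarith
        have hlog : 1 / d ≤ Real.log ‖y‖ := by
          rw [← Real.log_exp (1 / d)]
          exact Real.log_le_log hρ0 hyρ
        have hsplit : (2 ^ (α - n) * (1 / d) ^ m) * ‖y‖ ^ (-d - n) =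
            (2 * ‖y‖) ^ (α - n) * ((1 / d) ^ m * ‖y‖ ^ (-α - d)) := by
          rw [Real.mul_rpow (by norm_num) hypos.le, show -d - (n : ℝ) = (α - n) + (-α - d) by ring,
            Real.rpow_add hypos]
          ring
        rw [hsplit]
        refine ENNReal.ofReal_le_ofReal (mul_le_mul ?_ ?_ (by positivity) (rieszKernel_nonneg α x y))
        · rw [rieszKernel, one_div, ← Real.rpow_neg hxy.le, neg_sub]
          exact Real.rpow_le_rpow_of_nonpos hxy hxy2 (by linarith)
        · refine mul_le_mul_of_nonneg_right (pow_le_pow_left₀ (by positivity) ?_ m) (by positivity)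
          rw [abs_sub_comm]
          refine le_trans ?_ (le_abs_self _)
          linarith
    _ ≤ _ := lintegral_mono_set fun y hy => hmem.2 (hρ1.le.trans (hmem.1 hy))

/-- The extremal examples: for every `d ∈ (0, 1]` there are a power weight with constant at most
`(P / d) ^ (1 / γ)` and a power function of norm at most `C d ^ (-1 / p)` whose commutator with the
logarithm has norm at least `c₁ d ^ (-(m + 1 + 1 / q))`. -/
def ExtremalFamily (𝕜 : Type*) [RCLike 𝕜] (n m : ℕ) (α p q γ P C c₁ : ℝ) : Prop :=
  ∀ d : ℝ, 0 < d → d ≤ 1 → ∃ (a s : ℝ) (S : Set (E n)),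
    (S = Metric.ball 0 1 ∨ S = (Metric.ball 0 1)ᶜ) ∧
    MemApq p q (fun x : E n => ‖x‖ ^ a) ∧
    MemWLp (fun x : E n => ‖x‖ ^ a) p (S.indicator fun x => ((‖x‖ ^ s : ℝ) : 𝕜)) ∧
    apqConst p q (fun x : E n => ‖x‖ ^ a) ≤ ENNReal.ofReal ((P / d) ^ (1 / γ)) ∧
    wNorm (fun x : E n => ‖x‖ ^ a) p (S.indicator fun x => ((‖x‖ ^ s : ℝ) : 𝕜)) ≤
      ENNReal.ofReal (C * d ^ (-(1 / p))) ∧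
    ENNReal.ofReal (c₁ * d ^ (-(m + 1 + 1 / q))) ≤
      wNorm (fun x : E n => ‖x‖ ^ a) q
        (fracCommutator α (fun x : E n => Real.log ‖x‖) m
          (S.indicator fun x => ((‖x‖ ^ s : ℝ) : 𝕜)))

theorem one_div_pow_succ_mul_rpow {d σ q : ℝ} (hd : 0 < d) (hσ : 0 ≤ σ) (m : ℕ) (k : ℝ) :
    k * (1 / d) ^ (m + 1) * (σ / d) ^ (1 / q) = k * σ ^ (1 / q) * d ^ (-(m + 1 + 1 / q)) := by
  have e : d ^ (-((m : ℝ) + 1 + 1 / q)) = (d ^ (m + 1))⁻¹ * (d ^ (1 / q))⁻¹ := by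
    rw [neg_add, Real.rpow_add hd, Real.rpow_neg hd.le, Real.rpow_neg hd.le]
    congr 2
    exact_mod_cast Real.rpow_natCast d (m + 1)
  rw [e, Real.div_rpow hσ hd.le, one_div_pow]
  ring

/-- The examples on the unit ball, where `w ^ (-p')` is nearly critical at the origin: they give the
exponent `(m + 1 - α / n) p' / q`. -/
theorem exists_extremalFamily_ball {α p q : ℝ} (hE : Exponents n α p q) (m : ℕ) :
    ∃ P C c₁ : ℝ, 0 < P ∧ 0 < c₁ ∧
      ExtremalFamily 𝕜 n m α p q (p.conjExponent / q) P C c₁ := by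
  have hn := hE.dim
  have hn0 : (0 : ℝ) < n := by exact_mod_cast hn
  have hσ := sphereArea_pos hn
  have hq : 0 < q := by linarith [hE.q_gt]
  have hp : 0 < p := by linarith [hE.p_gt]
  have hp' : 0 < p.conjExponent := by linarith [hE.conj_gt]
  set k : ℝ := 2 ^ (α - n) * sphereArea n * Real.exp (-1) with hk
  have hk0 : 0 < k := by positivity
  obtain ⟨c, hc⟩ := exists_wNorm_fracCommutator_le (𝕜 := 𝕜) hE m
  refine ⟨powerWeightConst n, sphereArea n ^ (1 / p),
    k * (sphereArea n * (p.conjExponent / q)) ^ (1 / q), powerWeightConst_pos hn, by positivity,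
    fun d hd hd1 => ?_⟩
  set a := (n - d) / p.conjExponent with ha
  obtain ⟨hw, hA⟩ := apqConst_dual_critical_le (n := n) hn hp' hq hd hd1
  have hexp : (a + (d - n)) * p = d - n := by
    have h1 : 1 / p.conjExponent = 1 - 1 / p := by linarith [hE.sub_eq]
    rw [ha, div_eq_mul_one_div, h1]
    field_simp
    ring
  have hexpq : (a + (α - n)) * q = -(d * (q / p.conjExponent)) - n := by
    have h1 : α = n - n * (1 / q) - n * (1 / p.conjExponent) := by
      have := hE.sum_eq
      have h2 : α = n * (α / n) := by field_simp
      rw [h2, show α / n = 1 - 1 / q - 1 / p.conjExponent by linarith]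
      ring
    rw [ha, h1]
    field_simp
    ring
  have hball := lintegral_norm_rpow_ball hn hd one_pos
  rw [Real.one_rpow] at hball
  have hf : MemWLp (fun x : E n => ‖x‖ ^ a) p
      ((Metric.ball 0 1).indicator fun x => ((‖x‖ ^ (d - n) : ℝ) : 𝕜)) :=
    memWLp_indicator_norm_rpow hn hp a _ measurableSet_ball
      (by rw [hexp, hball]; exact ENNReal.ofReal_ne_top)
  refine ⟨a, d - n, Metric.ball 0 1, Or.inl rfl, hw, hf, ?_, ?_, ?_⟩
  · rw [one_div_div]; exact hA
  · rw [wNorm_indicator_norm_rpow hn hp a _ measurableSet_ball, hexp, hball,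
      ENNReal.ofReal_rpow_of_pos (by positivity)]
    refine ENNReal.ofReal_le_ofReal (le_of_eq ?_)
    rw [mul_one_div, Real.div_rpow hσ.le hd.le, Real.rpow_neg hd.le, div_eq_mul_inv]
  · have hconv := (hc _ _ hw (memBMO_log_norm hn) _ hf).1
    have hlow : ∀ᵐ x ∂(volume.restrict (Metric.ball (0 : E n) 1)ᶜ),
        ENNReal.ofReal (k * (1 / d) ^ (m + 1)) * ENNReal.ofReal (‖x‖ ^ (α - n)) ≤
          ‖fracCommutator α (fun y : E n => Real.log ‖y‖) m
            ((Metric.ball (0 : E n) 1).indicator fun y => ((‖y‖ ^ (d - n) : ℝ) : 𝕜)) x‖ₑ := by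
      filter_upwards [ae_restrict_of_ae hconv, ae_restrict_mem measurableSet_ball.compl] with x hx hx1
      refine le_enorm_fracCommutator_log_ball hn hE.α_lt hd ?_ hx
      simpa using hx1
    refine le_trans (le_of_eq ?_) (le_wNorm_norm_rpow hn hq a _ measurableSet_ball.compl hlow)
    have hδ : 0 < d * (q / p.conjExponent) := by positivity
    rw [hexpq, lintegral_norm_rpow_compl_ball hn hδ one_pos, Real.one_rpow,
      ENNReal.ofReal_rpow_of_pos (by positivity), ← ENNReal.ofReal_mul (by positivity)]
    congr 1
    rw [← one_div_pow_succ_mul_rpow hd (by positivity)]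
    congr 2
    field_simp

/-- The examples on the complement of the unit ball, where `w ^ q` is nearly critical at the origin:
they give the exponent `m + 1 - α / n`. -/
theorem exists_extremalFamily_compl_ball {α p q : ℝ} (hE : Exponents n α p q) (m : ℕ) :
    ∃ P C c₁ : ℝ, 0 < P ∧ 0 < c₁ ∧ ExtremalFamily 𝕜 n m α p q 1 P C c₁ := by
  have hn := hE.dim
  have hn0 : (0 : ℝ) < n := by exact_mod_cast hn
  have hσ := sphereArea_pos hn
  have hq : 0 < q := by linarith [hE.q_gt]
  have hp : 0 < p := by linarith [hE.p_gt]
  have hp' : 0 < p.conjExponent := by linarith [hE.conj_gt]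
  have hq1 : 0 < 1 - 1 / q := by
    have : 1 / q < 1 := by rw [div_lt_one hq]; exact hE.q_gt
    linarith
  set k : ℝ := 2 ^ (α - n) * sphereArea n * Real.exp (-1) with hk
  have hk0 : 0 < k := by positivity
  obtain ⟨c, hc⟩ := exists_wNorm_fracCommutator_le (𝕜 := 𝕜) hE m
  refine ⟨powerWeightConst n, (sphereArea n / (p * (1 - 1 / q))) ^ (1 / p),
    k * (sphereArea n) ^ (1 / q), powerWeightConst_pos hn, by positivity,
    fun d hd hd1 => ?_⟩
  set a := (d - n) / q with ha
  obtain ⟨hw, hA⟩ := apqConst_critical_le (n := n) hn hp' hq hd hd1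
  have hexp : (a + (-α - d)) * p = -(d * (p * (1 - 1 / q))) - n := by
    have h1 : α = n * (1 / p) - n * (1 / q) := by
      have h3 := hE.sum_eq
      have h4 := hE.sub_eq
      have h2 : α = n * (α / n) := by field_simp
      rw [h2, show α / n = 1 / p - 1 / q by linarith]
      ring
    rw [ha, h1]
    field_simp
    ring
  have hexpq : (a + 0) * q = d - n := by rw [ha]; field_simp; ring
  have hball := lintegral_norm_rpow_ball hn hd one_pos
  rw [Real.one_rpow] at hball
  have hδ : 0 < d * (p * (1 - 1 / q)) := by positivity
  have hcompl := lintegral_norm_rpow_compl_ball hn hδ one_pos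
  rw [Real.one_rpow] at hcompl
  have hf : MemWLp (fun x : E n => ‖x‖ ^ a) p
      ((Metric.ball 0 1)ᶜ.indicator fun x => ((‖x‖ ^ (-α - d) : ℝ) : 𝕜)) :=
    memWLp_indicator_norm_rpow hn hp a _ measurableSet_ball.compl
      (by rw [hexp, hcompl]; exact ENNReal.ofReal_ne_top)
  refine ⟨a, -α - d, (Metric.ball 0 1)ᶜ, Or.inr rfl, hw, hf, ?_, ?_, ?_⟩
  · rw [div_one, Real.rpow_one]; exact hA
  · rw [wNorm_indicator_norm_rpow hn hp a _ measurableSet_ball.compl, hexp, hcompl,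
      ENNReal.ofReal_rpow_of_pos (by positivity)]
    refine ENNReal.ofReal_le_ofReal (le_of_eq ?_)
    rw [mul_one_div, mul_comm d, ← div_div, Real.div_rpow (by positivity) hd.le,
      Real.rpow_neg hd.le, ← div_eq_mul_inv]
  · have hconv := (hc _ _ hw (memBMO_log_norm hn) _ hf).1
    have hlow : ∀ᵐ x ∂(volume.restrict (Metric.ball (0 : E n) 1)),
        ENNReal.ofReal (k * (1 / d) ^ (m + 1)) * ENNReal.ofReal (‖x‖ ^ (0 : ℝ)) ≤
          ‖fracCommutator α (fun y : E n => Real.log ‖y‖) m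
            ((Metric.ball (0 : E n) 1)ᶜ.indicator fun y => ((‖y‖ ^ (-α - d) : ℝ) : 𝕜)) x‖ₑ := by
      filter_upwards [ae_restrict_of_ae hconv, ae_restrict_mem measurableSet_ball] with x hx hx1
      rw [Real.rpow_zero, ENNReal.ofReal_one, mul_one]
      exact le_enorm_fracCommutator_log_compl_ball hn hE.α_lt hd (mem_ball_zero_iff.1 hx1) hx
    refine le_trans (le_of_eq ?_) (le_wNorm_norm_rpow hn hq a _ measurableSet_ball hlow)
    rw [hexpq, hball, ENNReal.ofReal_rpow_of_pos (by positivity), ← ENNReal.ofReal_mul (by positivity),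
      ← one_div_pow_succ_mul_rpow hd (by positivity), mul_one_div]

/-- An extremal family rules out every exponent below `(m + 1 - α / n) γ`. -/
theorem ExtremalFamily.exists_lt {α p q γ P C c₁ : ℝ} (hE : Exponents n α p q) {m : ℕ}
    (hγ : 0 < γ) (hP : 0 < P) (hc₁ : 0 < c₁)
    (hfam : ExtremalFamily 𝕜 n m α p q γ P C c₁) {θ : ℝ} (hθ : θ < (m + 1 - α / n) * γ) (c : ℝ≥0) :
    ∃ (a s : ℝ) (S : Set (E n)), (S = Metric.ball 0 1 ∨ S = (Metric.ball 0 1)ᶜ) ∧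
      MemApq p q (fun x : E n => ‖x‖ ^ a) ∧
      MemWLp (fun x : E n => ‖x‖ ^ a) p
        (S.indicator fun x => ((‖x‖ ^ s : ℝ) : 𝕜)) ∧
      c * bmoNorm (fun x : E n => Real.log ‖x‖) ^ m *
          apqConst p q (fun x : E n => ‖x‖ ^ a) ^ θ *
          wNorm (fun x : E n => ‖x‖ ^ a) p (S.indicator fun x => ((‖x‖ ^ s : ℝ) : 𝕜)) <
        wNorm (fun x : E n => ‖x‖ ^ a) q
          (fracCommutator α (fun x : E n => Real.log ‖x‖) m
            (S.indicator fun x => ((‖x‖ ^ s : ℝ) : 𝕜))) := by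
  have hn := hE.dim
  have hq : 0 < q := by linarith [hE.q_gt]
  have hp' : 0 < p.conjExponent := by linarith [hE.conj_gt]
  have hκ : 0 < 1 - α / n := by rw [← hE.sum_eq]; positivity
  have hm0 : (0 : ℝ) ≤ m := by positivity
  have hκm : 0 < (m : ℝ) + 1 - α / n := by linarith
  -- constants are at least one, so only nonnegative exponents matter
  set τ := max θ 0 with hτ
  have hτ0 : 0 ≤ τ := le_max_right _ _
  have hτlt : τ < (m + 1 - α / n) * γ := max_lt hθ (by positivity)
  set e := (m : ℝ) + 1 - α / n - τ / γ with he
  have he0 : 0 < e := by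
    have : τ / γ < (m : ℝ) + 1 - α / n := by rwa [div_lt_iff₀ hγ]
    linarith
  set β := (bmoNorm (fun x : E n => Real.log ‖x‖)).toReal with hβ
  have hβe : bmoNorm (fun x : E n => Real.log ‖x‖) = ENNReal.ofReal β :=
    (ENNReal.ofReal_toReal (memBMO_log_norm hn).2.ne).symm
  have hβ0 : 0 ≤ β := ENNReal.toReal_nonneg
  set K : ℝ := c * β ^ m * P ^ (τ / γ) * C with hK
  obtain ⟨d, hd, hd1, hsmall⟩ : ∃ d : ℝ, 0 < d ∧ d ≤ 1 ∧ K * d ^ e < c₁ := by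
    have hlim : Tendsto (fun d : ℝ => K * d ^ e) (𝓝[>] 0) (𝓝 0) := by
      have h1 := (Real.continuousAt_rpow_const 0 e (Or.inr he0.le)).tendsto
      rw [Real.zero_rpow he0.ne'] at h1
      simpa using (tendsto_nhdsWithin_of_tendsto_nhds h1).const_mul K
    obtain ⟨d, h1, h2⟩ := ((hlim.eventually (gt_mem_nhds hc₁)).and
      (Ioo_mem_nhdsGT (one_pos : (0 : ℝ) < 1))).exists
    exact ⟨d, h2.1, h2.2.le, h1⟩
  obtain ⟨a, s, S, hS, hw, hf, hA, hN, hlow⟩ := hfam d hd hd1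
  refine ⟨a, s, S, hS, hw, hf, lt_of_le_of_lt
    (b := ENNReal.ofReal (c * β ^ m * ((P / d) ^ (1 / γ)) ^ τ * (C * d ^ (-(1 / p))))) ?_
    (lt_of_lt_of_le ?_ hlow)⟩
  · have h1 : apqConst p q (fun x : E n => ‖x‖ ^ a) ^ θ ≤
        ENNReal.ofReal (((P / d) ^ (1 / γ)) ^ τ) := by
      calc _ ≤ apqConst p q (fun x : E n => ‖x‖ ^ a) ^ τ :=
            ENNReal.rpow_le_rpow_of_exponent_le (one_le_apqConst hq hp' hw.1 hw.2.1) (le_max_left _ _)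
        _ ≤ _ := by
            rw [← ENNReal.ofReal_rpow_of_pos (by positivity)]
            exact ENNReal.rpow_le_rpow hA hτ0
    have hcc : (c : ℝ≥0∞) = ENNReal.ofReal c := (ENNReal.ofReal_coe_nnreal).symm
    rw [ENNReal.ofReal_mul (by positivity), ENNReal.ofReal_mul (by positivity),
      ENNReal.ofReal_mul (by positivity), ENNReal.ofReal_pow hβ0, hβe, hcc]
    exact mul_le_mul' (mul_le_mul' le_rfl h1) hN
  · refine (ENNReal.ofReal_lt_ofReal_iff (by positivity)).2 ?_
    have e1 : c * β ^ m * ((P / d) ^ (1 / γ)) ^ τ * (C * d ^ (-(1 / p))) =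
        K * d ^ e * d ^ (-(m + 1 + 1 / q)) := by
      have hexp : e + -((m : ℝ) + 1 + 1 / q) = -(τ / γ) + -(1 / p) := by
        have h3 := hE.sum_eq
        have h4 := hE.sub_eq
        rw [he]; linarith
      rw [mul_assoc K, ← Real.rpow_add hd, hexp, Real.rpow_add hd, ← Real.rpow_mul (by positivity),
        one_div_mul_eq_div, Real.div_rpow hP.le hd.le, Real.rpow_neg hd.le (τ / γ), hK]
      ring
    rw [e1]
    exact mul_lt_mul_of_pos_right hsmall (by positivity)

end

end FracComm

open FracComm in
theorem corollary1p4 {𝕜 : Type*} [RCLike 𝕜] (n m : ℕ) (α p q : ℝ)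
    (hα₀ : 0 < α) (hαn : α < n) (hp₁ : 1 < p) (hpα : p < n / α)
    (hq : 1 / q + α / n = 1 / p) :
    -- the weighted bound; the constant depends only on `n, p, q, α, m`
    (∃ c : ℝ≥0, ∀ (w b : E n → ℝ), MemApq p q w → MemBMO b →
      ∀ f : E n → 𝕜, MemWLp w p f →
        CommutatorConverges α b m f ∧
        MemWLp w q (fracCommutator α b m f) ∧
        wNorm w q (fracCommutator α b m f) ≤
          c * bmoNorm b ^ m *
            apqConst p q w ^ ((m + 1 - α / n) * max 1 (p.conjExponent / q)) * wNorm w p f) ∧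
    -- no smaller exponent is possible, already for `b = log |x|`, power weights `|x|^a` and power
    -- functions `|x|^s` restricted to the unit ball or to its complement
    (MemBMO (fun x : E n => Real.log ‖x‖) ∧
      ∀ θ : ℝ, θ < (m + 1 - α / n) * max 1 (p.conjExponent / q) → ∀ c : ℝ≥0,
        ∃ (a s : ℝ) (S : Set (E n)), (S = Metric.ball 0 1 ∨ S = (Metric.ball 0 1)ᶜ) ∧
          MemApq p q (fun x : E n => ‖x‖ ^ a) ∧
          MemWLp (fun x : E n => ‖x‖ ^ a) p
            (S.indicator fun x => ((‖x‖ ^ s : ℝ) : 𝕜)) ∧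
          c * bmoNorm (fun x : E n => Real.log ‖x‖) ^ m *
              apqConst p q (fun x : E n => ‖x‖ ^ a) ^ θ *
              wNorm (fun x : E n => ‖x‖ ^ a) p (S.indicator fun x => ((‖x‖ ^ s : ℝ) : 𝕜)) <
            wNorm (fun x : E n => ‖x‖ ^ a) q
              (fracCommutator α (fun x : E n => Real.log ‖x‖) m
                (S.indicator fun x => ((‖x‖ ^ s : ℝ) : 𝕜)))) ∧
    -- the restricted strong type bound characterizes BMO
    (0 < m → ∀ (w b : E n → ℝ), MemApq p q w → MemLmLoc m b →
      (∃ c : ℝ≥0, ∀ F : Set (E n), MeasurableSet F → volume F < ∞ →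
        wNorm w q (fracCommutator α b m (F.indicator fun _ => (1 : 𝕜))) ≤
          c * weightMeasure w p F ^ (1 / p)) →
      MemBMO b) := by
  have hE := Exponents.of_hyp hα₀ hαn hp₁ hpα hq
  have hq0 : 0 < q := by linarith [hE.q_gt]
  have hp0 : 0 < p.conjExponent := by linarith [hE.conj_gt]
  refine ⟨exists_wNorm_fracCommutator_le hE m, ⟨memBMO_log_norm hE.dim, fun θ hθ c => ?_⟩,
    fun hm w b hw hb ⟨c, hc⟩ => memBMO_of_restricted_bound hE hm hw hb hc⟩
  rcases le_total 1 (p.conjExponent / q) with h | h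
  · rw [max_eq_right h] at hθ
    obtain ⟨P, C, c₁, hP, hc₁, hfam⟩ := exists_extremalFamily_ball (𝕜 := 𝕜) hE m
    exact hfam.exists_lt hE (div_pos hp0 hq0) hP hc₁ hθ c
  · rw [max_eq_left h] at hθ
    obtain ⟨P, C, c₁, hP, hc₁, hfam⟩ := exists_extremalFamily_compl_ball (𝕜 := 𝕜) hE m
    exact hfam.exists_lt hE one_pos hP hc₁ hθ c
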